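/- Let $G$ be a Lie groupoid over $M$, with source and target $s,t:G\to M$ (surjective submersions), multiplication $m:G_2\to G$ (where $gh$ is defined if $s(g)=t(h)$), units $1_x$ and inversion $\iota$. Let $A=\mathrm{Ker}(ds)|_M$, with anchor $\rho=dt|_A:A\to TM$; let $r_g:A_{t(g)}\to T_gG$ be right translation, and let $l_g:A_{s(g)}\to T_gG$ be $d\iota$ followed by left translation. Let $\sigma$ be an Ehresmann connection on $G$, i.e. a smooth bundle map $\sigma:s^*TM\to TG$ with $ds\circ\sigma=\mathrm{Id}$ and $\sigma_{1_x}=d(1)_x$, the differential of the unit map, for all $x\in M$. For $X\in T_{s(g)}M$ and $\alpha\in A_{s(g)}$ put \[\omega_g=r_g^{-1}\circ(\mathrm{Id}-\sigma_g\circ ds),\qquad \lambda_g(X)=dt(\sigma_g(X)),\qquad \lambda_g(\alpha)=-\omega_g(l_g(\alpha)),\] and for composable $g,h$ and $X\in T_{s(h)}M$ let the basic curvature $K(g,h)X=K^{\mathrm{bas}}_\sigma(g,h)X\in A_{t(g)}$ be defined by \[r_{gh}\big(K(g,h)X\big)=(dm)_{g,h}\big(\sigma_g(\lambda_hX),\sigma_h(X)\big)-\sigma_{gh}(X).\]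 Then these are well defined; $r_g$ is an isomorphism onto $\mathrm{Ker}(ds)_g$, with $\omega_g\circ r_g=\mathrm{Id}$ and $r_g\circ\omega_g+\sigma_g\circ ds=\mathrm{Id}$. Moreover: 1. $\rho(\lambda_g(\alpha))=\lambda_g(\rho(\alpha))$ for all $g\in G$ and $\alpha\in A_{s(g)}$. 2. For composable $g,h$, $X\in T_{s(h)}M$ and $\alpha\in A_{s(h)}$, \[\lambda_g\lambda_h(X)-\lambda_{gh}(X)=\rho(K(g,h)X),\qquad \lambda_g\lambda_h(\alpha)-\lambda_{gh}(\alpha)=K(g,h)(\rho(\alpha)).\] 3. For composable $g,h,k$, \[\lambda_gK(h,k)-K(gh,k)+K(g,hk)-K(g,h)\lambda_k=0.\] 4. The sequence $R_0=\rho$, $R_1=\lambda$, $R_2=K$, $R_k=0$ for $k\ge3$, makes the adjoint complex $E=(A\xrightarrow{\ \rho\ }TM)$, with $A$ in degree $0$ and $TM$ in degree $1$, a unital representation up to homotopy of $G$. Precisely: (a) Each $R_k$ is a smooth section over the manifold $G_k$ of strings of $k$ composable arrows ($G_0=M$) of $\mathrm{Hom}(s^*E^\bullet,t^*E^{\bullet+1-k})$,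 where $t(g_1,\dots,g_k)=t(g_1)$ and $s(g_1,\dots,g_k)=s(g_k)$; and for all $k\ge0$ \[\sum_{j=1}^{k-1}(-1)^jR_{k-1}(g_1,\dots,g_jg_{j+1},\dots,g_k)=\sum_{j=0}^k(-1)^jR_j(g_1,\dots,g_j)\circ R_{k-j}(g_{j+1},\dots,g_k).\] (b) $R_1(g)=\mathrm{Id}$ if $g$ is a unit, and $R_k(g_1,\dots,g_k)=0$ if $k\ge2$ and some $g_i$ is a unit. (c) Let $C(G;E)=\bigoplus_{k,l}C^k(G;E^l)$, $C^k(G;E^l)=\Gamma(G_k,t^*E^l)$, with total degree $k+l$, and $C^r(G)=C^\infty(G_r)$. For $\eta\in C^k(G;E^l)$ and $f\in C^r(G)$ let \[(\eta\star f)(g_1,\dots,g_{k+r})=(-1)^{kr}\eta(g_1,\dots,g_k)f(g_{k+1},\dots,g_{k+r}),\] \[(\delta f)(g_1,\dots,g_{r+1})=(-1)^r\Big\{f(g_2,\dots,g_{r+1})+\sum_{i=1}^r(-1)^if(\dots,g_ig_{i+1},\dots)+(-1)^{r+1}f(g_1,\dots,g_r)\Big\},\] \[(R_j\star\eta)(g_1,\dots,g_{j+k})=(-1)^{j(k+l)}R_j(g_1,\dots,g_j)\big(\eta(g_{j+1},\dots,g_{j+k})\big),\]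 \[(\hat D_0\eta)(g_1,\dots,g_{k+1})=(-1)^{k+l}\Big\{\sum_{i=1}^k(-1)^i\eta(\dots,g_ig_{i+1},\dots)+(-1)^{k+1}\eta(g_1,\dots,g_k)\Big\}.\] (A function or section on $G_0=M$ is evaluated on an empty string at the object where that string sits.) Then $D\eta=\sum_{j}R_j\star\eta+\hat D_0\eta$ is a well-defined linear operator on $C(G;E)$ that raises the total degree by one and satisfies $D^2=0$ and $D(\eta\star f)=D(\eta)\star f+(-1)^{|\eta|}\eta\star\delta(f)$ for all $\eta\in C(G;E)$ homogeneous of total degree $|\eta|$ and all $f\in C^r(G)$, $r\ge0$. -/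

import Mathlib

open scoped Manifold ContDiff

noncomputable section

open Bundle Topology Set

namespace LieGpd

/-- The model space `ℝⁿ`. -/
abbrev EE (n : ℕ) := EuclideanSpace ℝ (Fin n)

/-- A Lie groupoid with object manifold `M` of dimension `m` and arrow manifold `G` of dimension
`n`. Two arrows `g`, `h` are composable, with product `g h`, when `src g = tgt h`; the values of
`mul` on other pairs are irrelevant. Smoothness of `mul` is smoothness on the embedded submanifold
`G₂ = {(g, h) | src g = tgt h}` of `G × G`. -/
structure LieGroupoid (m n : ℕ) (M G : Type*)
    [TopologicalSpace M] [ChartedSpace (EE m) M]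
    [TopologicalSpace G] [ChartedSpace (EE n) G] where
  src : G → M
  tgt : G → M
  unit : M → G
  inv : G → G
  mul : G → G → G
  src_unit : ∀ x, src (unit x) = x
  tgt_unit : ∀ x, tgt (unit x) = x
  src_inv : ∀ g, src (inv g) = tgt g
  tgt_inv : ∀ g, tgt (inv g) = src g
  src_mul : ∀ g h, src g = tgt h → src (mul g h) = src h
  tgt_mul : ∀ g h, src g = tgt h → tgt (mul g h) = tgt g
  mul_assoc : ∀ g h k, src g = tgt h → src h = tgt k → mul (mul g h) k = mul g (mul h k)
  unit_mul : ∀ g, mul (unit (tgt g)) g = g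
  mul_unit : ∀ g, mul g (unit (src g)) = g
  mul_inv : ∀ g, mul g (inv g) = unit (tgt g)
  inv_mul : ∀ g, mul (inv g) g = unit (src g)
  contMDiff_src : ContMDiff (𝓡 n) (𝓡 m) ∞ src
  contMDiff_tgt : ContMDiff (𝓡 n) (𝓡 m) ∞ tgt
  contMDiff_unit : ContMDiff (𝓡 m) (𝓡 n) ∞ unit
  contMDiff_inv : ContMDiff (𝓡 n) (𝓡 n) ∞ inv
  contMDiffOn_mul : ContMDiffOn ((𝓡 n).prod (𝓡 n)) (𝓡 n) ∞
    (fun p : G × G => mul p.1 p.2) {p | src p.1 = tgt p.2}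
  submersion_src : ∀ g, Function.Surjective (mfderiv (𝓡 n) (𝓡 m) src g)
  submersion_tgt : ∀ g, Function.Surjective (mfderiv (𝓡 n) (𝓡 m) tgt g)

variable {m n : ℕ} {M G : Type*}
    [TopologicalSpace M] [ChartedSpace (EE m) M] [IsManifold (𝓡 m) ∞ M]
    [TopologicalSpace G] [ChartedSpace (EE n) G] [IsManifold (𝓡 n) ∞ G]

namespace LieGroupoid
variable (Γ : LieGroupoid m n M G)

/-- The differential `ds` of the source map.

Tangent spaces at equal points are the same type (the model space, read in the preferred chart at
the point), so no transport is written when, for instance, `src (unit x)` is replaced by `x`. -/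
def dsrc (g : G) : TangentSpace (𝓡 n) g →L[ℝ] TangentSpace (𝓡 m) (Γ.src g) :=
  mfderiv (𝓡 n) (𝓡 m) Γ.src g

/-- The fibre `A_x = Ker(ds)` at the unit `1_x`. -/
def Alg (x : M) : Submodule ℝ (TangentSpace (𝓡 n) (Γ.unit x)) :=
  (Γ.dsrc (Γ.unit x)).ker

/-! The smooth vector bundle structure of `A`, as a sub-bundle of the restriction of `TG` to the
units. Near `x₀`, in the trivialisations of `TG` at `1_{x₀}` and of `TM` at `x₀`, one chooses a
linear projection that is complementary to `ds`; its restriction to `Ker(ds)` is the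
trivialisation of `A`. -/

/-- `ds` along the units, in the local trivialisations at `x₀`. -/
def dsCoord (x₀ x : M) : EE n →L[ℝ] EE m :=
  inTangentCoordinates (𝓡 n) (𝓡 m) Γ.unit (fun x => Γ.src (Γ.unit x))
    (fun x => Γ.dsrc (Γ.unit x)) x₀ x

/-- The trivialisation of `TG` at the unit of `x₀`. -/
abbrev trivG (x₀ : M) : Trivialization (EE n) (TotalSpace.proj : TangentBundle (𝓡 n) G → G) :=
  trivializationAt (EE n) (TangentSpace (𝓡 n) : G → Type _) (Γ.unit x₀)
/-- The trivialisation of `TM` at `x₀`. -/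
abbrev trivM (x₀ : M) : Trivialization (EE m) (TotalSpace.proj : TangentBundle (𝓡 m) M → M) :=
  trivializationAt (EE m) (TangentSpace (𝓡 m) : M → Type _) (Γ.src (Γ.unit x₀))

/-- The points at which both trivialisations are defined. -/
def base (x₀ : M) : Set M :=
  {x | Γ.unit x ∈ (Γ.trivG x₀).baseSet ∧ Γ.src (Γ.unit x) ∈ (Γ.trivM x₀).baseSet}

theorem isOpen_base (x₀ : M) : IsOpen (Γ.base x₀) :=
  ((Γ.trivG x₀).open_baseSet.preimage Γ.contMDiff_unit.continuous).inter
    ((Γ.trivM x₀).open_baseSet.preimage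
      (Γ.contMDiff_src.continuous.comp Γ.contMDiff_unit.continuous))

theorem mem_base (x₀ : M) : x₀ ∈ Γ.base x₀ :=
  ⟨mem_baseSet_trivializationAt .., mem_baseSet_trivializationAt ..⟩

theorem dsCoord_self (x₀ : M) : ContMDiffAt (𝓡 m) 𝓘(ℝ, EE n →L[ℝ] EE m) ∞ (Γ.dsCoord x₀) x₀ := by
  refine ContMDiffAt.mfderiv (fun _ => Γ.src) Γ.unit (n := ∞) ?_ Γ.contMDiff_unit.contMDiffAt
    (by simp)
  exact (Γ.contMDiff_src.comp contMDiff_snd).contMDiffAt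

/-- Coordinate changes of `TG` along the units. -/
def cG (x₀ x₁ : M) (x : M) : EE n →L[ℝ] EE n :=
  ((Γ.trivG x₀).coordChangeL ℝ (Γ.trivG x₁) (Γ.unit x) : EE n →L[ℝ] EE n)
/-- Coordinate changes of `TM`. -/
def cM (x₀ x₁ : M) (x : M) : EE m →L[ℝ] EE m :=
  ((Γ.trivM x₀).coordChangeL ℝ (Γ.trivM x₁) (Γ.src (Γ.unit x)) : EE m →L[ℝ] EE m)

theorem contMDiffAt_cG {x₀ x₁ x : M} (h₀ : x ∈ Γ.base x₀) (h₁ : x ∈ Γ.base x₁) :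
    ContMDiffAt (𝓡 m) 𝓘(ℝ, EE n →L[ℝ] EE n) ∞ (Γ.cG x₀ x₁) x :=
  (contMDiffAt_coordChangeL (IB := 𝓡 n) (n := ∞) h₀.1 h₁.1).comp x
    Γ.contMDiff_unit.contMDiffAt

theorem contMDiffAt_cM {x₀ x₁ x : M} (h₀ : x ∈ Γ.base x₀) (h₁ : x ∈ Γ.base x₁) :
    ContMDiffAt (𝓡 m) 𝓘(ℝ, EE m →L[ℝ] EE m) ∞ (Γ.cM x₀ x₁) x :=
  ContMDiffAt.comp x (f := fun x => Γ.src (Γ.unit x))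
    (contMDiffAt_coordChangeL (IB := 𝓡 m) (n := ∞) h₀.2 h₁.2)
    (Γ.contMDiff_src.comp Γ.contMDiff_unit).contMDiffAt

theorem dsCoord_change {x₀ x₁ x : M} (h₀ : x ∈ Γ.base x₀) (h₁ : x ∈ Γ.base x₁) :
    Γ.dsCoord x₀ x = (Γ.cM x₁ x₀ x).comp ((Γ.dsCoord x₁ x).comp (Γ.cG x₀ x₁ x)) := by
  have hG : ∀ v : EE n, (Γ.trivG x₁).symm (Γ.unit x) (Γ.cG x₀ x₁ x v)
      = (Γ.trivG x₀).symm (Γ.unit x) v := by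
    intro v
    have := Trivialization.coordChangeL_apply (R := ℝ) (Γ.trivG x₀) (Γ.trivG x₁) ⟨h₀.1, h₁.1⟩ v
    rw [cG, ContinuousLinearEquiv.coe_coe, this,
      Trivialization.symm_apply_apply_mk _ h₁.1]
  have hM : ∀ w : TangentSpace (𝓡 m) (Γ.src (Γ.unit x)),
      Γ.cM x₁ x₀ x (Γ.trivM x₁ ⟨_, w⟩).2 = (Γ.trivM x₀ ⟨_, w⟩).2 := by
    intro w
    have := Trivialization.coordChangeL_apply (R := ℝ) (Γ.trivM x₁) (Γ.trivM x₀) ⟨h₁.2, h₀.2⟩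
      (Γ.trivM x₁ ⟨_, w⟩).2
    rw [cM, ContinuousLinearEquiv.coe_coe, this,
      Trivialization.symm_apply_apply_mk _ h₁.2]
  ext1 v
  simp only [dsCoord, inTangentCoordinates, ContinuousLinearMap.comp_apply]
  rw [ContinuousLinearMap.inCoordinates_eq h₀.1 h₀.2, ContinuousLinearMap.inCoordinates_eq h₁.1 h₁.2]
  exact ((hM _).trans (congrArg (fun w => (Γ.trivM x₀ ⟨_, Γ.dsrc (Γ.unit x) w⟩).2) (hG v))).symm

theorem contMDiffAt_dsCoord {x₀ x : M} (h₀ : x ∈ Γ.base x₀) :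
    ContMDiffAt (𝓡 m) 𝓘(ℝ, EE n →L[ℝ] EE m) ∞ (Γ.dsCoord x₀) x := by
  have h₁ := Γ.mem_base x
  refine ((Γ.contMDiffAt_cM h₁ h₀).clm_comp ((Γ.dsCoord_self x).clm_comp
    (Γ.contMDiffAt_cG h₀ h₁))).congr_of_eventuallyEq ?_
  filter_upwards [(Γ.isOpen_base x₀).mem_nhds h₀, (Γ.isOpen_base x).mem_nhds h₁] with y hy hy'
  exact Γ.dsCoord_change hy hy'

theorem dsCoord_apply {x₀ x : M} (h₀ : x ∈ Γ.base x₀) (v : EE n) :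
    Γ.dsCoord x₀ x v = (Γ.trivM x₀).continuousLinearEquivAt ℝ _ h₀.2
      (Γ.dsrc (Γ.unit x) (((Γ.trivG x₀).continuousLinearEquivAt ℝ _ h₀.1).symm v)) := by
  simp only [dsCoord, inTangentCoordinates]
  rw [ContinuousLinearMap.inCoordinates_eq h₀.1 h₀.2]
  rfl

theorem dsCoord_surjective (x₀ : M) : Function.Surjective (Γ.dsCoord x₀ x₀) := by
  intro w
  obtain ⟨u, hu⟩ := Γ.submersion_src (Γ.unit x₀)
    (((Γ.trivM x₀).continuousLinearEquivAt ℝ _ (Γ.mem_base x₀).2).symm w)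
  refine ⟨(Γ.trivG x₀).continuousLinearEquivAt ℝ _ (Γ.mem_base x₀).1 u, ?_⟩
  rw [Γ.dsCoord_apply (Γ.mem_base x₀), ContinuousLinearEquiv.symm_apply_apply]
  have : Γ.dsrc (Γ.unit x₀) u = _ := hu
  rw [this, ContinuousLinearEquiv.apply_symm_apply]

theorem exists_proj (x₀ : M) : ∃ P : EE n →L[ℝ] EE (n - m),
    ∃ e : EE n ≃L[ℝ] EE m × EE (n - m), (e : EE n →L[ℝ] EE m × EE (n - m)) =
      (Γ.dsCoord x₀ x₀).prod P := by
  have hs := Γ.dsCoord_surjective x₀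
  set φ : EE n →ₗ[ℝ] EE m := (Γ.dsCoord x₀ x₀ : EE n →ₗ[ℝ] EE m) with hφ
  have hr : LinearMap.range φ = ⊤ := LinearMap.range_eq_top.2 hs
  have hd := LinearMap.finrank_range_add_finrank_ker φ
  rw [hr, finrank_top] at hd
  simp only [finrank_euclideanSpace, Fintype.card_fin] at hd
  have hk : Module.finrank ℝ (LinearMap.ker φ) = Module.finrank ℝ (EE (n - m)) := by
    simp only [finrank_euclideanSpace, Fintype.card_fin]; omega
  let κ := LinearEquiv.ofFinrankEq _ _ hk
  obtain ⟨p, hp⟩ := LinearMap.exists_leftInverse_of_injective (LinearMap.ker φ).subtype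
    (Submodule.ker_subtype _)
  let P : EE n →ₗ[ℝ] EE (n - m) := κ.toLinearMap ∘ₗ p
  have hinj : Function.Injective (φ.prod P) := by
    rw [← LinearMap.ker_eq_bot, LinearMap.ker_eq_bot']
    intro v hv
    have h1 : φ v = 0 := congrArg Prod.fst hv
    have h2 : κ (p v) = 0 := congrArg Prod.snd hv
    have h3 : p v = 0 := by simpa using h2
    have h4 : p v = ⟨v, h1⟩ := LinearMap.congr_fun hp ⟨v, h1⟩
    rw [h4] at h3
    exact congrArg Subtype.val h3
  have hfr : Module.finrank ℝ (EE n) = Module.finrank ℝ (EE m × EE (n - m)) := by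
    rw [Module.finrank_prod]; simp only [finrank_euclideanSpace, Fintype.card_fin]; omega
  refine ⟨LinearMap.toContinuousLinearMap P,
    (LinearEquiv.ofInjectiveOfFinrankEq _ hinj hfr).toContinuousLinearEquiv, ?_⟩
  ext1 v
  rfl

/-- A linear projection complementary to `ds` at `x₀`. -/
def proj (x₀ : M) : EE n →L[ℝ] EE (n - m) := (Γ.exists_proj x₀).choose

/-- `ds` together with the projection; a linear isomorphism near `x₀`. -/
def full (x₀ x : M) : EE n →L[ℝ] EE m × EE (n - m) := (Γ.dsCoord x₀ x).prod (Γ.proj x₀)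

/-- The domain of the trivialisation of `A` at `x₀`. -/
def dom (x₀ : M) : Set M :=
  {x | x ∈ Γ.base x₀ ∧ Γ.full x₀ x ∈ range
    ((↑) : (EE n ≃L[ℝ] EE m × EE (n - m)) → (EE n →L[ℝ] EE m × EE (n - m)))}

theorem mem_dom (x₀ : M) : x₀ ∈ Γ.dom x₀ :=
  ⟨Γ.mem_base x₀, (Γ.exists_proj x₀).choose_spec⟩

theorem contMDiffAt_full {x₀ x : M} (h₀ : x ∈ Γ.base x₀) :
    ContMDiffAt (𝓡 m) 𝓘(ℝ, EE n →L[ℝ] EE m × EE (n - m)) ∞ (Γ.full x₀) x := by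
  have h : Γ.full x₀ = fun x =>
      (ContinuousLinearMap.inl ℝ (EE m) (EE (n - m))).comp (Γ.dsCoord x₀ x) +
      (ContinuousLinearMap.inr ℝ (EE m) (EE (n - m))).comp (Γ.proj x₀) := by
    funext x; ext1 v; simp [full]
  rw [h]
  exact (contMDiffAt_const.clm_comp (Γ.contMDiffAt_dsCoord h₀)).add contMDiffAt_const

theorem isOpen_dom (x₀ : M) : IsOpen (Γ.dom x₀) := by
  rw [isOpen_iff_mem_nhds]
  rintro x ⟨hx, hx'⟩
  filter_upwards [(Γ.isOpen_base x₀).mem_nhds hx,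
    (Γ.contMDiffAt_full hx).continuousAt.preimage_mem_nhds
      (ContinuousLinearEquiv.isOpen.mem_nhds hx')] with y hy hy'
  exact ⟨hy, hy'⟩

theorem contMDiffAt_inverse {x₀ x : M} (h₀ : x ∈ Γ.dom x₀) :
    ContMDiffAt (𝓡 m) 𝓘(ℝ, EE m × EE (n - m) →L[ℝ] EE n) ∞
      (fun x => (Γ.full x₀ x).inverse) x := by
  obtain ⟨hx, e, he⟩ := h₀
  have := contDiffAt_map_inverse (n := ∞) e
  rw [he] at this
  exact ContMDiffAt.comp x this.contMDiffAt (Γ.contMDiffAt_full hx)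

/-- The trivialisation of `A` over `dom x₀`, at the point `x`. -/
def fiberEquiv (x₀ x : M) (hx : x ∈ Γ.dom x₀) : Γ.Alg x ≃ₗ[ℝ] EE (n - m) where
  toFun a := Γ.proj x₀ ((Γ.trivG x₀).continuousLinearEquivAt ℝ _ hx.1.1 a.1)
  invFun w := ⟨((Γ.trivG x₀).continuousLinearEquivAt ℝ _ hx.1.1).symm
      ((Γ.full x₀ x).inverse (0, w)), by
    obtain ⟨hx, e, he⟩ := hx
    have h : Γ.full x₀ x ((Γ.full x₀ x).inverse (0, w)) = (0, w) := by
      rw [← he, ContinuousLinearMap.inverse_equiv]; exact e.apply_symm_apply _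
    have h1 : Γ.dsCoord x₀ x ((Γ.full x₀ x).inverse (0, w)) = 0 := congrArg Prod.fst h
    rw [Γ.dsCoord_apply hx] at h1
    exact (ContinuousLinearEquiv.map_eq_zero_iff _).1 h1⟩
  map_add' a b := by rw [Submodule.coe_add, map_add, map_add]
  map_smul' c a := by rw [Submodule.coe_smul, map_smul, map_smul]; rfl
  left_inv a := by
    obtain ⟨hx, e, he⟩ := hx
    apply Subtype.ext
    have ha : Γ.dsrc (Γ.unit x) a.1 = 0 := a.2
    have h : Γ.full x₀ x ((Γ.trivG x₀).continuousLinearEquivAt ℝ _ hx.1 a.1) =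
        (0, Γ.proj x₀ ((Γ.trivG x₀).continuousLinearEquivAt ℝ _ hx.1 a.1)) := by
      refine Prod.ext ?_ rfl
      change Γ.dsCoord x₀ x _ = 0
      rw [Γ.dsCoord_apply hx, ContinuousLinearEquiv.symm_apply_apply, ha, map_zero]
    change ((Γ.trivG x₀).continuousLinearEquivAt ℝ _ hx.1).symm _ = a.1
    rw [← h, ← he, ContinuousLinearMap.inverse_equiv]
    erw [e.symm_apply_apply]
    exact ContinuousLinearEquiv.symm_apply_apply _ _
  right_inv w := by
    obtain ⟨hx, e, he⟩ := hx
    have h : Γ.full x₀ x ((Γ.full x₀ x).inverse (0, w)) = (0, w) := by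
      rw [← he, ContinuousLinearMap.inverse_equiv]; exact e.apply_symm_apply _
    change Γ.proj x₀ (((Γ.trivG x₀).continuousLinearEquivAt ℝ _ hx.1)
      (((Γ.trivG x₀).continuousLinearEquivAt ℝ _ hx.1).symm _)) = w
    rw [ContinuousLinearEquiv.apply_symm_apply]
    exact congrArg Prod.snd h

open Classical in
/-- The trivialisation of `A` over `dom x₀`. -/
def pretriv (x₀ : M) : Pretrivialization (EE (n - m))
    (TotalSpace.proj : TotalSpace (EE (n - m)) (fun x => Γ.Alg x) → M) where
  toFun p := (p.1, if h : p.1 ∈ Γ.dom x₀ then Γ.fiberEquiv x₀ p.1 h p.2 else 0)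
  invFun q := ⟨q.1, if h : q.1 ∈ Γ.dom x₀ then (Γ.fiberEquiv x₀ q.1 h).symm q.2 else 0⟩
  source := TotalSpace.proj ⁻¹' Γ.dom x₀
  target := Γ.dom x₀ ×ˢ univ
  map_source' p hp := ⟨hp, mem_univ _⟩
  map_target' q hq := hq.1
  left_inv' p hp := by
    have hp' : p.1 ∈ Γ.dom x₀ := hp
    simp [hp']
  right_inv' q hq := by
    have hq' : q.1 ∈ Γ.dom x₀ := hq.1
    simp [hq']
  open_target := (Γ.isOpen_dom x₀).prod isOpen_univ
  baseSet := Γ.dom x₀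
  open_baseSet := Γ.isOpen_dom x₀
  source_eq := rfl
  target_eq := rfl
  proj_toFun _ _ := rfl

theorem pretriv_apply {x₀ x : M} (h : x ∈ Γ.dom x₀) (a : Γ.Alg x) :
    (Γ.pretriv x₀ ⟨x, a⟩).2 = Γ.fiberEquiv x₀ x h a := dif_pos h

theorem pretriv_symm {x₀ x : M} (h : x ∈ Γ.dom x₀) (w : EE (n - m)) :
    (Γ.pretriv x₀).symm x w = (Γ.fiberEquiv x₀ x h).symm w := by
  exact (Pretrivialization.symm_apply (Γ.pretriv x₀) h w).trans
    ((cast_eq _ _).trans (dif_pos h))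

/-- The coordinate changes of `A`. -/
def coordChange (x₀ x₁ x : M) : EE (n - m) →L[ℝ] EE (n - m) :=
  (Γ.proj x₁).comp ((Γ.cG x₀ x₁ x).comp
    ((Γ.full x₀ x).inverse.comp (ContinuousLinearMap.inr ℝ (EE m) (EE (n - m)))))

theorem coordChange_apply {x₀ x₁ x : M} (h : x ∈ Γ.dom x₀) (h' : x ∈ Γ.dom x₁)
    (w : EE (n - m)) :
    Γ.coordChange x₀ x₁ x w = (Γ.pretriv x₁ ⟨x, (Γ.pretriv x₀).symm x w⟩).2 := by
  rw [Γ.pretriv_apply h', Γ.pretriv_symm h]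
  refine congrArg (Γ.proj x₁) ?_
  exact (Γ.trivG x₀).coordChangeL_apply (R := ℝ) (Γ.trivG x₁) ⟨h.1.1, h'.1.1⟩ _

theorem contMDiffOn_coordChange (x₀ x₁ : M) :
    ContMDiffOn (𝓡 m) 𝓘(ℝ, EE (n - m) →L[ℝ] EE (n - m)) ∞ (Γ.coordChange x₀ x₁)
      (Γ.dom x₀ ∩ Γ.dom x₁) := fun _ hx =>
  (contMDiffAt_const.clm_comp ((Γ.contMDiffAt_cG hx.1.1 hx.2.1).clm_comp
    ((Γ.contMDiffAt_inverse hx.1).clm_comp contMDiffAt_const))).contMDiffWithinAt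

/-- The trivialisations make `A` a vector bundle of rank `n - m` over `M`. -/
def prebundle : VectorPrebundle ℝ (EE (n - m)) (fun x => Γ.Alg x) where
  pretrivializationAtlas := range Γ.pretriv
  pretrivialization_linear' := by
    rintro _ ⟨x₀, rfl⟩
    refine ⟨fun x hx => ?_⟩
    have : (fun a : Γ.Alg x => (Γ.pretriv x₀ ⟨x, a⟩).2) = Γ.fiberEquiv x₀ x hx :=
      funext fun a => Γ.pretriv_apply hx a
    rw [this]
    exact (Γ.fiberEquiv x₀ x hx).toLinearMap.isLinear
  pretrivializationAt := Γ.pretriv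
  mem_base_pretrivializationAt := Γ.mem_dom
  pretrivialization_mem_atlas x₀ := ⟨x₀, rfl⟩
  exists_coordChange := by
    rintro _ ⟨x₀, rfl⟩ _ ⟨x₁, rfl⟩
    exact ⟨Γ.coordChange x₀ x₁, (Γ.contMDiffOn_coordChange x₀ x₁).continuousOn,
      fun b hb v => Γ.coordChange_apply hb.1 hb.2 v⟩
  totalSpaceMk_isInducing b := by
    have h : (fun a : Γ.Alg b => Γ.pretriv b ⟨b, a⟩) =
        Prod.mk b ∘ (Γ.fiberEquiv b b (Γ.mem_dom b)) := by
      funext a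
      exact Prod.ext rfl (Γ.pretriv_apply (Γ.mem_dom b) a)
    change IsInducing (fun a : Γ.Alg b => Γ.pretriv b ⟨b, a⟩)
    rw [h]
    refine Topology.IsInducing.comp (isEmbedding_prodMkRight b).isInducing ?_
    have : FiniteDimensional ℝ (TangentSpace (𝓡 n) (Γ.unit b)) :=
      inferInstanceAs (FiniteDimensional ℝ (EE n))
    have : T2Space (TangentSpace (𝓡 n) (Γ.unit b)) := inferInstanceAs (T2Space (EE n))
    exact (Γ.fiberEquiv b b (Γ.mem_dom b)).toContinuousLinearEquiv.toHomeomorph.isInducing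

instance isContMDiff_prebundle : Γ.prebundle.IsContMDiff (𝓡 m) ∞ where
  exists_contMDiffCoordChange := by
    rintro _ ⟨x₀, rfl⟩ _ ⟨x₁, rfl⟩
    exact ⟨Γ.coordChange x₀ x₁, Γ.contMDiffOn_coordChange x₀ x₁,
      fun b hb v => Γ.coordChange_apply hb.1 hb.2 v⟩

end LieGroupoid

/-- A smooth real vector bundle of finite rank over `M`. -/
structure SmoothVB (m : ℕ) (M : Type*) [TopologicalSpace M] [ChartedSpace (EE m) M] where
  F : Type
  Fib : M → Type
  [normedAddCommGroup : NormedAddCommGroup F]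
  [normedSpace : NormedSpace ℝ F]
  [finiteDimensional : FiniteDimensional ℝ F]
  [addCommGroup : ∀ x, AddCommGroup (Fib x)]
  [module : ∀ x, Module ℝ (Fib x)]
  [topology : ∀ x, TopologicalSpace (Fib x)]
  [totalTopology : TopologicalSpace (TotalSpace F Fib)]
  [fiberBundle : FiberBundle F Fib]
  [vectorBundle : VectorBundle ℝ F Fib]
  [contMDiffVectorBundle : ContMDiffVectorBundle ∞ F Fib (𝓡 m)]

attribute [instance] SmoothVB.normedAddCommGroup SmoothVB.normedSpace
  SmoothVB.finiteDimensional SmoothVB.addCommGroup SmoothVB.module SmoothVB.topology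
  SmoothVB.totalTopology SmoothVB.fiberBundle SmoothVB.vectorBundle
  SmoothVB.contMDiffVectorBundle

/-- The total space of a smooth vector bundle. -/
abbrev SmoothVB.Tot (V : SmoothVB m M) := TotalSpace V.F V.Fib

/-- The model with corners of the total space. -/
abbrev SmoothVB.J (V : SmoothVB m M) := (𝓡 m).prod 𝓘(ℝ, V.F)

variable (m M) in
/-- The tangent bundle `TM`. -/
def tangentVB : SmoothVB m M where
  F := EE m
  Fib := (TangentSpace (𝓡 m) : M → Type)

variable (m M) in
/-- The zero bundle. -/
def zeroVB : SmoothVB m M where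
  F := EE 0
  Fib := Bundle.Trivial M (EE 0)

/-- The vector bundle `A = Ker(ds)|_M`. -/
def LieGroupoid.algVB (Γ : LieGroupoid m n M G) : SmoothVB m M :=
  letI := Γ.prebundle.totalSpaceTopology
  letI := Γ.prebundle.toFiberBundle
  letI := Γ.prebundle.toVectorBundle
  letI : ContMDiffVectorBundle ∞ (EE (n - m)) (fun x => Γ.Alg x) (𝓡 m) :=
    Γ.prebundle.contMDiffVectorBundle (𝓡 m)
  { F := EE (n - m)
    Fib := fun x => Γ.Alg x }

/-- A bounded graded vector bundle `E = ⨁ E^l` over `M`. -/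
structure GradedVB (m : ℕ) (M : Type*) [TopologicalSpace M] [ChartedSpace (EE m) M] where
  deg : ℤ → SmoothVB m M
  bounded : ∃ N : ℕ, ∀ l : ℤ, (N : ℤ) < |l| → ∀ x, Subsingleton ((deg l).Fib x)

/-- The graded vector bundle underlying the adjoint complex: `A` in degree `0`, `TM` in
degree `1`. -/
def LieGroupoid.adj (Γ : LieGroupoid m n M G) : GradedVB m M where
  deg
    | 0 => Γ.algVB
    | 1 => tangentVB m M
    | _ => zeroVB m M
  bounded := ⟨1, fun l hl x => by
    have h0 : l ≠ 0 := by rintro rfl; simp at hl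
    have h1 : l ≠ 1 := by rintro rfl; simp at hl
    split
    · exact absurd rfl h0
    · exact absurd rfl h1
    · exact inferInstanceAs (Subsingleton (EE 0))⟩

/-- The model with corners of `Gᵏ × M`. -/
abbrev stringModel (m n k : ℕ) :=
  (ModelWithCorners.pi (fun _ : Fin k => 𝓡 n)).prod (𝓡 m)

theorem contMDiff_arrow {k : ℕ} (i : Fin k) :
    ContMDiff (ModelWithCorners.pi (fun _ : Fin k => 𝓡 n)) (𝓡 n) ∞ (fun q : Fin k → G => q i) := by
  intro q
  rw [contMDiffAt_iff]
  refine ⟨(continuous_apply i).continuousAt, ?_⟩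
  have h : ContDiff ℝ ∞ (fun v : Fin k → EE n => v i) := contDiff_apply ℝ (EE n) i
  refine h.contDiffAt.contDiffWithinAt.congr_of_eventuallyEq_of_mem ?_ ⟨_, rfl⟩
  have ht : (extChartAt (ModelWithCorners.pi (fun _ : Fin k => 𝓡 n)) q).target ∈
      𝓝[range (ModelWithCorners.pi (fun _ : Fin k => 𝓡 n))]
        (extChartAt (ModelWithCorners.pi (fun _ : Fin k => 𝓡 n)) q q) :=
    extChartAt_target_mem_nhdsWithin q
  filter_upwards [ht] with v hv
  have : v i ∈ (extChartAt (𝓡 n) (q i)).target := by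
    have h1 := hv
    simp only [extChartAt, OpenPartialHomeomorph.extend, mfld_simps] at h1 ⊢
    exact h1.2 i (mem_univ i)
  exact (extChartAt (𝓡 n) (q i)).right_inv this

theorem contMDiffOn_add_smul (V : SmoothVB m M)
    {E' H' N : Type*} [NormedAddCommGroup E'] [NormedSpace ℝ E'] [TopologicalSpace H']
    {I' : ModelWithCorners ℝ E' H'} [TopologicalSpace N] [ChartedSpace H' N]
    {S : Set N} {Φ₁ Φ₂ : N → V.Tot} (h₁ : ContMDiffOn I' V.J ∞ Φ₁ S)
    (h₂ : ContMDiffOn I' V.J ∞ Φ₂ S) (c : ℝ) (h : ∀ q ∈ S, (Φ₁ q).1 = (Φ₂ q).1) :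
    ∃ Φ : N → V.Tot, ContMDiffOn I' V.J ∞ Φ S ∧ ∀ q ∈ S, ∀ y a b,
      Φ₁ q = ⟨y, a⟩ → Φ₂ q = ⟨y, b⟩ → Φ q = ⟨y, a + c • b⟩ := by
  classical
  let Φ : N → V.Tot := fun q => if e : (Φ₂ q).1 = (Φ₁ q).1 then
    ⟨(Φ₁ q).1, (Φ₁ q).2 + c • (e ▸ (Φ₂ q).2)⟩ else Φ₁ q
  have key : ∀ q y a b, Φ₁ q = ⟨y, a⟩ → Φ₂ q = ⟨y, b⟩ → Φ q = ⟨y, a + c • b⟩ := by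
    intro q y a b ha hb
    have e : (Φ₂ q).1 = (Φ₁ q).1 := by rw [ha, hb]
    simp only [Φ, dif_pos e]
    generalize Φ₁ q = P at *
    generalize Φ₂ q = Q at *
    subst ha hb
    rfl
  refine ⟨Φ, fun q₀ hq₀ => ?_, fun q _ => key q⟩
  have hw : ∀ q ∈ S, ∃ y a b, Φ₁ q = ⟨y, a⟩ ∧ Φ₂ q = ⟨y, b⟩ ∧ Φ q = ⟨y, a + c • b⟩ := by
    intro q hq
    obtain ⟨b, hb⟩ : ∃ b, Φ₂ q = ⟨(Φ₁ q).1, b⟩ := by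
      rw [h q hq]; exact ⟨_, rfl⟩
    exact ⟨_, _, b, rfl, hb, key q _ _ b rfl hb⟩
  have hproj : ∀ q ∈ S, (Φ q).1 = (Φ₁ q).1 := by
    intro q hq
    obtain ⟨y, a, b, ha, hb, hc⟩ := hw q hq
    rw [hc, ha]
  have k₁ := contMDiffWithinAt_totalSpace.1 (h₁ q₀ hq₀)
  have k₂ := contMDiffWithinAt_totalSpace.1 (h₂ q₀ hq₀)
  rw [← h q₀ hq₀] at k₂
  rw [contMDiffWithinAt_totalSpace, hproj q₀ hq₀]
  refine ⟨k₁.1.congr hproj (hproj q₀ hq₀), ?_⟩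
  refine (k₁.2.add (contMDiffWithinAt_const (I' := 𝓘(ℝ, ℝ)) (c := c) |>.smul k₂.2)).congr_of_eventuallyEq_of_mem
    ?_ hq₀
  have hU := k₁.1.continuousWithinAt.preimage_mem_nhdsWithin
    ((trivializationAt V.F V.Fib (Φ₁ q₀).1).open_baseSet.mem_nhds
      (mem_baseSet_trivializationAt V.F V.Fib (Φ₁ q₀).1))
  filter_upwards [hU, self_mem_nhdsWithin] with q hq hqS
  obtain ⟨y, a, b, ha, hb, hc⟩ := hw q hqS
  have hy : y ∈ (trivializationAt V.F V.Fib (Φ₁ q₀).1).baseSet := by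
    have : (Φ₁ q).1 ∈ (trivializationAt V.F V.Fib (Φ₁ q₀).1).baseSet := hq
    rwa [ha] at this
  change (trivializationAt V.F V.Fib (Φ₁ q₀).1 (Φ q)).2 =
    (trivializationAt V.F V.Fib (Φ₁ q₀).1 (Φ₁ q)).2 +
      c • (trivializationAt V.F V.Fib (Φ₁ q₀).1 (Φ₂ q)).2
  rw [ha, hb, hc]
  have hl := (trivializationAt V.F V.Fib (Φ₁ q₀).1).linear ℝ hy
  rw [hl.map_add, hl.map_smul]

namespace LieGroupoid
variable (Γ : LieGroupoid m n M G)

/-- `IsString [g₁, …, gₖ] y x`: the `gᵢ` form a string of composable arrows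
`y ← ⋯ ← x`, with `y = t(g₁)` and `x = s(gₖ)`. For `k = 0` this means `y = x`. -/
def IsString : List G → M → M → Prop
  | [], y, x => y = x
  | g :: p, y, x => Γ.tgt g = y ∧ IsString p (Γ.src g) x

/-- The target `t(g₁)` of a string ending at `x`. -/
def vertex : List G → M → M
  | [], x => x
  | g :: _, _ => Γ.tgt g

/-- `contract i [g₁, …, gₖ] = [g₁, …, gᵢ₊₁gᵢ₊₂, …, gₖ]` for `i + 2 ≤ k`. -/
def contract : ℕ → List G → List G
  | 0, g :: h :: p => Γ.mul g h :: p
  | i + 1, g :: p => g :: contract i p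
  | _, p => p

variable {Γ}

theorem IsString.eq_vertex {p : List G} {y x : M} (h : Γ.IsString p y x) : y = Γ.vertex p x := by
  cases p with
  | nil => exact h
  | cons g p => exact h.1.symm

theorem IsString.drop {p : List G} {y x : M} (h : Γ.IsString p y x) (j : ℕ) :
    Γ.IsString (p.drop j) (Γ.vertex (p.drop j) x) x := by
  induction p generalizing y j with
  | nil => simp [IsString, vertex]
  | cons g p ih =>
    cases j with
    | zero => exact ⟨rfl, h.2⟩
    | succ j => exact ih h.2 j

theorem IsString.take {p : List G} {y x : M} (h : Γ.IsString p y x) (j : ℕ) :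
    Γ.IsString (p.take j) y (Γ.vertex (p.drop j) x) := by
  induction p generalizing y j with
  | nil => simpa [IsString, vertex] using h
  | cons g p ih =>
    cases j with
    | zero => exact h.1.symm
    | succ j => exact ⟨h.1, ih h.2 j⟩

theorem IsString.contract {p : List G} {y x : M} (h : Γ.IsString p y x) (i : ℕ) :
    Γ.IsString (Γ.contract i p) y x := by
  induction p generalizing y i with
  | nil => cases i <;> exact h
  | cons g p ih =>
    cases i with
    | succ i => exact ⟨h.1, ih h.2 i⟩
    | zero =>
      cases p with
      | nil => exact h
      | cons k p =>
        obtain ⟨h1, h2, h3⟩ := h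
        exact ⟨(Γ.tgt_mul g k h2.symm).trans h1, by rwa [Γ.src_mul g k h2.symm]⟩

variable (Γ)

/-- A string `y = left ← ⋯ ← right = x` of composable arrows: a point of `G_k` with `k` the number
of arrows, and a point of `G_0 = M` when there are none. -/
structure Str where
  arrows : List G
  left : M
  right : M
  isString : Γ.IsString arrows left right

variable {Γ}
namespace Str

/-- The number of arrows. -/
abbrev len (s : Γ.Str) : ℕ := s.arrows.length

/-- `(g_{j+1}, …, gₖ)`. -/
abbrev drop (s : Γ.Str) (j : ℕ) : Γ.Str := ⟨_, _, _, s.isString.drop j⟩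

/-- `(g₁, …, g_j)`. -/
abbrev take (s : Γ.Str) (j : ℕ) : Γ.Str := ⟨_, _, _, s.isString.take j⟩

/-- `(g₁, …, gᵢ₊₁gᵢ₊₂, …, gₖ)`. -/
abbrev contract (s : Γ.Str) (i : ℕ) : Γ.Str := ⟨_, _, _, s.isString.contract i⟩

end Str
variable (Γ)

/-- `G_k` as an embedded submanifold of `Gᵏ × M`, the last component being `s(gₖ)` (the point itself
if `k = 0`). A map on `G_k` is smooth if and only if it is `ContMDiffOn` as a map on this set. -/
def nerve (k : ℕ) : Set ((Fin k → G) × M) :=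
  {q | ∃ y, Γ.IsString (List.ofFn q.1) y q.2}

/-- `v` restricts to a smooth section over `G_k` of `t^*V`, the pullback of `V` along
`(g₁, …, gₖ) ↦ t(g₁)`. -/
def SmoothSection (V : SmoothVB m M) (k : ℕ) (v : ∀ s : Γ.Str, V.Fib s.left) : Prop :=
  ∃ Φ : (Fin k → G) × M → V.Tot,
    ContMDiffOn (stringModel m n k) V.J ∞ Φ (Γ.nerve k) ∧
    ∀ q y (h : Γ.IsString (List.ofFn q.1) y q.2), Φ q = ⟨y, v ⟨_, y, _, h⟩⟩

/-- `f` restricts to a smooth function on `G_k`. -/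
def SmoothFunction (k : ℕ) (f : Γ.Str → ℝ) : Prop :=
  ∃ φ : (Fin k → G) × M → ℝ,
    ContMDiffOn (stringModel m n k) 𝓘(ℝ, ℝ) ∞ φ (Γ.nerve k) ∧
    ∀ q y (h : Γ.IsString (List.ofFn q.1) y q.2), φ q = f ⟨_, y, _, h⟩

/-- `T` restricts to a smooth section over `G_k` of `Hom(s^*V, t^*W)`, that is, to a smooth bundle
map from `s^*V`, an embedded submanifold of `Gᵏ × V`, to `W`. -/
def SmoothHom (V W : SmoothVB m M) (k : ℕ)
    (T : ∀ s : Γ.Str, V.Fib s.right →ₗ[ℝ] W.Fib s.left) : Prop :=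
  ∃ Φ : (Fin k → G) × V.Tot → W.Tot,
    ContMDiffOn ((ModelWithCorners.pi (fun _ : Fin k => 𝓡 n)).prod V.J) W.J ∞ Φ
      {q | ∃ y, Γ.IsString (List.ofFn q.1) y q.2.1} ∧
    ∀ q y x (h : Γ.IsString (List.ofFn q) y x) (v : V.Fib x),
      Φ (q, ⟨x, v⟩) = ⟨y, T ⟨_, y, x, h⟩ v⟩

theorem smoothSection_zero (V : SmoothVB m M) (k : ℕ) :
    Γ.SmoothSection V k (fun _ => 0) := by
  refine ⟨fun q => ⟨Γ.vertex (List.ofFn q.1) q.2, 0⟩, ?_, fun q y h => ?_⟩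
  · refine (contMDiff_zeroSection ℝ V.Fib (n := ∞) (IB := 𝓡 m)).comp_contMDiffOn ?_
    refine ContMDiff.contMDiffOn ?_
    cases k with
    | zero => simpa [vertex] using contMDiff_snd
    | succ k =>
      have := Γ.contMDiff_tgt.comp ((contMDiff_arrow (G := G) (n := n) (0 : Fin (k + 1))).comp
        (contMDiff_fst (J := 𝓡 m) (N := M)))
      simpa [vertex, Function.comp_def] using this
  · obtain rfl := h.eq_vertex
    rfl

variable {Γ} in
theorem SmoothSection.add_smul {V : SmoothVB m M} {k : ℕ}
    {v w : ∀ s : Γ.Str, V.Fib s.left} (c : ℝ)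
    (hv : Γ.SmoothSection V k v) (hw : Γ.SmoothSection V k w) :
    Γ.SmoothSection V k (fun s => v s + c • w s) := by
  obtain ⟨Φ₁, h₁, e₁⟩ := hv
  obtain ⟨Φ₂, h₂, e₂⟩ := hw
  obtain ⟨Φ, h, e⟩ := contMDiffOn_add_smul V h₁ h₂ c
    (fun q ⟨y, hy⟩ => by rw [e₁ q y hy, e₂ q y hy])
  exact ⟨Φ, h, fun q y hy => e q ⟨y, hy⟩ y _ _ (e₁ q y hy) (e₂ q y hy)⟩

end LieGroupoid

namespace LieGroupoid
variable (Γ : LieGroupoid m n M G)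

/-- Families of elements `η_l(g₁, …, gₖ) ∈ E^l` over `t(g₁)`, for all `k` and `l`, not necessarily
smooth. -/
abbrev RawCochain (E : GradedVB m M) := ∀ (s : Γ.Str) (l : ℤ), (E.deg l).Fib s.left

/-- The space `C(G; E)`, the direct sum over `k` and `l` of `C^k(G; E^l) = Γ(G_k, t^*E^l)`. -/
def Cochain (E : GradedVB m M) : Submodule ℝ (Γ.RawCochain E) where
  carrier := {η | (∀ (k : ℕ) (l : ℤ), Γ.SmoothSection (E.deg l) k (fun s => η s l)) ∧
    ∃ N : ℕ, ∀ s l, (N < s.len ∨ (N : ℤ) < |l|) → η s l = 0}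
  zero_mem' := ⟨fun k l => Γ.smoothSection_zero (E.deg l) k, 0, fun _ _ _ => rfl⟩
  add_mem' := by
    rintro η ζ ⟨h₁, N₁, e₁⟩ ⟨h₂, N₂, e₂⟩
    refine ⟨fun k l => by simpa using (h₁ k l).add_smul 1 (h₂ k l), max N₁ N₂, ?_⟩
    intro s l hl
    have a₁ : N₁ < s.len ∨ (N₁ : ℤ) < |l| := by omega
    have a₂ : N₂ < s.len ∨ (N₂ : ℤ) < |l| := by omega
    change η s l + ζ s l = 0
    rw [e₁ s l a₁, e₂ s l a₂, add_zero]
  smul_mem' := by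
    rintro c η ⟨h₁, N₁, e₁⟩
    refine ⟨fun k l => by
      simpa using (Γ.smoothSection_zero (E.deg l) k).add_smul c (h₁ k l), N₁, ?_⟩
    intro s l hl
    change c • η s l = 0
    rw [e₁ s l hl, smul_zero]

variable {Γ}

/-- `η` is homogeneous of total degree `d`: only components with `k + l = d` occur. -/
def HasDegree {E : GradedVB m M} (d : ℤ) (η : Γ.RawCochain E) : Prop :=
  ∀ s l, (s.len : ℤ) + l ≠ d → η s l = 0

/-- `f ∈ C^r(G)`: a smooth function on `G_r`, extended by zero to strings of other lengths. -/
def IsScalarCochain (r : ℕ) (f : Γ.Str → ℝ) : Prop :=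
  (∀ k, Γ.SmoothFunction k f) ∧ ∀ s, s.len ≠ r → f s = 0

/-- The differential `δ` of `C(G)`, the operator `D_λ` of the trivial representation on the
trivial line bundle. -/
def scalarD (f : Γ.Str → ℝ) : Γ.Str → ℝ := fun s =>
  if s.arrows = [] then 0 else
    (-1) ^ (s.len - 1) * (f (s.drop 1) +
      (∑ i ∈ Finset.range (s.len - 1), (-1) ^ (i + 1) * f (s.contract i)) +
      (-1) ^ s.len * f (s.take (s.len - 1)))

/-- The right module structure: for `η` of cocycle degree `k` and `f ∈ C^r(G)` it is
`(-1)^{k r} η(g₁, …, gₖ) f(g_{k+1}, …, g_{k+r})`. -/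
def star {E : GradedVB m M} (η : Γ.RawCochain E) (f : Γ.Str → ℝ) : Γ.RawCochain E :=
  fun s l => ∑ j ∈ Finset.range (s.len + 1),
    ((-1) ^ (j * (s.len - j)) * f (s.drop j)) • η (s.take j) l

variable (Γ) in
/-- A representation up to homotopy of the groupoid on `E`: a degree one operator `D` on `C(G; E)`
with `D² = 0` and `D(η ⋆ f) = D(η) ⋆ f + (-1)^{|η|} η ⋆ δ(f)`. -/
structure RepUpToHomotopy (E : GradedVB m M) where
  D : Γ.Cochain E →ₗ[ℝ] Γ.Cochain E
  degree_one : ∀ (d : ℤ) (η : Γ.Cochain E), HasDegree d η.1 → HasDegree (d + 1) (D η).1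
  square_zero : ∀ η, D (D η) = 0
  leibniz : ∀ (d : ℤ) (r : ℕ) (η : Γ.Cochain E) (f : Γ.Str → ℝ),
    HasDegree d η.1 → IsScalarCochain r f →
    ∃ hm : star η.1 f ∈ Γ.Cochain E,
      (D ⟨star η.1 f, hm⟩).1 = star (D η).1 f + (-1 : ℝ) ^ d • star η.1 (scalarD f)

variable (Γ) in
/-- Families of linear maps `R_k(g₁, …, gₖ) : E^l_{s(gₖ)} → E^{l'}_{t(g₁)}`, for all `k`, `l`, `l'`:
all the matrix entries of elements of `End(E)`. -/
abbrev Operators (E : GradedVB m M) :=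
  ∀ (s : Γ.Str) (l l' : ℤ), (E.deg l).Fib s.right →ₗ[ℝ] (E.deg l').Fib s.left

variable {E : GradedVB m M} (R : Γ.Operators E)

/-- `R_k ∈ C^k(G; End^{1-k}(E))` for all `k`: smooth, and of degree `1 - k`. -/
structure IsOperatorSequence : Prop where
  degree : ∀ s l l', l' ≠ l + 1 - (s.len : ℤ) → R s l l' = 0
  smooth : ∀ k l l', Γ.SmoothHom (E.deg l) (E.deg l') k (fun s => R s l l')

/-- The structure equations
`∑_{j=1}^{k-1} (-1)^j R_{k-1}(…, g_j g_{j+1}, …) = ∑_{j=0}^k (-1)^j R_j(g₁, …, g_j) ∘ R_{k-j}(g_{j+1}, …, gₖ)`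
for all `k ≥ 0`, on each `E^l`. -/
def StructureEquations : Prop :=
  ∀ (s : Γ.Str) (l : ℤ),
    ∑ i ∈ Finset.range (s.len - 1), (-1 : ℝ) ^ (i + 1) •
        R (s.contract i) l (l + 2 - s.len) =
    ∑ j ∈ Finset.range (s.len + 1), (-1 : ℝ) ^ j •
        (R (s.take j) (l + 1 - (s.len - j)) (l + 2 - s.len) ∘ₗ
          R (s.drop j) l (l + 1 - (s.len - j)) :
            (E.deg l).Fib s.right →ₗ[ℝ] (E.deg (l + 2 - s.len)).Fib s.left)

/-- `R_1(g) = Id` if `g` is a unit, and `R_k(g₁, …, gₖ) = 0` if `k ≥ 2` and some `gᵢ` is a unit. -/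
structure IsUnital : Prop where
  weakly : ∀ (u : M) (h : Γ.IsString [Γ.unit u] u u) (l : ℤ),
    R ⟨[Γ.unit u], u, u, h⟩ l l = LinearMap.id
  higher : ∀ s, 2 ≤ s.len → (∃ u, Γ.unit u ∈ s.arrows) → ∀ l l', R s l l' = 0

/-- `η ↦ ∑ⱼ R_j ⋆ η`, with
`(R_j ⋆ η)(g₁, …, g_{j+k'}) = (-1)^{j (k' + l')} R_j(g₁, …, g_j)(η(g_{j+1}, …, g_{j+k'}))`
for `η` of bidegree `(k', l')`. -/
def leftMul (η : Γ.RawCochain E) : Γ.RawCochain E := fun s l =>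
  ∑ j ∈ Finset.range (s.len + 1),
    (-1 : ℝ) ^ ((j : ℤ) * ((s.len - j : ℤ) + (l + j - 1))) •
      R (s.take j) (l + j - 1) l (η (s.drop j) (l + j - 1))

/-- The operator `D̂_0`: for `η` of bidegree `(k, l)`, `D̂_0(η)(g₁, …, g_{k+1})` is
`(-1)^{k+l} (∑_{i=1}^k (-1)^i η(…, gᵢgᵢ₊₁, …) + (-1)^{k+1} η(g₁, …, gₖ))`. -/
def hatD (η : Γ.RawCochain E) : Γ.RawCochain E := fun s l =>
  if s.arrows = [] then 0 else
    (-1 : ℝ) ^ ((s.len : ℤ) - 1 + l) •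
      ((∑ i ∈ Finset.range (s.len - 1), (-1 : ℝ) ^ (i + 1) • η (s.contract i) l) +
        (-1 : ℝ) ^ s.len • η (s.take (s.len - 1)) l)

/-- The structure operator is given by the sequence `R`: `D(η) = ∑ₖ R_k ⋆ η + D̂_0(η)`. -/
def RepUpToHomotopy.HasComponents (𝓓 : Γ.RepUpToHomotopy E) : Prop :=
  ∀ η : Γ.Cochain E, (𝓓.D η).1 = leftMul R η.1 + hatD η.1

end LieGroupoid

namespace LieGroupoid
variable (Γ : LieGroupoid m n M G)

/-- The differential `dt` of the target map. -/
def dtgt (g : G) : TangentSpace (𝓡 n) g →L[ℝ] TangentSpace (𝓡 m) (Γ.tgt g) :=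
  mfderiv (𝓡 n) (𝓡 m) Γ.tgt g

/-- The differential of the unit map, the inclusion `T_xM ⊂ T_{1_x}G`. -/
def dunit (x : M) : TangentSpace (𝓡 m) x →L[ℝ] TangentSpace (𝓡 n) (Γ.unit x) :=
  mfderiv (𝓡 m) (𝓡 n) Γ.unit x

/-- The differential `dι` of the inversion. -/
def dinv (g : G) : TangentSpace (𝓡 n) g →L[ℝ] TangentSpace (𝓡 n) (Γ.inv g) :=
  mfderiv (𝓡 n) (𝓡 n) Γ.inv g

/-- The differential `(dm)_{g,h}` of the multiplication `m : G₂ → G` at a composable pair. Its values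
on `T_{(g,h)}G₂ = {(X, Y) | ds X = dt Y}` are determined by `m` on the submanifold `G₂`, and only
these values are used. -/
def dmul (g h : G) :
    TangentSpace (𝓡 n) g × TangentSpace (𝓡 n) h →L[ℝ] TangentSpace (𝓡 n) (Γ.mul g h) :=
  mfderivWithin ((𝓡 n).prod (𝓡 n)) (𝓡 n) (fun p : G × G => Γ.mul p.1 p.2)
    {p | Γ.src p.1 = Γ.tgt p.2} (g, h)

/-- The anchor `ρ = dt|_A : A_x → T_xM`. -/
def anchor (x : M) : Γ.Alg x →ₗ[ℝ] TangentSpace (𝓡 m) x :=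
  (Γ.dtgt (Γ.unit x)).toLinearMap ∘ₗ (Γ.Alg x).subtype

/-- Right translation `r_g : A_y → T_gG`, for `y = t(g)`: the differential of `h ↦ h g` at `1_y`, on
vectors tangent to the source fibre. -/
def rightTr (g : G) (y : M) : Γ.Alg y →ₗ[ℝ] TangentSpace (𝓡 n) g :=
  (Γ.dmul (Γ.unit y) g).toLinearMap ∘ₗ LinearMap.inl ℝ _ _ ∘ₗ (Γ.Alg y).subtype

/-- Left translation `l_g : A_x → T_gG`, for `x = s(g)`: `α ∈ A_x` is moved by `dι` to a vector at
`1_x` tangent to the target fibre, and then by the differential of `h ↦ g h`. -/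
def leftTr (g : G) (x : M) : Γ.Alg x →ₗ[ℝ] TangentSpace (𝓡 n) g :=
  (Γ.dmul g (Γ.unit x)).toLinearMap ∘ₗ LinearMap.inr ℝ _ _ ∘ₗ
    (Γ.dinv (Γ.unit x)).toLinearMap ∘ₗ (Γ.Alg x).subtype

/-- The inverse of `r_g : A_y → Ker(ds)_g`, for `y = t(g)`, extended linearly to `T_gG`. Only its
values on `Ker(ds)_g`, the image of the injective map `r_g`, are used. -/
def rightInv (g : G) (y : M) : TangentSpace (𝓡 n) g →ₗ[ℝ] Γ.Alg y :=
  (Γ.rightTr g y).leftInverse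

/-- An Ehresmann connection, as a smooth right splitting `σ : s^*TM → TG` of `ds` that is the natural
splitting at the units. -/
structure Connection where
  σ : ∀ g : G, TangentSpace (𝓡 m) (Γ.src g) →L[ℝ] TangentSpace (𝓡 n) g
  dsrc_σ : ∀ g v, Γ.dsrc g (σ g v) = v
  σ_unit : ∀ (x : M) (v : TangentSpace (𝓡 m) x), σ (Γ.unit x) v = Γ.dunit x v
  smooth : ∃ Φ : G × TangentBundle (𝓡 m) M → TangentBundle (𝓡 n) G,
    ContMDiffOn ((𝓡 n).prod (𝓡 m).tangent) (𝓡 n).tangent ∞ Φ {q | Γ.src q.1 = q.2.1} ∧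
    ∀ g v, Φ (g, ⟨Γ.src g, v⟩) = ⟨g, σ g v⟩

variable {Γ}
namespace Connection
variable (c : Γ.Connection)

/-- The quasi-action on `TM`: `λ_g(X) = dt(σ_g(X))`, for `x = s(g)` and `y = t(g)`. -/
def lamT (g : G) (y x : M) : TangentSpace (𝓡 m) x →ₗ[ℝ] TangentSpace (𝓡 m) y :=
  (Γ.dtgt g).toLinearMap ∘ₗ (c.σ g).toLinearMap

/-- The form `ω_g = r_g⁻¹ ∘ (Id - σ_g ∘ ds)` with values in `A_y`, for `y = t(g)`. -/
def omega (g : G) (y : M) : TangentSpace (𝓡 n) g →ₗ[ℝ] Γ.Alg y :=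
  Γ.rightInv g y ∘ₗ (LinearMap.id - (c.σ g).toLinearMap ∘ₗ (Γ.dsrc g).toLinearMap)

/-- The quasi-action on `A`: `λ_g(α) = -ω_g(l_g(α))`, for `x = s(g)` and `y = t(g)`. -/
def lamA (g : G) (y x : M) : Γ.Alg x →ₗ[ℝ] Γ.Alg y :=
  -(c.omega g y ∘ₗ Γ.leftTr g x)

/-- `σ_g : T_xM → T_gG`, for `x = s(g)`. -/
def sig (g : G) (x : M) : TangentSpace (𝓡 m) x →ₗ[ℝ] TangentSpace (𝓡 n) g :=
  (c.σ g).toLinearMap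

/-- The basic curvature of a pair `z ←g― y ←h― x`:
`K(g, h)(v) = r_{gh}⁻¹(dm(σ_g(λ_h(v)), σ_h(v)) - σ_{gh}(v)) ∈ A_z`. -/
def Kbas (g h : G) (z y x : M) : TangentSpace (𝓡 m) x →ₗ[ℝ] Γ.Alg z :=
  Γ.rightInv (Γ.mul g h) z ∘ₗ
    ((Γ.dmul g h).toLinearMap ∘ₗ (c.sig g y ∘ₗ c.lamT h y x).prod (c.sig h x) -
      c.sig (Γ.mul g h) x)

/-- The sequence `R_0 = ρ`, `R_1 = λ`, `R_2 = K`, and `R_k = 0` for `k ≥ 3`. -/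
def adOps : Γ.Operators Γ.adj := fun s l l' =>
  match s, l, l' with
  | ⟨[], _, x, _⟩, 0, 1 => Γ.anchor x
  | ⟨[g], y, x, _⟩, 0, 0 => c.lamA g y x
  | ⟨[g], y, x, _⟩, 1, 1 => c.lamT g y x
  | ⟨[g, h], y, x, _⟩, 1, 0 => c.Kbas g h y (Γ.tgt h) x
  | _, _, _ => 0

end Connection
end LieGroupoid

end LieGpd

end

/-! Differentiating the structure maps makes `TG ⇉ TM` a groupoid whose product `tmul` is linear on
composable pairs of vectors. Write `·` for this product. Right translation is `r_g(α) = α · 0_g` and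
left translation is `l_g(α) = 0_g · dι(α)`. Multiplying by `0_{g⁻¹}` on the right undoes `r_g`, so
`r_g` is an isomorphism onto `Ker(ds)_g`, and an identity in `A` may be tested after applying some
`r_g`.

Two formulas carry the pointwise part: `r_g(λ_g α) = σ_g(ρ α) - l_g(α)` (`rtr_lamA`) and
`r_{gh}(K(g,h)X) = σ_g(λ_h X) · σ_h(X) - σ_{gh}(X)` (`rtr_Kbas`). Applying `dt` to them yields the
equivariance of `ρ` and the curvature identity on `TM`. The identity on `A` and the cocycle equation
also need the cancellation `l_g(β) · (r_h(β) + w) = 0_g · w` (`tmul_ltr_rtr`). With it, the cocycle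
equation is associativity for the triple `σ_g(λ_h λ_k X)`, `σ_h(λ_k X)`, `σ_k(X)`.

Since the adjoint complex lives in degrees `0` and `1`, the structure equations are nontrivial for
only four pairs (number of arrows, degree). These four cases are exactly the identities above.

That `D² = 0` and the Leibniz rule hold is formal for any sequence satisfying the structure
equations. Write `L = ∑ R_j ⋆` and `H = D̂_0`. By the structure equations `L²` is a sum of terms
with a contraction inside the arguments of some `R_q`. In `HL` the same terms occur with the
opposite sign, and its remaining terms cancel `LH`. Finally `H² = 0` by the simplicial identities.
For the Leibniz rule, `L` commutes with `⋆ f` and the defect of `H` is the term with `δ f`.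

Smoothness is also reduced to `tmul`: `A` sits in `TG`, a map to `A` is smooth if it is smooth into
`TG`, and `λ`, `K` are built from `tmul`, `dι`, `dt` and `σ`. The smoothness of `tmul` on composable
vectors (`contMDiffOn_tangentMul`) comes from extending the multiplication smoothly off `G₂`, which
is possible locally because the source map is a submersion. -/

noncomputable section

open Bundle Topology Set Filter

namespace LieGpd

set_option linter.unusedSectionVars false

/-! ### Velocities of curves. -/

section Velocity

variable {k l : ℕ} {X : Type*} [TopologicalSpace X] [ChartedSpace (EE k) X]
  {Y : Type*} [TopologicalSpace Y] [ChartedSpace (EE l) Y]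

/-- The curve `γ` passes through `x` at time `0` with velocity `v`. -/
def HasVelocity (γ : ℝ → X) (x : X) (v : EE k) : Prop :=
  γ 0 = x ∧ HasMFDerivAt 𝓘(ℝ, ℝ) (𝓡 k) γ 0 (ContinuousLinearMap.toSpanSingleton ℝ v)

/-- Every identity of the tangent groupoid is proved through this: one curve, its velocity computed
in two ways. The vectors lie in the model space, so the two base points may be different expressions
for the same point. -/
theorem HasVelocity.unique {γ : ℝ → X} {x y : X} {v w : EE k} (hv : HasVelocity γ x v)
    (hw : HasVelocity γ y w) : v = w := by
  have := hasMFDerivAt_unique hv.2 hw.2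
  have h1 : (ContinuousLinearMap.toSpanSingleton ℝ v) (1 : ℝ) =
    (ContinuousLinearMap.toSpanSingleton ℝ w) (1 : ℝ) :=
      congrArg (fun L : ℝ →L[ℝ] EE k => L 1) this
  rwa [ContinuousLinearMap.toSpanSingleton_apply, ContinuousLinearMap.toSpanSingleton_apply,
    one_smul, one_smul] at h1

theorem HasVelocity.congr {γ δ : ℝ → X} {x : X} {v : EE k} (hv : HasVelocity γ x v)
    (h : δ =ᶠ[𝓝 0] γ) : HasVelocity δ x v := by
  refine ⟨h.self_of_nhds.trans hv.1, ?_⟩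
  exact hv.2.congr_of_eventuallyEq h

theorem HasVelocity.continuousAt {γ : ℝ → X} {x : X} {v : EE k} (hv : HasVelocity γ x v) :
    Tendsto γ (𝓝 0) (𝓝 x) := by
  have := hv.2.continuousAt
  rwa [ContinuousAt, hv.1] at this

theorem HasVelocity.map {γ : ℝ → X} {x : X} {v : EE k} (hv : HasVelocity γ x v) {f : X → Y}
    (hf : MDifferentiableAt (𝓡 k) (𝓡 l) f x) :
    HasVelocity (fun τ => f (γ τ)) (f x) (mfderiv (𝓡 k) (𝓡 l) f x v : EE l) := by
  obtain ⟨rfl, h⟩ := hv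
  refine ⟨rfl, (hf.hasMFDerivAt.comp (0 : ℝ) h).congr_mfderiv ?_⟩
  refine ContinuousLinearMap.ext fun τ => ?_
  exact ((mfderiv (𝓡 k) (𝓡 l) f (γ 0)).map_smul τ v)

theorem exists_hasVelocity (x : X) (v : EE k) :
    ∃ γ : ℝ → X, HasVelocity γ x v := by
  let φ := extChartAt (𝓡 k) x
  let L : ℝ → EE k := fun τ => φ x + τ • v
  have hL : HasFDerivAt L (ContinuousLinearMap.toSpanSingleton ℝ v) 0 :=
    (((hasDerivAt_id (0 : ℝ)).smul_const v).const_add (φ x)).hasFDerivAt.congr_fderiv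
      (by simp)
  have hL0 : L 0 = φ x := by simp [L]
  have hγ0 : φ.symm (L 0) = x := by simp [hL0, φ]
  have hc : ContinuousAt (fun τ => φ.symm (L τ)) 0 := by
    refine ContinuousAt.comp (g := φ.symm) ?_ hL.continuousAt
    rw [hL0]
    exact continuousAt_extChartAt_symm x
  refine ⟨fun τ => φ.symm (L τ), hγ0, hc, ?_⟩
  simp only [mfld_simps]
  refine (hL.congr_of_eventuallyEq ?_).hasFDerivWithinAt
  have ht : ∀ᶠ τ in 𝓝 (0 : ℝ), L τ ∈ φ.target := by
    refine hL.continuousAt.eventually ?_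
    rw [hL0]
    exact extChartAt_target_mem_nhds x
  filter_upwards [ht] with τ hτ
  change extChartAt (𝓡 k) (φ.symm (L 0)) (φ.symm (L τ)) = L τ
  rw [hγ0]
  exact φ.right_inv hτ

end Velocity

/-! ### Local form of a submersion. -/

theorem exists_complementary_projection {m n : ℕ} (φ : EE n →L[ℝ] EE m)
    (hs : Function.Surjective φ) : ∃ P : EE n →L[ℝ] EE (n - m),
    ∃ e : EE n ≃L[ℝ] EE m × EE (n - m), (e : EE n →L[ℝ] EE m × EE (n - m)) = φ.prod P := by
  have hr : LinearMap.range (φ : EE n →ₗ[ℝ] EE m) = ⊤ := LinearMap.range_eq_top.2 hs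
  have hd := LinearMap.finrank_range_add_finrank_ker (φ : EE n →ₗ[ℝ] EE m)
  rw [hr, finrank_top] at hd
  simp only [finrank_euclideanSpace, Fintype.card_fin] at hd
  have hk : Module.finrank ℝ (LinearMap.ker (φ : EE n →ₗ[ℝ] EE m)) =
      Module.finrank ℝ (EE (n - m)) := by
    simp only [finrank_euclideanSpace, Fintype.card_fin]; omega
  let κ := LinearEquiv.ofFinrankEq _ _ hk
  obtain ⟨p, hp⟩ := LinearMap.exists_leftInverse_of_injective
    (LinearMap.ker (φ : EE n →ₗ[ℝ] EE m)).subtype (Submodule.ker_subtype _)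
  -- `p` projects onto the kernel and `κ` reads the kernel in coordinates. Rank-nullity gives `m ≤
  -- n`, so the truncated `n - m` is the true dimension of the kernel; an injective map between
  -- spaces of equal dimension is then an isomorphism.
  let P : EE n →ₗ[ℝ] EE (n - m) := κ.toLinearMap ∘ₗ p
  have hinj : Function.Injective ((φ : EE n →ₗ[ℝ] EE m).prod P) := by
    rw [← LinearMap.ker_eq_bot, LinearMap.ker_eq_bot']
    intro v hv
    have h1 : φ v = 0 := congrArg Prod.fst hv
    have h2 : κ (p v) = 0 := congrArg Prod.snd hv
    have h3 : p v = 0 := by simpa using h2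
    have h4 : p v = ⟨v, h1⟩ := LinearMap.congr_fun hp ⟨v, h1⟩
    rw [h4] at h3
    exact congrArg Subtype.val h3
  have hfr : Module.finrank ℝ (EE n) = Module.finrank ℝ (EE m × EE (n - m)) := by
    rw [Module.finrank_prod]; simp only [finrank_euclideanSpace, Fintype.card_fin]; omega
  refine ⟨LinearMap.toContinuousLinearMap P,
    (LinearEquiv.ofInjectiveOfFinrankEq _ hinj hfr).toContinuousLinearEquiv, ?_⟩
  ext1 v
  rfl

section Submersion

variable {m n : ℕ} {M G : Type*}
    [TopologicalSpace M] [ChartedSpace (EE m) M] [IsManifold (𝓡 m) ∞ M]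
    [TopologicalSpace G] [ChartedSpace (EE n) G] [IsManifold (𝓡 n) ∞ G]

/-- The local form of a submersion. -/
theorem exists_local_form_of_submersion {s : G → M} {g : G}
    (hs : ContMDiffAt (𝓡 n) (𝓡 m) ∞ s g)
    (hs' : Function.Surjective (mfderiv (𝓡 n) (𝓡 m) s g)) :
    ∃ (p : G → EE (n - m)) (ψ : M × EE (n - m) → G),
      ContMDiffAt (𝓡 n) 𝓘(ℝ, EE (n - m)) ∞ p g ∧
      ContMDiffAt ((𝓡 m).prod 𝓘(ℝ, EE (n - m))) (𝓡 n) ∞ ψ (s g, p g) ∧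
      (∀ᶠ z in 𝓝 (s g, p g), s (ψ z) = z.1) ∧ (∀ᶠ g' in 𝓝 g, ψ (s g', p g') = g') := by
  let φ := extChartAt (𝓡 n) g
  let χ := extChartAt (𝓡 m) (s g)
  let F : EE n → EE m := writtenInExtChartAt (𝓡 n) (𝓡 m) g s
  have hF : ContDiffAt ℝ ∞ F (φ g) := by
    have := (contMDiffAt_iff.1 hs).2
    simp only [mfld_simps, contDiffWithinAt_univ] at this
    exact this
  obtain ⟨P, e, he⟩ := exists_complementary_projection (fderiv ℝ F (φ g)) (by
    have h1 := hs'
    rw [(hs.mdifferentiableAt (by simp)).mfderiv] at h1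
    simp only [mfld_simps, fderivWithin_univ] at h1
    exact h1)
  -- The coordinate expression `F` of `s` is completed by a linear map `P` to a local
  -- diffeomorphism. With its local inverse `R`, the fibre coordinate is `p = P ∘ φ`, and `ψ` is `R`
  -- read back in the charts.
  let Q : EE n → EE m × EE (n - m) := fun v => (F v, P v)
  have hQ : ContDiffAt ℝ ∞ Q (φ g) := hF.prodMk P.contDiff.contDiffAt
  have hQ' : HasFDerivAt Q (e : EE n →L[ℝ] EE m × EE (n - m)) (φ g) := by
    rw [he]
    exact (hF.differentiableAt (by simp)).hasFDerivAt.prodMk P.hasFDerivAt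
  let R := hQ.localInverse hQ' (by simp)
  have hR : ContDiffAt ℝ ∞ R (Q (φ g)) := hQ.to_localInverse hQ' (by simp)
  have hRQ : ∀ᶠ v in 𝓝 (φ g), R (Q v) = v :=
    (hQ.hasStrictFDerivAt' hQ' (by simp)).eventually_left_inverse
  have hQR : ∀ᶠ y in 𝓝 (Q (φ g)), Q (R y) = y :=
    (hQ.hasStrictFDerivAt' hQ' (by simp)).eventually_right_inverse
  have hQg : Q (φ g) = (χ (s g), P (φ g)) := by
    simp [Q, F, writtenInExtChartAt, φ, χ]
  have hRg : R (Q (φ g)) = φ g := hRQ.self_of_nhds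
  have hφ : ContMDiffAt (𝓡 n) 𝓘(ℝ, EE n) ∞ φ g := contMDiffAt_extChartAt
  have hχ : ContMDiffAt (𝓡 m) 𝓘(ℝ, EE m) ∞ χ (s g) := contMDiffAt_extChartAt
  have hφs : ContMDiffAt 𝓘(ℝ, EE n) (𝓡 n) ∞ φ.symm (φ g) :=
    (contMDiffOn_extChartAt_symm g).contMDiffAt (extChartAt_target_mem_nhds g)
  let p : G → EE (n - m) := fun g' => P (φ g')
  let c : M × EE (n - m) → EE m × EE (n - m) := fun z => (χ z.1, z.2)
  have hc : ContMDiffAt ((𝓡 m).prod 𝓘(ℝ, EE (n - m))) 𝓘(ℝ, EE m × EE (n - m)) ∞ c (s g, p g) :=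
    (ContMDiffAt.comp (s g, p g) (f := Prod.fst) hχ contMDiffAt_fst).prodMk_space contMDiffAt_snd
  have hcg : c (s g, p g) = Q (φ g) := hQg.symm
  have hRc : ContMDiffAt ((𝓡 m).prod 𝓘(ℝ, EE (n - m))) 𝓘(ℝ, EE n) ∞ (fun z => R (c z))
      (s g, p g) := by
    refine ContMDiffAt.comp (s g, p g) (g := R) (f := c) ?_ hc
    rw [hcg]
    exact hR.contMDiffAt
  have hψ : ContMDiffAt ((𝓡 m).prod 𝓘(ℝ, EE (n - m))) (𝓡 n) ∞ (fun z => φ.symm (R (c z)))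
      (s g, p g) := by
    refine ContMDiffAt.comp (s g, p g) (g := φ.symm) (f := fun z => R (c z)) ?_ hRc
    rw [hcg, hRg]
    exact hφs
  have hψg : φ.symm (R (c (s g, p g))) = g := by
    rw [hcg, hRg]; exact extChartAt_to_inv g
  refine ⟨p, fun z => φ.symm (R (c z)), ?_, hψ, ?_, ?_⟩
  · exact P.contMDiff.contMDiffAt.comp g hφ
  · have h1 : ∀ᶠ z in 𝓝 (s g, p g), Q (R (c z)) = c z := by
      refine hc.continuousAt.eventually (p := fun y => Q (R y) = y) ?_
      rw [hcg]; exact hQR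
    have h2 : ∀ᶠ z in 𝓝 (s g, p g), s (φ.symm (R (c z))) ∈ χ.source := by
      have : ContinuousAt (fun z => s (φ.symm (R (c z)))) (s g, p g) := by
        refine ContinuousAt.comp (g := s) ?_ hψ.continuousAt
        rw [hψg]; exact hs.continuousAt
      refine this.eventually_mem ?_
      rw [hψg]; exact extChartAt_source_mem_nhds _
    have h3 : ∀ᶠ z : M × EE (n - m) in 𝓝 (s g, p g), z.1 ∈ χ.source :=
      continuousAt_fst.eventually_mem (extChartAt_source_mem_nhds _)
    filter_upwards [h1, h2, h3] with z h1 h2 h3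
    exact χ.injOn h2 h3 (congrArg Prod.fst h1)
  · have h1 : ∀ᶠ g' in 𝓝 g, R (Q (φ g')) = φ g' := hφ.continuousAt.eventually hRQ
    filter_upwards [h1, extChartAt_source_mem_nhds (I := 𝓡 n) g] with g' h1 h2
    have h3 : Q (φ g') = c (s g', p g') := by
      simp only [Q, c, p, F, writtenInExtChartAt, Function.comp_apply]
      rw [φ.left_inv h2]
    rw [← h3, h1]
    exact φ.left_inv h2

end Submersion

variable {m n : ℕ} {M G : Type*}
    [TopologicalSpace M] [ChartedSpace (EE m) M] [IsManifold (𝓡 m) ∞ M]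
    [TopologicalSpace G] [ChartedSpace (EE n) G] [IsManifold (𝓡 n) ∞ G]

/-! ### The tangent groupoid. -/

namespace LieGroupoid
variable (Γ : LieGroupoid m n M G)

/-! The structure maps of the tangent groupoid `TG ⇉ TM`, with all tangent spaces read in the
preferred charts. -/

/-- The differential of the source map, as a map of model spaces. -/
def tsrc (g : G) : EE n →ₗ[ℝ] EE m := (Γ.dsrc g).toLinearMap
/-- The differential of the target map, as a map of model spaces. -/
def ttgt (g : G) : EE n →ₗ[ℝ] EE m := (Γ.dtgt g).toLinearMap
/-- The differential of the unit map, as a map of model spaces. -/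
def tunit (x : M) : EE m →ₗ[ℝ] EE n := (Γ.dunit x).toLinearMap
/-- The differential of the inversion, as a map of model spaces. -/
def tinv (g : G) : EE n →ₗ[ℝ] EE n := (Γ.dinv g).toLinearMap
/-- The differential of the multiplication, as a map of model spaces. -/
def tmul (g h : G) : EE n × EE n →ₗ[ℝ] EE n := (Γ.dmul g h).toLinearMap

variable {Γ}

theorem _root_.LieGpd.HasVelocity.src {γ : ℝ → G} {g : G} {X : EE n} (h : HasVelocity γ g X) :
    HasVelocity (fun τ => Γ.src (γ τ)) (Γ.src g) (Γ.tsrc g X) :=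
  h.map (Γ.contMDiff_src.mdifferentiableAt (by simp))

theorem _root_.LieGpd.HasVelocity.tgt {γ : ℝ → G} {g : G} {X : EE n} (h : HasVelocity γ g X) :
    HasVelocity (fun τ => Γ.tgt (γ τ)) (Γ.tgt g) (Γ.ttgt g X) :=
  h.map (Γ.contMDiff_tgt.mdifferentiableAt (by simp))

theorem _root_.LieGpd.HasVelocity.inv {γ : ℝ → G} {g : G} {X : EE n} (h : HasVelocity γ g X) :
    HasVelocity (fun τ => Γ.inv (γ τ)) (Γ.inv g) (Γ.tinv g X) :=
  h.map (Γ.contMDiff_inv.mdifferentiableAt (by simp))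

theorem _root_.LieGpd.HasVelocity.unit {γ : ℝ → M} {x : M} {v : EE m} (h : HasVelocity γ x v) :
    HasVelocity (fun τ => Γ.unit (γ τ)) (Γ.unit x) (Γ.tunit x v) :=
  h.map (Γ.contMDiff_unit.mdifferentiableAt (by simp))

/-- `dmul` is a derivative within `G₂`, and the curve stays in `G₂` for times near `0`; that set of
times is a neighbourhood of `0`, which turns the derivative within it into a derivative. Uniqueness
of derivatives within `G₂` plays no role: whichever one `dmul` is, its value on the velocity of a
curve in `G₂` is forced. -/
theorem _root_.LieGpd.HasVelocity.mul {γ η : ℝ → G} {g h : G} {X Y : EE n}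
    (hγ : HasVelocity γ g X) (hη : HasVelocity η h Y)
    (hc : ∀ᶠ τ in 𝓝 0, Γ.src (γ τ) = Γ.tgt (η τ)) :
    HasVelocity (fun τ => Γ.mul (γ τ) (η τ)) (Γ.mul g h) (Γ.tmul g h (X, Y)) := by
  obtain ⟨rfl, hγ⟩ := hγ
  obtain ⟨rfl, hη⟩ := hη
  refine ⟨rfl, ?_⟩
  have hm : MDifferentiableWithinAt ((𝓡 n).prod (𝓡 n)) (𝓡 n) (fun p : G × G => Γ.mul p.1 p.2)
      {p | Γ.src p.1 = Γ.tgt p.2} (γ 0, η 0) :=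
    (Γ.contMDiffOn_mul _ hc.self_of_nhds).mdifferentiableWithinAt (by simp)
  have h1 := (hγ.prodMk hη).hasMFDerivWithinAt (s := {τ | Γ.src (γ τ) = Γ.tgt (η τ)})
  have h2 := (hm.hasMFDerivWithinAt.comp (0 : ℝ) h1 (by intro τ hτ; exact hτ)).hasMFDerivAt hc
  refine h2.congr_mfderiv ?_
  refine ContinuousLinearMap.ext fun τ => ?_
  exact (Γ.dmul (γ 0) (η 0)).map_smul τ (X, Y)

/-- Take any curve with velocity `X` and, in the local product structure of `src`, replace its base
coordinate by `b`. The velocity is unchanged because the two base curves have the same velocity. -/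
theorem exists_hasVelocity_lift {b : ℝ → M} {x : M} {B : EE m} (hb : HasVelocity b x B)
    {g : G} (hg : Γ.src g = x) {X : EE n} (hX : Γ.tsrc g X = B) :
    ∃ a : ℝ → G, HasVelocity a g X ∧ ∀ᶠ τ in 𝓝 0, Γ.src (a τ) = b τ := by
  subst hg hX
  obtain ⟨p, ψ, hp, hψ, h1, h2⟩ := exists_local_form_of_submersion
    (Γ.contMDiff_src.contMDiffAt (x := g)) (Γ.submersion_src g)
  obtain ⟨a, ha⟩ := exists_hasVelocity g X
  have hpa := (hp.mdifferentiableAt (by simp)).hasMFDerivAt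
  obtain ⟨D, hψa⟩ : ∃ D : EE m × EE (n - m) →L[ℝ] EE n,
      HasMFDerivAt ((𝓡 m).prod 𝓘(ℝ, EE (n - m))) (𝓡 n) ψ (Γ.src g, p g) D :=
    ⟨_, (hψ.mdifferentiableAt (by simp)).hasMFDerivAt⟩
  have hs := ha.src (Γ := Γ)
  obtain ⟨rfl, ha⟩ := ha
  have hpa := hpa.comp (0 : ℝ) ha
  -- `(b, p ∘ a)` and `(src ∘ a, p ∘ a)` have the same value and derivative at `0`, and `ψ` sends
  -- the second curve back to `a`.
  have e1 := hb.2.prodMk hpa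
  have e2 := hs.2.prodMk hpa
  have f2 := hψa.comp (0 : ℝ) e2
  rw [← hb.1] at hψa
  have f1 := hψa.comp (0 : ℝ) e1
  have e3 : (fun τ => ψ (Γ.src (a τ), p (a τ))) =ᶠ[𝓝 0] a := by
    have : Tendsto a (𝓝 0) (𝓝 (a 0)) := ha.continuousAt
    exact this.eventually h2
  have f3 := ha.congr_of_eventuallyEq e3
  have key := hasMFDerivAt_unique f2 f3
  refine ⟨fun τ => ψ (b τ, p (a τ)), ⟨?_, f1.congr_mfderiv key⟩, ?_⟩
  · change ψ (b 0, p (a 0)) = a 0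
    rw [hb.1]; exact h2.self_of_nhds
  · have : Tendsto (fun τ => (b τ, p (a τ))) (𝓝 0) (𝓝 (Γ.src (a 0), p (a 0))) := by
      rw [← hb.1]; exact e1.continuousAt
    exact this.eventually h1

theorem exists_hasVelocity_composable {η : ℝ → G} {g h : G} {X Y : EE n} (hη : HasVelocity η h Y)
    (hc : Γ.src g = Γ.tgt h) (hXY : Γ.tsrc g X = Γ.ttgt h Y) :
    ∃ γ : ℝ → G, HasVelocity γ g X ∧ ∀ᶠ τ in 𝓝 0, Γ.src (γ τ) = Γ.tgt (η τ) :=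
  exists_hasVelocity_lift hη.tgt hc hXY

variable (Γ)

/-- Here, as in the identities that follow, the groupoid axiom is applied along curves representing
the given vectors and differentiated at `0`. Tangent composability is what allows the curves
themselves to be chosen composable. -/
theorem tsrc_tmul {g h : G} {X Y : EE n} (hc : Γ.src g = Γ.tgt h)
    (hXY : Γ.tsrc g X = Γ.ttgt h Y) : Γ.tsrc (Γ.mul g h) (Γ.tmul g h (X, Y)) = Γ.tsrc h Y := by
  obtain ⟨η, hη⟩ := exists_hasVelocity h Y
  obtain ⟨γ, hγ, e⟩ := exists_hasVelocity_composable hη hc hXY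
  exact ((hγ.mul hη e).src.congr (e.mono fun τ hτ => (Γ.src_mul _ _ hτ).symm)).unique hη.src

theorem ttgt_tmul {g h : G} {X Y : EE n} (hc : Γ.src g = Γ.tgt h)
    (hXY : Γ.tsrc g X = Γ.ttgt h Y) : Γ.ttgt (Γ.mul g h) (Γ.tmul g h (X, Y)) = Γ.ttgt g X := by
  obtain ⟨η, hη⟩ := exists_hasVelocity h Y
  obtain ⟨γ, hγ, e⟩ := exists_hasVelocity_composable hη hc hXY
  exact ((hγ.mul hη e).tgt.congr (e.mono fun τ hτ => (Γ.tgt_mul _ _ hτ).symm)).unique hγ.tgt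

theorem tmul_assoc {g h k : G} {X Y Z : EE n} (hc : Γ.src g = Γ.tgt h) (hc' : Γ.src h = Γ.tgt k)
    (hXY : Γ.tsrc g X = Γ.ttgt h Y) (hYZ : Γ.tsrc h Y = Γ.ttgt k Z) :
    Γ.tmul (Γ.mul g h) k (Γ.tmul g h (X, Y), Z) = Γ.tmul g (Γ.mul h k) (X, Γ.tmul h k (Y, Z)) := by
  -- Curves are chosen from right to left, since the lifting lemma adjusts the left factor of a
  -- product to a given right factor.
  obtain ⟨ζ, hζ⟩ := exists_hasVelocity k Z
  obtain ⟨η, hη, e'⟩ := exists_hasVelocity_composable hζ hc' hYZ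
  obtain ⟨γ, hγ, e⟩ := exists_hasVelocity_composable hη hc hXY
  have h1 := (hγ.mul hη e).mul hζ (by
    filter_upwards [e, e'] with τ h1 h2
    rw [Γ.src_mul _ _ h1, h2])
  have h2 := hγ.mul (hη.mul hζ e') (by
    filter_upwards [e, e'] with τ h1 h2
    rw [Γ.tgt_mul _ _ h2, h1])
  refine (h1.congr ?_).unique h2
  filter_upwards [e, e'] with τ h1 h2
  rw [Γ.mul_assoc _ _ _ h1 h2]

theorem ttgt_tunit (x : M) (v : EE m) : Γ.ttgt (Γ.unit x) (Γ.tunit x v) = v := by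
  obtain ⟨γ, hγ⟩ := exists_hasVelocity x v
  exact (hγ.unit.tgt.congr (.of_eq (funext fun τ => (Γ.tgt_unit _).symm))).unique hγ

theorem tsrc_tinv (g : G) (X : EE n) : Γ.tsrc (Γ.inv g) (Γ.tinv g X) = Γ.ttgt g X := by
  obtain ⟨γ, hγ⟩ := exists_hasVelocity g X
  exact (hγ.inv.src.congr (.of_eq (funext fun τ => (Γ.src_inv _).symm))).unique hγ.tgt

theorem ttgt_tinv (g : G) (X : EE n) : Γ.ttgt (Γ.inv g) (Γ.tinv g X) = Γ.tsrc g X := by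
  obtain ⟨γ, hγ⟩ := exists_hasVelocity g X
  exact (hγ.inv.tgt.congr (.of_eq (funext fun τ => (Γ.tgt_inv _).symm))).unique hγ.src

theorem tunit_tmul (g : G) (X : EE n) :
    Γ.tmul (Γ.unit (Γ.tgt g)) g (Γ.tunit (Γ.tgt g) (Γ.ttgt g X), X) = X := by
  obtain ⟨γ, hγ⟩ := exists_hasVelocity g X
  exact ((hγ.tgt.unit.mul hγ (.of_forall fun τ => Γ.src_unit _)).congr
    (.of_eq (funext fun τ => (Γ.unit_mul _).symm))).unique hγ

theorem tmul_tunit (g : G) (X : EE n) :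
    Γ.tmul g (Γ.unit (Γ.src g)) (X, Γ.tunit (Γ.src g) (Γ.tsrc g X)) = X := by
  obtain ⟨γ, hγ⟩ := exists_hasVelocity g X
  exact ((hγ.mul hγ.src.unit (.of_forall fun τ => (Γ.tgt_unit _).symm)).congr
    (.of_eq (funext fun τ => (Γ.mul_unit _).symm))).unique hγ

theorem tmul_tinv (g : G) (X : EE n) :
    Γ.tmul g (Γ.inv g) (X, Γ.tinv g X) = Γ.tunit (Γ.tgt g) (Γ.ttgt g X) := by
  obtain ⟨γ, hγ⟩ := exists_hasVelocity g X
  exact ((hγ.mul hγ.inv (.of_forall fun τ => (Γ.tgt_inv _).symm)).congr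
    (.of_eq (funext fun τ => (Γ.mul_inv _).symm))).unique hγ.tgt.unit

theorem tinv_tmul (g : G) (X : EE n) :
    Γ.tmul (Γ.inv g) g (Γ.tinv g X, X) = Γ.tunit (Γ.src g) (Γ.tsrc g X) := by
  obtain ⟨γ, hγ⟩ := exists_hasVelocity g X
  exact ((hγ.inv.mul hγ (.of_forall fun τ => Γ.src_inv _)).congr
    (.of_eq (funext fun τ => (Γ.inv_mul _).symm))).unique hγ.src.unit

end LieGroupoid

/-! ### Right and left translation. -/

namespace LieGroupoid
variable (Γ : LieGroupoid m n M G)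

theorem inv_unit (x : M) : Γ.inv (Γ.unit x) = Γ.unit x := by
  have h := Γ.mul_inv (Γ.unit x)
  rw [Γ.tgt_unit] at h
  have h' := Γ.unit_mul (Γ.inv (Γ.unit x))
  rw [Γ.tgt_inv, Γ.src_unit, h] at h'
  exact h'.symm

theorem unit_mul_unit (x : M) : Γ.mul (Γ.unit x) (Γ.unit x) = Γ.unit x := by
  have h := Γ.mul_unit (Γ.unit x)
  rwa [Γ.src_unit] at h

/-- Right translation with values in the model space. -/
def rtr (g : G) (y : M) : Γ.Alg y →ₗ[ℝ] EE n := Γ.rightTr g y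
/-- Left translation with values in the model space. -/
def ltr (g : G) (x : M) : Γ.Alg x →ₗ[ℝ] EE n := Γ.leftTr g x
/-- The anchor with values in the model space. -/
def anc (x : M) : Γ.Alg x →ₗ[ℝ] EE m := Γ.anchor x
/-- The inclusion of `A_x` in the model space. -/
def incl (x : M) : Γ.Alg x →ₗ[ℝ] EE n := (Γ.Alg x).subtype

theorem rtr_apply (g : G) (y : M) (α : Γ.Alg y) :
    Γ.rtr g y α = Γ.tmul (Γ.unit y) g (Γ.incl y α, 0) := rfl

theorem ltr_apply (g : G) (x : M) (α : Γ.Alg x) :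
    Γ.ltr g x α = Γ.tmul g (Γ.unit x) (0, Γ.tinv (Γ.unit x) (Γ.incl x α)) := rfl

theorem anc_apply (x : M) (α : Γ.Alg x) : Γ.anc x α = Γ.ttgt (Γ.unit x) (Γ.incl x α) := rfl

theorem tsrc_incl (x : M) (α : Γ.Alg x) : Γ.tsrc (Γ.unit x) (Γ.incl x α) = 0 := α.2

theorem incl_injective (x : M) : Function.Injective (Γ.incl x) := Subtype.val_injective

/-- Inversion fixes units and exchanges source and target, so `dι(α)` is tangent to the target
fibre. The last clause is `dι(α) · α = 1_{ds α} = 0`. -/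
theorem tinv_incl (x : M) (α : Γ.Alg x) :
    Γ.tsrc (Γ.unit x) (Γ.tinv (Γ.unit x) (Γ.incl x α)) = Γ.anc x α ∧
    Γ.ttgt (Γ.unit x) (Γ.tinv (Γ.unit x) (Γ.incl x α)) = 0 ∧
    Γ.tmul (Γ.unit x) (Γ.unit x) (Γ.tinv (Γ.unit x) (Γ.incl x α), Γ.incl x α) = 0 := by
  have h1 := Γ.tsrc_tinv (Γ.unit x) (Γ.incl x α)
  have h2 := Γ.ttgt_tinv (Γ.unit x) (Γ.incl x α)
  have h3 := Γ.tinv_tmul (Γ.unit x) (Γ.incl x α)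
  rw [Γ.inv_unit] at h1 h2 h3
  rw [tsrc_incl, map_zero] at h3
  exact ⟨h1, h2.trans (Γ.tsrc_incl x α), h3⟩

variable {Γ}

section
variable {g h : G} {z y x : M}

theorem tsrc_rtr (hg : Γ.tgt g = y) (α : Γ.Alg y) : Γ.tsrc g (Γ.rtr g y α) = 0 := by
  subst hg
  have := Γ.tsrc_tmul (g := Γ.unit (Γ.tgt g)) (h := g) (X := Γ.incl _ α) (Y := 0)
    (Γ.src_unit _) (by rw [tsrc_incl, map_zero])
  rw [Γ.unit_mul, map_zero] at this
  exact this

theorem ttgt_rtr (hg : Γ.tgt g = y) (α : Γ.Alg y) : Γ.ttgt g (Γ.rtr g y α) = Γ.anc y α := by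
  subst hg
  have := Γ.ttgt_tmul (g := Γ.unit (Γ.tgt g)) (h := g) (X := Γ.incl _ α) (Y := 0)
    (Γ.src_unit _) (by rw [tsrc_incl, map_zero])
  rw [Γ.unit_mul] at this
  exact this

theorem tsrc_ltr (hg : Γ.src g = x) (α : Γ.Alg x) : Γ.tsrc g (Γ.ltr g x α) = Γ.anc x α := by
  subst hg
  have := Γ.tsrc_tmul (g := g) (h := Γ.unit (Γ.src g)) (X := 0)
    (Y := Γ.tinv (Γ.unit (Γ.src g)) (Γ.incl _ α))
    (Γ.tgt_unit _).symm (by rw [(Γ.tinv_incl _ α).2.1, map_zero])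
  rw [Γ.mul_unit, (Γ.tinv_incl _ α).1] at this
  exact this

theorem ttgt_ltr (hg : Γ.src g = x) (α : Γ.Alg x) : Γ.ttgt g (Γ.ltr g x α) = 0 := by
  subst hg
  have := Γ.ttgt_tmul (g := g) (h := Γ.unit (Γ.src g)) (X := 0)
    (Y := Γ.tinv (Γ.unit (Γ.src g)) (Γ.incl _ α))
    (Γ.tgt_unit _).symm (by rw [(Γ.tinv_incl _ α).2.1, map_zero])
  rw [Γ.mul_unit, map_zero] at this
  exact this

/-- Associativity: `(β · 0_g) · 0_h = β · (0_g · 0_h)`, and `0_g · 0_h = 0_{gh}` by linearity. -/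
theorem rtr_mul (hg : Γ.tgt g = z) (hgh : Γ.src g = Γ.tgt h) (β : Γ.Alg z) :
    Γ.rtr (Γ.mul g h) z β = Γ.tmul g h (Γ.rtr g z β, 0) := by
  subst hg
  have := Γ.tmul_assoc (g := Γ.unit (Γ.tgt g)) (h := g) (k := h) (X := Γ.incl _ β) (Y := 0)
    (Z := 0) (Γ.src_unit _) hgh (by rw [tsrc_incl, map_zero]) (by rw [map_zero, map_zero])
  rw [Γ.unit_mul, ← Prod.zero_eq_mk, map_zero] at this
  exact this.symm

theorem ltr_mul (hh : Γ.src h = x) (hgh : Γ.src g = Γ.tgt h) (α : Γ.Alg x) :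
    Γ.ltr (Γ.mul g h) x α = Γ.tmul g h (0, Γ.ltr h x α) := by
  subst hh
  have := Γ.tmul_assoc (g := g) (h := h) (k := Γ.unit (Γ.src h)) (X := 0) (Y := 0)
    (Z := Γ.tinv (Γ.unit (Γ.src h)) (Γ.incl _ α)) hgh (Γ.tgt_unit _).symm
    (by rw [map_zero, map_zero]) (by rw [(Γ.tinv_incl _ α).2.1, map_zero])
  rw [Γ.mul_unit, ← Prod.zero_eq_mk, map_zero] at this
  exact this

/-- Right translation by the inverse arrow inverts right translation. -/
theorem incl_eq_tmul_inv (hg : Γ.tgt g = y) (α : Γ.Alg y) :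
    Γ.incl y α = Γ.tmul g (Γ.inv g) (Γ.rtr g y α, 0) := by
  subst hg
  have := Γ.tmul_assoc (g := Γ.unit (Γ.tgt g)) (h := g) (k := Γ.inv g) (X := Γ.incl _ α) (Y := 0)
    (Z := 0) (Γ.src_unit _) (Γ.tgt_inv _).symm (by rw [tsrc_incl, map_zero])
    (by rw [map_zero, map_zero])
  rw [Γ.unit_mul, ← Prod.zero_eq_mk, map_zero, Γ.mul_inv] at this
  rw [rtr_apply, this]
  have h2 := Γ.tmul_tunit (Γ.unit (Γ.tgt g)) (Γ.incl _ α)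
  rw [tsrc_incl, map_zero, Γ.src_unit] at h2
  exact h2.symm

theorem rtr_injective (hg : Γ.tgt g = y) : Function.Injective (Γ.rtr g y) := by
  intro α β h
  apply Γ.incl_injective
  rw [incl_eq_tmul_inv hg, h, ← incl_eq_tmul_inv hg]

/-- The preimage is `Z · 0_{g⁻¹}`, which is composable because `ds Z = 0`. Together with injectivity
this makes the arbitrary linear extension in `rightInv` harmless. -/
theorem exists_rtr_eq (hg : Γ.tgt g = y) {Z : EE n} (hZ : Γ.tsrc g Z = 0) :
    ∃ α : Γ.Alg y, Γ.rtr g y α = Z := by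
  subst hg
  have h1 := Γ.tsrc_tmul (g := g) (h := Γ.inv g) (X := Z) (Y := 0) (Γ.tgt_inv _).symm
    (by rw [hZ, map_zero])
  rw [Γ.mul_inv, map_zero] at h1
  refine ⟨⟨Γ.tmul g (Γ.inv g) (Z, 0), h1⟩, ?_⟩
  have := Γ.tmul_assoc (g := g) (h := Γ.inv g) (k := g) (X := Z) (Y := 0)
    (Z := 0) (Γ.tgt_inv _).symm (Γ.src_inv _) (by rw [hZ, map_zero])
    (by rw [map_zero, map_zero])
  rw [Γ.mul_inv, Γ.inv_mul, ← Prod.zero_eq_mk, map_zero] at this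
  refine Eq.trans this ?_
  have h2 := Γ.tmul_tunit g Z
  rwa [hZ, map_zero] at h2

theorem rightInv_rtr (hg : Γ.tgt g = y) (α : Γ.Alg y) : Γ.rightInv g y (Γ.rtr g y α) = α :=
  LinearMap.leftInverse_apply_of_inj (LinearMap.ker_eq_bot.2 (rtr_injective hg)) α

theorem rtr_rightInv (hg : Γ.tgt g = y) {Z : EE n} (hZ : Γ.tsrc g Z = 0) :
    Γ.rtr g y (Γ.rightInv g y Z) = Z := by
  obtain ⟨α, rfl⟩ := exists_rtr_eq hg hZ
  rw [rightInv_rtr hg]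

/-- As `dt w = 0`, one has `w = 0 · w` and hence `r_h(β) + w = β · w`. So `(0_g · dι(β)) · (β · w) =
0_g · ((dι(β) · β) · w) = 0_g · w`: left translation by `β` absorbs right translation by `β`. -/
theorem tmul_ltr_rtr (hg : Γ.src g = y) (hh : Γ.tgt h = y) (β : Γ.Alg y) {w : EE n}
    (hw : Γ.ttgt h w = 0) :
    Γ.tmul g h (Γ.ltr g y β, Γ.rtr h y β + w) = Γ.tmul g h (0, w) := by
  subst hh
  obtain ⟨i1, i2, i3⟩ := Γ.tinv_incl _ β
  have e1 : Γ.rtr h _ β + w = Γ.tmul (Γ.unit (Γ.tgt h)) h (Γ.incl _ β, w) := by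
    have h1 := Γ.tunit_tmul h w
    rw [hw, map_zero] at h1
    rw [rtr_apply]
    nth_rw 1 [← h1]
    rw [← map_add, Prod.mk_add_mk, add_zero, zero_add]
  have c1 : Γ.tsrc (Γ.unit (Γ.tgt h)) (Γ.incl _ β) = Γ.ttgt h w := by rw [tsrc_incl, hw]
  have h2 := Γ.tmul_assoc (g := Γ.unit (Γ.tgt h)) (h := Γ.unit (Γ.tgt h)) (k := h)
    (X := Γ.tinv (Γ.unit (Γ.tgt h)) (Γ.incl _ β)) (Y := Γ.incl _ β) (Z := w)
    ((Γ.src_unit _).trans (Γ.tgt_unit _).symm) (Γ.src_unit _) i1 c1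
  rw [i3, Γ.unit_mul_unit, Γ.unit_mul] at h2
  have h3 := Γ.tunit_tmul h w
  rw [hw, map_zero] at h3
  rw [h3] at h2
  have h4 := Γ.tmul_assoc (g := g) (h := Γ.unit (Γ.tgt h)) (k := h)
    (X := 0) (Y := Γ.tinv (Γ.unit (Γ.tgt h)) (Γ.incl _ β))
    (Z := Γ.tmul (Γ.unit (Γ.tgt h)) h (Γ.incl _ β, w))
    (hg.trans (Γ.tgt_unit _).symm) (Γ.src_unit _) (by rw [i2, map_zero]) (by
      have h5 := Γ.ttgt_tmul (Γ.src_unit _) c1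
      rw [Γ.unit_mul] at h5
      rw [i1, h5]; rfl)
  rw [← h2, Γ.unit_mul] at h4
  have h6 := Γ.mul_unit g
  rw [hg] at h6
  rw [h6] at h4
  rw [e1]
  exact h4

end

/-! ### The pointwise identities for `ω`, `λ` and `K`. -/

namespace Connection
variable (c : Γ.Connection)

/-- The splitting, as a map of model spaces. -/
def split (g : G) : EE m →ₗ[ℝ] EE n := (c.σ g).toLinearMap
/-- The quasi-action on `TM`, as a map of model spaces. -/
def act (g : G) : EE m →ₗ[ℝ] EE m := Γ.ttgt g ∘ₗ c.split g

theorem act_apply (g : G) (v : EE m) : c.act g v = Γ.ttgt g (c.split g v) := rfl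

theorem tsrc_split (g : G) (v : EE m) : Γ.tsrc g (c.split g v) = v := c.dsrc_σ g v

theorem split_unit (x : M) (v : EE m) : c.split (Γ.unit x) v = Γ.tunit x v := by
  exact c.σ_unit x v

section
variable {g h k : G} {z y x w : M}

theorem rtr_omega (hg : Γ.tgt g = y) (X : EE n) :
    Γ.rtr g y (c.omega g y X) = X - c.split g (Γ.tsrc g X) :=
  rtr_rightInv hg (by
    change Γ.tsrc g (X - c.split g (Γ.tsrc g X)) = 0
    rw [map_sub, tsrc_split, sub_self])

theorem omega_rtr (hg : Γ.tgt g = y) (α : Γ.Alg y) : c.omega g y (Γ.rtr g y α) = α := by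
  apply rtr_injective hg
  rw [c.rtr_omega hg, tsrc_rtr hg, map_zero, sub_zero]

/-- The splitting term is `σ_g(ds(l_g α))`, and `ds ∘ l_g = ρ`. This formula replaces the definition
of `λ` on `A` everywhere below. -/
theorem rtr_lamA (hg : Γ.tgt g = y) (hx : Γ.src g = x) (α : Γ.Alg x) :
    Γ.rtr g y (c.lamA g y x α) = c.split g (Γ.anc x α) - Γ.ltr g x α := by
  have : c.lamA g y x α = -c.omega g y (Γ.ltr g x α) := rfl
  rw [this, map_neg, c.rtr_omega hg, tsrc_ltr hx, neg_sub]

/-- The right-hand side lies in `Ker(ds)`: both of its terms have source `X`. That is the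
well-definedness of `K`. -/
theorem rtr_Kbas (hg : Γ.tgt g = z) (hy : Γ.src g = y) (hh : Γ.tgt h = y) (X : EE m) :
    Γ.rtr (Γ.mul g h) z (c.Kbas g h z y x X) =
      Γ.tmul g h (c.split g (c.act h X), c.split h X) - c.split (Γ.mul g h) X := by
  subst hh
  refine rtr_rightInv ((Γ.tgt_mul g h hy).trans hg) (Z :=
    Γ.tmul g h (c.split g (c.act h X), c.split h X) - c.split (Γ.mul g h) X) ?_
  rw [map_sub, Γ.tsrc_tmul hy (Y := c.split h X) (c.tsrc_split g (c.act h X)), tsrc_split, tsrc_split, sub_self]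

theorem anc_lamA (hg : Γ.tgt g = y) (hx : Γ.src g = x) (α : Γ.Alg x) :
    Γ.anc y (c.lamA g y x α) = c.act g (Γ.anc x α) := by
  rw [← ttgt_rtr hg, c.rtr_lamA hg hx, map_sub, ttgt_ltr hx, sub_zero, act_apply]

theorem act_act (hg : Γ.tgt g = z) (hy : Γ.src g = y) (hh : Γ.tgt h = y) (X : EE m) :
    c.act g (c.act h X) - c.act (Γ.mul g h) X = Γ.anc z (c.Kbas g h z y x X) := by
  rw [← ttgt_rtr ((Γ.tgt_mul g h (hy.trans hh.symm)).trans hg), c.rtr_Kbas hg hy hh, map_sub,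
    Γ.ttgt_tmul (hy.trans hh.symm) (Y := c.split h X) (c.tsrc_split g (c.act h X))]
  rfl

/-- Put `β = λ_h α`. After `r_{gh}` the left side is `(σ_g(ρ β) - l_g β) · 0 - σ_{gh}(ρ α) + 0 · l_h
α`. Since `σ_h(ρ α) = r_h β + l_h α`, the cancellation lemma turns `0 · l_h α` into `l_g β · σ_h(ρ
α)`. The `l_g β` terms then cancel and `σ_g(λ_h ρ α) · σ_h(ρ α) - σ_{gh}(ρ α)` remains. -/
theorem lamA_lamA (hg : Γ.tgt g = z) (hy : Γ.src g = y) (hh : Γ.tgt h = y) (hx : Γ.src h = x)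
    (α : Γ.Alg x) :
    c.lamA g z y (c.lamA h y x α) - c.lamA (Γ.mul g h) z x α =
      c.Kbas g h z y x (Γ.anc x α) := by
  have hgh := hy.trans hh.symm
  have ht := (Γ.tgt_mul g h hgh).trans hg
  have hs := (Γ.src_mul g h hgh).trans hx
  apply rtr_injective ht
  have h1 : c.split h (Γ.anc x α) = Γ.rtr h y (c.lamA h y x α) + Γ.ltr h x α := by
    rw [c.rtr_lamA hh hx, sub_add_cancel]
  rw [map_sub, rtr_mul hg hgh, c.rtr_lamA hg hy, c.rtr_lamA ht hs, c.rtr_Kbas hg hy hh,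
    ltr_mul hx hgh, ← tmul_ltr_rtr hy hh (c.lamA h y x α) (ttgt_ltr hx α), ← h1,
    c.anc_lamA hh hx, sub_sub_eq_add_sub, ← map_add, Prod.mk_add_mk, sub_add_cancel, zero_add]

/-- After `r_{ghk}` the `σ_{ghk}(X)` terms of `K(gh,k)` and `K(g,hk)` cancel. The other terms are
the two bracketings of `σ_g(λ_h λ_k X)`, `σ_h(λ_k X)`, `σ_k(X)`, corrected by products that cancel
in pairs. -/
theorem Kbas_cocycle (hg : Γ.tgt g = z) (hy : Γ.src g = y) (hh : Γ.tgt h = y) (hx : Γ.src h = x)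
    (hk : Γ.tgt k = x) (X : EE m) :
    c.lamA g z y (c.Kbas h k y x w X) - c.Kbas (Γ.mul g h) k z x w X +
      c.Kbas g (Γ.mul h k) z y w X - c.Kbas g h z y x (c.act k X) = 0 := by
  have hgh := hy.trans hh.symm
  have hhk := hx.trans hk.symm
  have thk := (Γ.tgt_mul h k hhk).trans hh
  have tgh := (Γ.tgt_mul g h hgh).trans hg
  have sgh := (Γ.src_mul g h hgh).trans hx
  have hghk : Γ.src g = Γ.tgt (Γ.mul h k) := hy.trans thk.symm
  have e := Γ.mul_assoc g h k hgh hhk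
  apply rtr_injective ((Γ.tgt_mul g (Γ.mul h k) hghk).trans hg)
  have k1 := rtr_mul hg hghk (c.lamA g z y (c.Kbas h k y x w X))
  have k2 := c.rtr_Kbas (x := w) tgh sgh hk X
  have k3 := c.rtr_Kbas (x := w) hg hy thk X
  have k4 := rtr_mul tgh (sgh.trans hk.symm) (c.Kbas g h z y x (c.act k X))
  -- The anchor of `K(h,k)X` is replaced by `λ_h λ_k X - λ_{hk} X`.
  rw [c.rtr_lamA hg hy, ← c.act_act hh hx hk] at k1
  rw [c.rtr_Kbas hg hy hh] at k4
  rw [e] at k2 k4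
  have hL := tmul_ltr_rtr hy thk (c.Kbas h k y x w X) (map_zero _)
  rw [add_zero, c.rtr_Kbas hh hx hk, ← Prod.zero_eq_mk, map_zero] at hL
  have hA := Γ.tmul_assoc hgh hhk (X := c.split g (c.act h (c.act k X)))
    (Y := c.split h (c.act k X)) (Z := c.split k X) (c.tsrc_split g _) (c.tsrc_split h _)
  rw [map_zero, map_sub, map_add, map_sub, k1, k2, k3, k4]
  -- Vectors with the same right factor `σ_k(X)` are subtracted, so that the second component
  -- becomes `0`.
  have d1 : Γ.tmul (Γ.mul g h) k (Γ.tmul g h (c.split g (c.act h (c.act k X)),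
      c.split h (c.act k X)) - c.split (Γ.mul g h) (c.act k X), 0) =
      Γ.tmul (Γ.mul g h) k (Γ.tmul g h (c.split g (c.act h (c.act k X)),
      c.split h (c.act k X)), c.split k X) -
      Γ.tmul (Γ.mul g h) k (c.split (Γ.mul g h) (c.act k X), c.split k X) := by
    rw [← map_sub, Prod.mk_sub_mk, sub_self]
  -- Subtracting `hL`, which is zero, adds `r_{hk}(K(h,k)X)` to the right factor. This replaces
  -- `σ_{hk}(X)` by `σ_h(λ_k X) · σ_k(X)` and removes the left translation from the left factor.
  have d2 : Γ.tmul g (Γ.mul h k) (c.split g (c.act h (c.act k X) - c.act (Γ.mul h k) X) -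
      Γ.ltr g y (c.Kbas h k y x w X), 0) + Γ.tmul g (Γ.mul h k)
        (c.split g (c.act (Γ.mul h k) X), c.split (Γ.mul h k) X) =
      Γ.tmul g (Γ.mul h k) (c.split g (c.act h (c.act k X)),
        Γ.tmul h k (c.split h (c.act k X), c.split k X)) := by
    refine Eq.trans ?_ (sub_zero _)
    refine Eq.trans ?_ (congrArg (fun v => _ - v) hL)
    rw [← map_add, ← map_sub, Prod.mk_add_mk, Prod.mk_sub_mk, map_sub]
    congr 2
    · abel
    · rw [zero_add]; abel
  rw [d1, hA, ← d2]
  abel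

/-- At a unit `σ` is the unit map, and `1_{ρ α} = α · dι(α)`. Subtracting `l(α) = 0 · dι(α)` leaves
`α · 0 = r(α)`. -/
theorem lamA_unit (x : M) (α : Γ.Alg x) : c.lamA (Γ.unit x) x x α = α := by
  apply rtr_injective (Γ.tgt_unit x)
  rw [c.rtr_lamA (Γ.tgt_unit x) (Γ.src_unit x), split_unit]
  have h1 := Γ.tmul_tinv (Γ.unit x) (Γ.incl x α)
  rw [Γ.inv_unit, Γ.tgt_unit] at h1
  have h2 := Γ.tmul_tunit (Γ.unit x) (Γ.incl x α)
  rw [Γ.src_unit] at h2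
  rw [anc_apply, ← h1, ltr_apply, rtr_apply, ← map_sub, Prod.mk_sub_mk, sub_zero, sub_self]

theorem act_unit (x : M) (v : EE m) : c.act (Γ.unit x) v = v := by
  rw [act_apply, split_unit, Γ.ttgt_tunit]

theorem Kbas_unit_left (hh : Γ.tgt h = y) (X : EE m) :
    c.Kbas (Γ.unit y) h y y x X = 0 := by
  subst hh
  have ht : Γ.tgt (Γ.mul (Γ.unit (Γ.tgt h)) h) = Γ.tgt h := by rw [Γ.unit_mul]
  apply rtr_injective ht
  rw [c.rtr_Kbas (Γ.tgt_unit _) (Γ.src_unit _) rfl, split_unit, act_apply, Γ.tunit_tmul,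
    Γ.unit_mul, sub_self, map_zero]

theorem Kbas_unit_right (hg : Γ.tgt g = z) (X : EE m) :
    c.Kbas g (Γ.unit (Γ.src g)) z (Γ.src g) x X = 0 := by
  have ht : Γ.tgt (Γ.mul g (Γ.unit (Γ.src g))) = z := by rw [Γ.mul_unit, hg]
  apply rtr_injective ht
  rw [c.rtr_Kbas hg rfl (Γ.tgt_unit _), split_unit, act_unit, Γ.mul_unit, map_zero]
  have := Γ.tmul_tunit g (c.split g X)
  rw [tsrc_split] at this
  rw [this, sub_self]

end
end Connection
end LieGroupoid

/-! ### Smoothness criteria for maps into and out of tangent bundles. -/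

section TangentMap

variable {E₁ H₁ X E₂ H₂ Y : Type*} [NormedAddCommGroup E₁] [NormedSpace ℝ E₁] [TopologicalSpace H₁]
  {I₁ : ModelWithCorners ℝ E₁ H₁} [TopologicalSpace X] [ChartedSpace H₁ X] [IsManifold I₁ ∞ X]
  [NormedAddCommGroup E₂] [NormedSpace ℝ E₂] [TopologicalSpace H₂]
  {I₂ : ModelWithCorners ℝ E₂ H₂} [TopologicalSpace Y] [ChartedSpace H₂ Y] [IsManifold I₂ ∞ Y]

/-- A pointwise version is needed because the extension of the multiplication is known to be smooth
only at the chosen pair. -/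
theorem contMDiffAt_tangentMap {f : X → Y} {x₀ : TangentBundle I₁ X}
    (hf : ContMDiffAt I₁ I₂ ∞ f x₀.1) :
    ContMDiffAt I₁.tangent I₂.tangent ∞ (tangentMap I₁ I₂ f) x₀ := by
  have : IsManifold I₁ 1 X := .of_le (n := ∞) (by simp)
  have : IsManifold I₂ 1 Y := .of_le (n := ∞) (by simp)
  let b₁ : TangentBundle I₁ X → X := fun p ↦ p.1
  let v : Π (y : TangentBundle I₁ X), TangentSpace I₁ (b₁ y) := fun y ↦ y.2
  have hv : ContMDiffAt I₁.tangent I₁.tangent ∞ (fun y ↦ (v y : TangentBundle I₁ X)) x₀ :=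
    contMDiffAt_id
  let b₂ : TangentBundle I₁ X → Y := f ∘ b₁
  have hb₂ : ContMDiffAt I₁.tangent I₂ ∞ b₂ x₀ := hf.comp _ (contMDiffAt_proj (TangentSpace I₁))
  let ϕ : Π (y : TangentBundle I₁ X), TangentSpace I₁ (b₁ y) →L[ℝ] TangentSpace I₂ (b₂ y) :=
    fun y ↦ mfderiv I₁ I₂ f (b₁ y)
  have hϕ : ContMDiffAt I₁.tangent 𝓘(ℝ, E₁ →L[ℝ] E₂) ∞ (fun y ↦
      ContinuousLinearMap.inCoordinates E₁ (TangentSpace I₁ (M := X)) E₂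
      (TangentSpace I₂ (M := Y)) (b₁ x₀) (b₁ y) (b₂ x₀) (b₂ y) (ϕ y)) x₀ :=
    (ContMDiffAt.mfderiv_const hf (m := ∞) (by simp)).comp x₀ (contMDiffAt_proj (TangentSpace I₁))
  exact ContMDiffAt.clm_apply_of_inCoordinates hϕ hv hb₂

theorem tangentBundle_mk_eq {x y : X} (h : x = y) {v w : E₁} (h' : v = w) :
    (⟨x, v⟩ : TangentBundle I₁ X) = ⟨y, w⟩ := by
  subst h h'; rfl

end TangentMap

/-- To be applied to the inclusion of `A` in `TG` over the unit map. In trivialisations the map is a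
smooth family `Ψ` of linear maps on the fibre coordinate. -/
theorem contMDiff_of_fibre_coord (V : SmoothVB m M) (j : V.Tot → TangentBundle (𝓡 n) G)
    {u : M → G} (hu : ContMDiff (𝓡 m) (𝓡 n) ∞ u) (hj : ∀ a, (j a).1 = u a.1)
    (Ψ : M → M → V.F →L[ℝ] EE n) {dom : M → Set M} (hdo : ∀ x, IsOpen (dom x))
    (hdm : ∀ x, x ∈ dom x)
    (hΨ : ∀ x₀, ContMDiffAt (𝓡 m) 𝓘(ℝ, V.F →L[ℝ] EE n) ∞ (Ψ x₀) x₀)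
    (h : ∀ (x₀ : M) (a : V.Tot), a.1 ∈ dom x₀ →
      (trivializationAt (EE n) (TangentSpace (𝓡 n) : G → Type _) (u x₀) (j a)).2 =
        Ψ x₀ a.1 (trivializationAt V.F V.Fib x₀ a).2) :
    ContMDiff V.J (𝓡 n).tangent ∞ j := by
  intro a₀
  have hπ : ContMDiff V.J (𝓡 m) ∞ (TotalSpace.proj : V.Tot → M) := contMDiff_proj V.Fib
  rw [contMDiffAt_totalSpace, hj]
  refine ⟨((hu.comp hπ).congr fun a => hj a).contMDiffAt, ?_⟩
  have h1 : ContMDiffAt V.J 𝓘(ℝ, V.F →L[ℝ] EE n) ∞ (fun a : V.Tot => Ψ a₀.1 a.1) a₀ :=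
    ContMDiffAt.comp a₀ (f := (TotalSpace.proj : V.Tot → M)) (hΨ a₀.1) hπ.contMDiffAt
  have h2 : ContMDiffAt V.J 𝓘(ℝ, V.F) ∞
      (fun a : V.Tot => (trivializationAt V.F V.Fib a₀.1 a).2) a₀ :=
    (contMDiffAt_totalSpace.1 (contMDiffAt_id (x := a₀))).2
  refine (h1.clm_apply h2).congr_of_eventuallyEq ?_
  filter_upwards [(hπ.continuous.isOpen_preimage _ (hdo a₀.1)).mem_nhds (hdm a₀.1)] with a ha
  exact h a₀.1 a ha

/-- The converse direction: the fibre coordinate is a fixed linear image `P` of the coordinate in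
`TG`, and the base point is recovered by `s`, a left inverse of `u`. -/
theorem contMDiffOn_of_comp_fibre_coord (V : SmoothVB m M) (j : V.Tot → TangentBundle (𝓡 n) G)
    (u : M → G) {s : G → M} (hs : ContMDiff (𝓡 n) (𝓡 m) ∞ s) (hsu : ∀ x, s (u x) = x)
    (hj : ∀ a, (j a).1 = u a.1)
    (P : M → EE n →L[ℝ] V.F) {dom : M → Set M} (hdo : ∀ x, IsOpen (dom x))
    (hdm : ∀ x, x ∈ dom x)
    (h : ∀ (x₀ : M) (a : V.Tot), a.1 ∈ dom x₀ → (trivializationAt V.F V.Fib x₀ a).2 =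
      P x₀ (trivializationAt (EE n) (TangentSpace (𝓡 n) : G → Type _) (u x₀) (j a)).2)
    {E' H' N : Type*} [NormedAddCommGroup E'] [NormedSpace ℝ E'] [TopologicalSpace H']
    {I' : ModelWithCorners ℝ E' H'} [TopologicalSpace N] [ChartedSpace H' N] {S : Set N}
    {f : N → V.Tot} (hf : ContMDiffOn I' (𝓡 n).tangent ∞ (fun q => j (f q)) S) :
    ContMDiffOn I' V.J ∞ f S := by
  intro q₀ hq₀
  have h0 := contMDiffWithinAt_totalSpace.1 (hf q₀ hq₀)
  have hb : ContMDiffWithinAt I' (𝓡 m) ∞ (fun q => (f q).1) S q₀ := by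
    have := hs.contMDiffAt.comp_contMDiffWithinAt q₀ h0.1
    refine this.congr (fun q _ => ?_) ?_ <;> simp [hj, hsu]
  have h2 := h0.2
  rw [hj] at h2
  rw [contMDiffWithinAt_totalSpace]
  refine ⟨hb, ((P (f q₀).1).contMDiff.contMDiffAt.comp_contMDiffWithinAt q₀
    h2).congr_of_eventuallyEq_of_mem ?_ hq₀⟩
  filter_upwards [hb.continuousWithinAt.preimage_mem_nhdsWithin
    ((hdo (f q₀).1).mem_nhds (hdm (f q₀).1))] with q hq
  exact h _ _ hq

/-! ### Smoothness of the tangent multiplication and of maps to `A`. -/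

namespace LieGroupoid
variable (Γ : LieGroupoid m n M G)

/-- The multiplication of the tangent groupoid, on all pairs of tangent vectors. -/
def tangentMul (q : TangentBundle (𝓡 n) G × TangentBundle (𝓡 n) G) : TangentBundle (𝓡 n) G :=
  ⟨Γ.mul q.1.1 q.2.1, Γ.tmul q.1.1 q.2.1 (q.1.2, q.2.2)⟩

variable {Γ} in
/-- The multiplication extends smoothly from the composable pairs to a neighbourhood of such a
pair. -/
theorem exists_mul_extension {g h : G} (hgh : Γ.src g = Γ.tgt h) :
    ∃ μ : G × G → G, ContMDiffAt ((𝓡 n).prod (𝓡 n)) (𝓡 n) ∞ μ (g, h) ∧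
      ∀ᶠ z in 𝓝 (g, h), Γ.src z.1 = Γ.tgt z.2 → μ z = Γ.mul z.1 z.2 := by
  obtain ⟨p, ψ, hp, hψ, h1, h2⟩ := exists_local_form_of_submersion
    (Γ.contMDiff_src.contMDiffAt (x := g)) (Γ.submersion_src g)
  let e : G × G → M × EE (n - m) := fun z => (Γ.tgt z.2, p z.1)
  have he : ContMDiffAt ((𝓡 n).prod (𝓡 n)) ((𝓡 m).prod 𝓘(ℝ, EE (n - m))) ∞ e (g, h) :=
    ((Γ.contMDiff_tgt.comp contMDiff_snd).contMDiffAt).prodMk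
      (ContMDiffAt.comp (g, h) (f := Prod.fst) hp contMDiffAt_fst)
  have heg : e (g, h) = (Γ.src g, p g) := by simp [e, hgh]
  -- Near `(g, h)` this is a smooth retraction onto the composable pairs: it moves the first arrow,
  -- with fibre coordinate fixed, until its source is the target of the second.
  let f : G × G → G × G := fun z => (ψ (e z), z.2)
  have hf : ContMDiffAt ((𝓡 n).prod (𝓡 n)) ((𝓡 n).prod (𝓡 n)) ∞ f (g, h) := by
    refine ContMDiffAt.prodMk (ContMDiffAt.comp (g, h) (g := ψ) ?_ he) contMDiffAt_snd
    rw [heg]; exact hψ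
  have hfg : f (g, h) = (g, h) := by
    simp only [f, heg, h2.self_of_nhds]
  have hS : {z | Γ.src (f z).1 = Γ.tgt (f z).2} ∈ 𝓝 (g, h) := by
    have := he.continuousAt.eventually (p := fun y => Γ.src (ψ y) = y.1) (by rw [heg]; exact h1)
    exact this
  refine ⟨fun z => Γ.mul (f z).1 (f z).2, ?_, ?_⟩
  · have hm := Γ.contMDiffOn_mul (f (g, h)) (by rw [hfg]; exact hgh)
    exact (hm.comp (g, h) hf.contMDiffWithinAt (by intro z hz; exact hz)).contMDiffAt hS
  · have : ∀ᶠ z in 𝓝 (g, h), ψ (Γ.src z.1, p z.1) = z.1 :=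
      (continuous_fst.tendsto (g, h)).eventually h2
    filter_upwards [this] with z hz hc
    simp only [f, e]
    rw [← hc, hz]

/-- On tangent vectors to `G₂` near a given point, `dmul` agrees with the honest derivative of a
local smooth extension `μ`, as is seen on composable curves. The tangent map of `μ` is smooth. -/
theorem contMDiffOn_tangentMul :
    ContMDiffOn ((𝓡 n).tangent.prod (𝓡 n).tangent) (𝓡 n).tangent ∞ Γ.tangentMul
      {q | Γ.src q.1.1 = Γ.tgt q.2.1 ∧ Γ.tsrc q.1.1 q.1.2 = Γ.ttgt q.2.1 q.2.2} := by
  have : IsManifold (𝓡 n) 1 G := .of_le (n := ∞) (by simp)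
  rintro q₀ hq₀
  obtain ⟨μ, hμ, e⟩ := exists_mul_extension hq₀.1
  have h1 : ContMDiffAt ((𝓡 n).tangent.prod (𝓡 n).tangent) (𝓡 n).tangent ∞
      (fun q => tangentMap ((𝓡 n).prod (𝓡 n)) (𝓡 n) μ
        ((equivTangentBundleProd (𝓡 n) G (𝓡 n) G).symm q)) q₀ := by
    refine ContMDiffAt.comp q₀ (contMDiffAt_tangentMap hμ) ?_
    exact contMDiff_equivTangentBundleProd_symm.contMDiffAt
  refine h1.contMDiffWithinAt.congr_of_eventuallyEq_of_mem ?_ hq₀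
  -- The comparison takes place at all nearby pairs, so `μ` must be differentiable and agree with
  -- the product near each of them. Finite regularity at a point, here order `1`, spreads to a
  -- neighbourhood.
  have h2 : ∀ᶠ z in 𝓝 (q₀.1.1, q₀.2.1),
      MDifferentiableAt ((𝓡 n).prod (𝓡 n)) (𝓡 n) μ z ∧
      ∀ᶠ w in 𝓝 z, Γ.src w.1 = Γ.tgt w.2 → μ w = Γ.mul w.1 w.2 := by
    refine Filter.Eventually.and ?_ e.eventually_nhds
    have h3 : ContMDiffAt ((𝓡 n).prod (𝓡 n)) (𝓡 n) 1 μ (q₀.1.1, q₀.2.1) := hμ.of_le (by simp)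
    filter_upwards [(contMDiffAt_iff_contMDiffAt_nhds (by simp)).1 h3] with z hz
    exact hz.mdifferentiableAt (by simp)
  have hproj : Tendsto (fun q : TangentBundle (𝓡 n) G × TangentBundle (𝓡 n) G => (q.1.1, q.2.1))
      (𝓝 q₀) (𝓝 (q₀.1.1, q₀.2.1)) := by
    have : Continuous (TotalSpace.proj : TangentBundle (𝓡 n) G → G) :=
      FiberBundle.continuous_proj (EE n) (TangentSpace (𝓡 n))
    exact ((this.comp continuous_fst).prodMk (this.comp continuous_snd)).tendsto q₀
  filter_upwards [nhdsWithin_le_nhds (hproj.eventually h2), self_mem_nhdsWithin] with q hq hS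
  obtain ⟨⟨g, X⟩, ⟨h, Y⟩⟩ := q
  obtain ⟨η, hη⟩ := exists_hasVelocity h Y
  obtain ⟨γ, hγ, e'⟩ := exists_hasVelocity_composable hη hS.1 hS.2
  have hv := hγ.mul hη e'
  refine tangentBundle_mk_eq (hq.2.self_of_nhds hS.1).symm ?_
  have hc : HasVelocity (fun τ => μ (γ τ, η τ)) (μ (g, h))
      (mfderiv ((𝓡 n).prod (𝓡 n)) (𝓡 n) μ (g, h) (X, Y) : EE n) := by
    have hd := hq.1
    obtain ⟨rfl, hγ'⟩ := hγ
    obtain ⟨rfl, hη'⟩ := hη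
    refine ⟨rfl, (hd.hasMFDerivAt.comp (0 : ℝ) (hγ'.prodMk hη')).congr_mfderiv ?_⟩
    refine ContinuousLinearMap.ext fun τ => ?_
    exact ((mfderiv ((𝓡 n).prod (𝓡 n)) (𝓡 n) μ (γ 0, η 0)).map_smul τ (X, Y))
  refine HasVelocity.unique (hv.congr ?_) hc
  have := (hγ.continuousAt.prodMk_nhds hη.continuousAt).eventually hq.2
  filter_upwards [this, e'] with τ h1 h2
  exact h1 h2

/-- The inclusion of `A` in `TG`. -/
def algIncl (a : Γ.algVB.Tot) : TangentBundle (𝓡 n) G := ⟨Γ.unit a.1, Γ.incl a.1 a.2⟩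

/-- The fibre coordinate of the trivialisation of `A` at `x₀`. -/
def algCoord (x₀ : M) (a : Γ.algVB.Tot) : EE (n - m) :=
  (trivializationAt Γ.algVB.F Γ.algVB.Fib x₀ a).2

-- The first clause makes the inclusion of `A` in `TG` smooth; the second lets smoothness into `A`
-- be tested in `TG`.
variable {Γ} in
theorem trivG_algIncl {x₀ : M} {a : Γ.algVB.Tot} (ha : a.1 ∈ Γ.dom x₀) :
    (Γ.trivG x₀ (Γ.algIncl a)).2 = (Γ.full x₀ a.1).inverse (0, Γ.algCoord x₀ a) ∧
    Γ.algCoord x₀ a = Γ.proj x₀ (Γ.trivG x₀ (Γ.algIncl a)).2 := by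
  obtain ⟨x, a⟩ := a
  have h1 : Γ.algCoord x₀ ⟨x, a⟩ = Γ.fiberEquiv x₀ x ha a := Γ.pretriv_apply ha a
  rw [h1]
  refine ⟨?_, rfl⟩
  have h2 := congrArg Subtype.val ((Γ.fiberEquiv x₀ x ha).symm_apply_apply a)
  have h3 : (Γ.trivG x₀ (Γ.algIncl ⟨x, a⟩)).2 =
    (Γ.trivG x₀).continuousLinearEquivAt ℝ _ ha.1.1 a.1 := rfl
  rw [h3, ← h2]
  exact ContinuousLinearEquiv.apply_symm_apply _ _

theorem contMDiff_algIncl : ContMDiff Γ.algVB.J (𝓡 n).tangent ∞ Γ.algIncl :=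
  contMDiff_of_fibre_coord Γ.algVB Γ.algIncl Γ.contMDiff_unit (fun _ => rfl)
    (fun x₀ x => (Γ.full x₀ x).inverse.comp (ContinuousLinearMap.inr ℝ (EE m) (EE (n - m))))
    Γ.isOpen_dom Γ.mem_dom
    (fun x₀ => (Γ.contMDiffAt_inverse (Γ.mem_dom x₀)).clm_comp contMDiffAt_const)
    (fun _ _ ha => (trivG_algIncl ha).1)

section
variable {Γ}
variable {E' H' N : Type*} [NormedAddCommGroup E'] [NormedSpace ℝ E'] [TopologicalSpace H']
    {I' : ModelWithCorners ℝ E' H'} [TopologicalSpace N] [ChartedSpace H' N] {S : Set N}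

/-- A map to `A` is smooth if it is smooth as a map to `TG`. -/
theorem contMDiffOn_of_algIncl {f : N → Γ.algVB.Tot}
    (hf : ContMDiffOn I' (𝓡 n).tangent ∞ (fun q => Γ.algIncl (f q)) S) :
    ContMDiffOn I' Γ.algVB.J ∞ f S :=
  contMDiffOn_of_comp_fibre_coord Γ.algVB Γ.algIncl Γ.unit Γ.contMDiff_src
    (fun x => Γ.src_unit x) (fun _ => rfl) Γ.proj Γ.isOpen_dom Γ.mem_dom
    (fun _ _ ha => (trivG_algIncl ha).2) hf

theorem contMDiffOn_incl {x : N → M} {a : ∀ q, Γ.Alg (x q)}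
    (h : ContMDiffOn I' Γ.algVB.J ∞ (fun q => (⟨x q, a q⟩ : Γ.algVB.Tot)) S) :
    ContMDiffOn I' (𝓡 n).tangent ∞
      (fun q => (⟨Γ.unit (x q), Γ.incl (x q) (a q)⟩ : TangentBundle (𝓡 n) G)) S :=
  Γ.contMDiff_algIncl.comp_contMDiffOn h

theorem contMDiffOn_tangentZero {b : N → G} (hb : ContMDiffOn I' (𝓡 n) ∞ b S) :
    ContMDiffOn I' (𝓡 n).tangent ∞ (fun q => (⟨b q, (0 : EE n)⟩ : TangentBundle (𝓡 n) G)) S :=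
  (contMDiff_zeroSection ℝ (TangentSpace (𝓡 n) : G → Type _) (n := ∞)
    (IB := 𝓡 n)).comp_contMDiffOn hb

theorem contMDiffOn_tangentSub {b : N → G} {v w : N → EE n}
    (hv : ContMDiffOn I' (𝓡 n).tangent ∞ (fun q => (⟨b q, v q⟩ : TangentBundle (𝓡 n) G)) S)
    (hw : ContMDiffOn I' (𝓡 n).tangent ∞ (fun q => (⟨b q, w q⟩ : TangentBundle (𝓡 n) G)) S) :
    ContMDiffOn I' (𝓡 n).tangent ∞ (fun q => (⟨b q, v q - w q⟩ : TangentBundle (𝓡 n) G)) S := by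
  obtain ⟨Φ, hΦ, e⟩ := contMDiffOn_add_smul (tangentVB n G) hv hw (-1) (fun _ _ => rfl)
  refine ContMDiffOn.congr hΦ fun q hq => ?_
  rw [e q hq (b q) (v q) (w q) rfl rfl]
  refine tangentBundle_mk_eq rfl ?_
  have : v q - w q = v q + (-1 : ℝ) • w q := by rw [neg_one_smul, sub_eq_add_neg]
  exact this

theorem contMDiffOn_ttgt {b : N → G} {v : N → EE n}
    (hv : ContMDiffOn I' (𝓡 n).tangent ∞ (fun q => (⟨b q, v q⟩ : TangentBundle (𝓡 n) G)) S) :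
    ContMDiffOn I' (𝓡 m).tangent ∞
      (fun q => (⟨Γ.tgt (b q), Γ.ttgt (b q) (v q)⟩ : TangentBundle (𝓡 m) M)) S :=
  (Γ.contMDiff_tgt.contMDiff_tangentMap (m := ∞) (by simp)).comp_contMDiffOn hv

theorem contMDiffOn_tinv {b : N → G} {v : N → EE n}
    (hv : ContMDiffOn I' (𝓡 n).tangent ∞ (fun q => (⟨b q, v q⟩ : TangentBundle (𝓡 n) G)) S) :
    ContMDiffOn I' (𝓡 n).tangent ∞
      (fun q => (⟨Γ.inv (b q), Γ.tinv (b q) (v q)⟩ : TangentBundle (𝓡 n) G)) S :=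
  (Γ.contMDiff_inv.contMDiff_tangentMap (m := ∞) (by simp)).comp_contMDiffOn hv

theorem contMDiffOn_tmul {b b' : N → G} {v v' : N → EE n}
    (hv : ContMDiffOn I' (𝓡 n).tangent ∞ (fun q => (⟨b q, v q⟩ : TangentBundle (𝓡 n) G)) S)
    (hv' : ContMDiffOn I' (𝓡 n).tangent ∞ (fun q => (⟨b' q, v' q⟩ : TangentBundle (𝓡 n) G)) S)
    (hb : ∀ q ∈ S, Γ.src (b q) = Γ.tgt (b' q))
    (hc : ∀ q ∈ S, Γ.tsrc (b q) (v q) = Γ.ttgt (b' q) (v' q)) :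
    ContMDiffOn I' (𝓡 n).tangent ∞ (fun q =>
      (⟨Γ.mul (b q) (b' q), Γ.tmul (b q) (b' q) (v q, v' q)⟩ : TangentBundle (𝓡 n) G)) S :=
  ContMDiffOn.comp (g := Γ.tangentMul) Γ.contMDiffOn_tangentMul (hv.prodMk hv')
    (fun q hq => ⟨hb q hq, hc q hq⟩)

theorem contMDiffOn_split (c : Γ.Connection) {b : N → G} {x : N → M} {v : N → EE m}
    (hb : ContMDiffOn I' (𝓡 n) ∞ b S)
    (hv : ContMDiffOn I' (𝓡 m).tangent ∞ (fun q => (⟨x q, v q⟩ : TangentBundle (𝓡 m) M)) S)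
    (hx : ∀ q ∈ S, Γ.src (b q) = x q) :
    ContMDiffOn I' (𝓡 n).tangent ∞ (fun q =>
      (⟨b q, c.split (b q) (v q)⟩ : TangentBundle (𝓡 n) G)) S := by
  obtain ⟨Φ, hΦ, e⟩ := c.smooth
  refine (ContMDiffOn.comp hΦ (hb.prodMk hv) (fun q hq => hx q hq)).congr fun q hq => ?_
  refine (e (b q) (v q)).symm.trans ?_
  rw [hx q hq]; rfl

/-- If right translation by `b` maps `a` to a smooth vector field along `b`, then `a` is smooth. -/
theorem contMDiffOn_of_rtr {b : N → G} {a : ∀ q, Γ.Alg (Γ.tgt (b q))} {v : N → EE n}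
    (hv : ContMDiffOn I' (𝓡 n).tangent ∞ (fun q => (⟨b q, v q⟩ : TangentBundle (𝓡 n) G)) S)
    (hb : ContMDiffOn I' (𝓡 n) ∞ b S) (ha : ∀ q ∈ S, Γ.rtr (b q) _ (a q) = v q) :
    ContMDiffOn I' Γ.algVB.J ∞ (fun q => (⟨Γ.tgt (b q), a q⟩ : Γ.algVB.Tot)) S := by
  refine contMDiffOn_of_algIncl ?_
  refine (contMDiffOn_tmul (Γ := Γ) hv
    (contMDiffOn_tangentZero (Γ.contMDiff_inv.comp_contMDiffOn hb)) ?_ ?_).congr ?_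
  · exact fun q _ => (Γ.tgt_inv _).symm
  · intro q hq
    rw [← ha q hq, tsrc_rtr rfl, map_zero]
  · intro q hq
    refine tangentBundle_mk_eq (Γ.mul_inv _).symm ?_
    rw [← ha q hq]
    exact incl_eq_tmul_inv rfl _

end

end LieGroupoid

/-! ### Structure equations and unitality of the adjoint sequence. -/

namespace LieGroupoid
variable {Γ : LieGroupoid m n M G}

namespace Connection
variable (c : Γ.Connection)

theorem adOps_eq_zero (s : Γ.Str) (l l' : ℤ)
    (h : ¬((s.len = 0 ∧ l = 0 ∧ l' = 1) ∨ (s.len = 1 ∧ l = 0 ∧ l' = 0) ∨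
      (s.len = 1 ∧ l = 1 ∧ l' = 1) ∨ (s.len = 2 ∧ l = 1 ∧ l' = 0))) :
    c.adOps s l l' = 0 := by
  obtain ⟨_ | ⟨g, _ | ⟨k, _ | ⟨k', p⟩⟩⟩, y, x, hs⟩ := s
  -- Integers are split into `0`, `1`, at least `2`, and negative, which is what the pattern match
  -- in `adOps` distinguishes.
  · rcases l with (_ | _ | l) | l <;> rcases l' with (_ | _ | l') | l' <;>
      first | (exfalso; apply h; simp [Str.len]; done) | rfl
  · rcases l with (_ | _ | l) | l <;> rcases l' with (_ | _ | l') | l' <;>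
      first | (exfalso; apply h; simp [Str.len]; done) | rfl
  · rcases l with (_ | _ | l) | l <;> rcases l' with (_ | _ | l') | l' <;>
      first | (exfalso; apply h; simp [Str.len]; done) | rfl
  · rfl

theorem adOps_degree (s : Γ.Str) (l l' : ℤ) (h : l' ≠ l + 1 - (s.len : ℤ)) :
    c.adOps s l l' = 0 := c.adOps_eq_zero s l l' (by omega)

theorem _root_.LieGpd.LieGroupoid.length_contract (p : List G) (i : ℕ) (h : i < p.length - 1) :
    (Γ.contract i p).length = p.length - 1 := by
  induction p generalizing i with
  | nil => simp at h
  | cons g p ih =>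
    cases i with
    | zero =>
      cases p with
      | nil => simp at h
      | cons k p => rfl
    | succ i =>
      simp only [List.length_cons, Nat.add_sub_cancel] at h
      have := ih i (by omega)
      simp only [contract, List.length_cons, this]
      omega

/-- With `k` arrows both sides map `E^l` to `E^{l+2-k}`. For both degrees to be `0` or `1`, either
`l = 0` and `k` is `1` or `2`, or `l = 1` and `k` is `2` or `3`. -/
theorem structureEquations_adOps_of_degree (s : Γ.Str) (l : ℤ)
    (h : ¬((s.len = 1 ∧ l = 0) ∨ (s.len = 2 ∧ l = 0) ∨ (s.len = 2 ∧ l = 1) ∨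
      (s.len = 3 ∧ l = 1))) :
    ∑ i ∈ Finset.range (s.len - 1), (-1 : ℝ) ^ (i + 1) •
        c.adOps (s.contract i) l (l + 2 - s.len) =
    ∑ j ∈ Finset.range (s.len + 1), (-1 : ℝ) ^ j •
        (c.adOps (s.take j) (l + 1 - (s.len - j)) (l + 2 - s.len) ∘ₗ
          c.adOps (s.drop j) l (l + 1 - (s.len - j)) :
            (Γ.adj.deg l).Fib s.right →ₗ[ℝ] (Γ.adj.deg (l + 2 - s.len)).Fib s.left) := by
  refine (Finset.sum_eq_zero fun i hi => ?_).trans (Finset.sum_eq_zero fun j hj => ?_).symm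
  · have h1 : (s.contract i).len = s.len - 1 := length_contract _ _ (Finset.mem_range.1 hi)
    have h0 := Finset.mem_range.1 hi
    rw [c.adOps_eq_zero (s.contract i) _ _ (by rw [h1]; omega), smul_zero]
  · have h0 := Finset.mem_range.1 hj
    have h1 : (s.take j).len = j :=
      List.length_take.trans (min_eq_left (Nat.lt_succ_iff.1 h0))
    have h2 : (s.drop j).len = s.len - j := by simp only [Str.len, List.length_drop]
    by_cases hd : ((s.drop j).len = 0 ∧ l = 0) ∨ ((s.drop j).len = 1 ∧ l = 0) ∨
      ((s.drop j).len = 1 ∧ l = 1) ∨ ((s.drop j).len = 2 ∧ l = 1)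
    · rw [h2] at hd
      rw [c.adOps_eq_zero (s.take j) _ _ (by
        simp only [Str.len] at h1 hd h h0 ⊢
        rw [h1]; omega), LinearMap.zero_comp, smul_zero]
    · rw [c.adOps_eq_zero (s.drop j) _ _ (by
        rintro (h | h | h | h) <;> exact hd (by simp [h])), LinearMap.comp_zero, smul_zero]

theorem _root_.LieGpd.sum_range_two {V : Type*} [AddCommMonoid V] (f : ℕ → V) :
    ∑ i ∈ Finset.range 2, f i = f 0 + f 1 := by
  rw [Finset.sum_range_succ, Finset.sum_range_one]

theorem _root_.LieGpd.sum_range_three {V : Type*} [AddCommMonoid V] (f : ℕ → V) :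
    ∑ i ∈ Finset.range 3, f i = f 0 + f 1 + f 2 := by
  rw [Finset.sum_range_succ, sum_range_two]

theorem _root_.LieGpd.sum_range_four {V : Type*} [AddCommMonoid V] (f : ℕ → V) :
    ∑ i ∈ Finset.range 4, f i = f 0 + f 1 + f 2 + f 3 := by
  rw [Finset.sum_range_succ, sum_range_three]

/-- The four remaining cases are `anc_lamA`, `lamA_lamA`, `act_act` and `Kbas_cocycle`, up to sign
and with the zero components written out. -/
theorem structureEquations_adOps : StructureEquations c.adOps := by
  intro s l
  by_cases h : (s.len = 1 ∧ l = 0) ∨ (s.len = 2 ∧ l = 0) ∨ (s.len = 2 ∧ l = 1) ∨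
      (s.len = 3 ∧ l = 1)
  swap
  · exact c.structureEquations_adOps_of_degree s l h
  obtain ⟨_ | ⟨g, _ | ⟨k, _ | ⟨k', _ | ⟨k'', p⟩⟩⟩⟩, y, x, hs⟩ := s
  · simp at h
  · obtain rfl : l = 0 := by simpa [Str.len] using h
    obtain ⟨rfl, rfl⟩ := hs
    refine (Finset.sum_range_zero _).trans (Eq.trans ?_ (sum_range_two _).symm)
    refine LinearMap.ext fun (α : Γ.Alg (Γ.src g)) => ?_
    change (0 : EE m) = (-1 : ℝ) ^ 0 • Γ.anc (Γ.tgt g) (c.lamA g (Γ.tgt g) (Γ.src g) α) +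
      (-1 : ℝ) ^ 1 • c.act g (Γ.anc (Γ.src g) α)
    rw [c.anc_lamA rfl rfl]
    simp
  · obtain rfl | rfl : l = 0 ∨ l = 1 := by simpa [Str.len] using h
    · obtain ⟨rfl, hgk, rfl⟩ := hs
      refine (Finset.sum_range_one _).trans (Eq.trans ?_ (sum_range_three _).symm)
      refine LinearMap.ext fun (α : Γ.Alg (Γ.src k)) => ?_
      change (-1 : ℝ) ^ 1 • c.lamA (Γ.mul g k) (Γ.tgt g) (Γ.src k) α =
        (-1 : ℝ) ^ 0 • (0 : Γ.Alg (Γ.tgt g)) +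
        (-1 : ℝ) ^ 1 • c.lamA g (Γ.tgt g) (Γ.tgt k) (c.lamA k (Γ.tgt k) (Γ.src k) α) +
        (-1 : ℝ) ^ 2 • c.Kbas g k (Γ.tgt g) (Γ.tgt k) (Γ.src k) (Γ.anc (Γ.src k) α)
      rw [← c.lamA_lamA rfl hgk.symm rfl rfl]
      module
    · obtain ⟨rfl, hgk, rfl⟩ := hs
      refine (Finset.sum_range_one _).trans (Eq.trans ?_ (sum_range_three _).symm)
      refine LinearMap.ext fun (X : EE m) => ?_
      change (-1 : ℝ) ^ 1 • c.act (Γ.mul g k) X =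
        (-1 : ℝ) ^ 0 • Γ.anc (Γ.tgt g) (c.Kbas g k (Γ.tgt g) (Γ.tgt k) (Γ.src k) X) +
        (-1 : ℝ) ^ 1 • c.act g (c.act k X) + (-1 : ℝ) ^ 2 • (0 : EE m)
      rw [← c.act_act rfl hgk.symm rfl]
      module
  · obtain rfl : l = 1 := by simpa [Str.len] using h
    obtain ⟨rfl, hgk, hkk, rfl⟩ := hs
    refine (sum_range_two _).trans (Eq.trans ?_ (sum_range_four _).symm)
    refine LinearMap.ext fun (X : EE m) => ?_
    change (-1 : ℝ) ^ 1 • c.Kbas (Γ.mul g k) k' (Γ.tgt g) (Γ.tgt k') (Γ.src k') X +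
        (-1 : ℝ) ^ 2 • c.Kbas g (Γ.mul k k') (Γ.tgt g) (Γ.tgt (Γ.mul k k')) (Γ.src k') X =
      (-1 : ℝ) ^ 0 • (0 : Γ.Alg (Γ.tgt g)) +
      (-1 : ℝ) ^ 1 • c.lamA g (Γ.tgt g) (Γ.tgt k)
        (c.Kbas k k' (Γ.tgt k) (Γ.tgt k') (Γ.src k') X) +
      (-1 : ℝ) ^ 2 • c.Kbas g k (Γ.tgt g) (Γ.tgt k) (Γ.tgt k') (c.act k' X) +
      (-1 : ℝ) ^ 3 • (0 : Γ.Alg (Γ.tgt g))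
    have key := c.Kbas_cocycle (w := Γ.src k') (x := Γ.tgt k') rfl hgk.symm rfl hkk.symm rfl X
    -- `adOps` records the target of the second arrow as the middle vertex of `K`; for the product
    -- of `k` and `k'` this is the target of `k`.
    rw [Γ.tgt_mul k k' hkk.symm]
    rw [← sub_eq_zero]
    refine Eq.trans ?_ key
    module
  · exfalso
    simp [Str.len] at h

theorem isUnital_adOps : IsUnital c.adOps where
  weakly u h l := by
    rcases l with (_ | _ | l) | l
    · exact LinearMap.ext fun (α : Γ.Alg u) => c.lamA_unit u α
    · exact LinearMap.ext fun (X : EE m) => c.act_unit u X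
    · exact LinearMap.ext fun v => Subsingleton.elim (α := EE 0) _ _
    · exact LinearMap.ext fun v => Subsingleton.elim (α := EE 0) _ _
  higher s hlen hu l l' := by
    by_cases h : s.len = 2 ∧ l = 1 ∧ l' = 0
    swap
    · exact c.adOps_eq_zero s l l' (by omega)
    obtain ⟨h2, rfl, rfl⟩ := h
    obtain ⟨u, hu⟩ := hu
    obtain ⟨_ | ⟨g, _ | ⟨k, _ | ⟨k', p⟩⟩⟩, y, x, hs⟩ := s
    · simp [Str.len] at h2
    · simp [Str.len] at h2
    · obtain ⟨rfl, hgk, rfl⟩ := hs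
      refine LinearMap.ext fun (X : EE m) => ?_
      change c.Kbas g k (Γ.tgt g) (Γ.tgt k) (Γ.src k) X = 0
      simp only [List.mem_cons, List.not_mem_nil, or_false] at hu
      obtain rfl | rfl := hu
      · rw [Γ.tgt_unit]
        have : u = Γ.tgt k := by rw [hgk, Γ.src_unit]
        subst this
        exact c.Kbas_unit_left rfl X
      · rw [Γ.tgt_unit] at hgk ⊢
        subst hgk
        exact c.Kbas_unit_right rfl X
    · simp [Str.len] at h2

end Connection

/-! ### Smoothness of the anchor, the quasi-actions and the basic curvature. -/

theorem contMDiff_vertex (k : ℕ) : ContMDiff (stringModel m n k) (𝓡 m) ∞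
    (fun q : (Fin k → G) × M => Γ.vertex (List.ofFn q.1) q.2) := by
  cases k with
  | zero => simpa [vertex] using contMDiff_snd
  | succ k =>
    have := Γ.contMDiff_tgt.comp ((contMDiff_arrow (G := G) (n := n) (0 : Fin (k + 1))).comp
      (contMDiff_fst (J := 𝓡 m) (N := M)))
    simpa [vertex, Function.comp_def] using this

theorem smoothHom_of_eq_zero (V W : SmoothVB m M) (k : ℕ)
    (T : ∀ s : Γ.Str, V.Fib s.right →ₗ[ℝ] W.Fib s.left) (hT : ∀ s, s.len = k → T s = 0) :
    Γ.SmoothHom V W k T := by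
  refine ⟨fun q => ⟨Γ.vertex (List.ofFn q.1) q.2.1, 0⟩, ?_, fun q y x h v => ?_⟩
  · refine (contMDiff_zeroSection ℝ W.Fib (n := ∞) (IB := 𝓡 m)).comp_contMDiffOn ?_
    have h1 : ContMDiff ((ModelWithCorners.pi (fun _ : Fin k => 𝓡 n)).prod V.J)
        (stringModel m n k) ∞ (fun q : (Fin k → G) × V.Tot => (q.1, q.2.1)) :=
      contMDiff_fst.prodMk ((contMDiff_proj V.Fib).comp contMDiff_snd)
    exact ((contMDiff_vertex k).comp h1).contMDiffOn
  · rw [hT ⟨_, y, x, h⟩ (List.length_ofFn)]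
    obtain rfl := h.eq_vertex
    rfl

section
variable {E' H' N : Type*} [NormedAddCommGroup E'] [NormedSpace ℝ E'] [TopologicalSpace H']
    {I' : ModelWithCorners ℝ E' H'} [TopologicalSpace N] [ChartedSpace H' N] {S : Set N}

theorem contMDiffOn_ltr {b : N → G} {x : N → M} {a : ∀ q, Γ.Alg (x q)}
    (hb : ContMDiffOn I' (𝓡 n) ∞ b S)
    (ha : ContMDiffOn I' Γ.algVB.J ∞ (fun q => (⟨x q, a q⟩ : Γ.algVB.Tot)) S)
    (hx : ∀ q ∈ S, Γ.src (b q) = x q) :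
    ContMDiffOn I' (𝓡 n).tangent ∞
      (fun q => (⟨b q, Γ.ltr (b q) (x q) (a q)⟩ : TangentBundle (𝓡 n) G)) S := by
  have h1 := contMDiffOn_tinv (Γ := Γ) (contMDiffOn_incl ha)
  refine (contMDiffOn_tmul (Γ := Γ) (contMDiffOn_tangentZero hb) h1 ?_ ?_).congr ?_
  · intro q hq
    rw [Γ.inv_unit, Γ.tgt_unit, hx q hq]
  · intro q hq
    rw [Γ.inv_unit, (Γ.tinv_incl _ _).2.1, map_zero]
  · intro q hq
    refine tangentBundle_mk_eq ?_ ?_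
    · rw [Γ.inv_unit, ← hx q hq, Γ.mul_unit]
    · rw [Γ.inv_unit, ltr_apply]

end

namespace Connection
variable (c : Γ.Connection)

theorem smoothHom_anchor : Γ.SmoothHom Γ.algVB (tangentVB m M) 0 (fun s => c.adOps s 0 1) := by
  refine ⟨fun q => ⟨Γ.tgt (Γ.unit q.2.1), Γ.anc q.2.1 q.2.2⟩, ?_, fun q y x h v => ?_⟩
  · exact contMDiffOn_ttgt (Γ := Γ) (contMDiffOn_incl (x := fun q : (Fin 0 → G) × Γ.algVB.Tot => q.2.1) (a := fun q : (Fin 0 → G) × Γ.algVB.Tot => q.2.2)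
      contMDiffOn_snd)
  · revert h
    rw [List.ofFn_zero]
    rintro rfl
    exact tangentBundle_mk_eq (I₁ := 𝓡 m) (Γ.tgt_unit y) rfl

theorem smoothHom_act :
    Γ.SmoothHom (tangentVB m M) (tangentVB m M) 1 (fun s => c.adOps s 1 1) := by
  refine ⟨fun q => ⟨Γ.tgt (q.1 0), c.act (q.1 0) q.2.2⟩, ?_, fun q y x h v => ?_⟩
  · have hX : ContMDiffOn ((ModelWithCorners.pi (fun _ : Fin 1 => 𝓡 n)).prod (tangentVB m M).J)
        (𝓡 m).tangent ∞ (fun q : (Fin 1 → G) × (tangentVB m M).Tot =>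
          (⟨q.2.1, q.2.2⟩ : TangentBundle (𝓡 m) M))
        {q | ∃ y, Γ.IsString (List.ofFn q.1) y q.2.1} :=
      contMDiffOn_snd (N := (tangentVB m M).Tot) (J := (tangentVB m M).J)
    refine contMDiffOn_ttgt (Γ := Γ) (contMDiffOn_split c
      (b := fun q : (Fin 1 → G) × (tangentVB m M).Tot => q.1 0) ?_ hX ?_)
    · exact ((contMDiff_arrow 0).comp contMDiff_fst).contMDiffOn
    · rintro q ⟨y, hy⟩
      rw [List.ofFn_succ, List.ofFn_zero] at hy
      exact hy.2
  · revert h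
    rw [List.ofFn_succ, List.ofFn_zero]
    rintro ⟨rfl, rfl⟩
    rfl

theorem smoothHom_lamA : Γ.SmoothHom Γ.algVB Γ.algVB 1 (fun s => c.adOps s 0 0) := by
  refine ⟨fun q => ⟨Γ.tgt (q.1 0), c.lamA (q.1 0) (Γ.tgt (q.1 0)) q.2.1 q.2.2⟩, ?_,
    fun q y x h v => ?_⟩
  · have hs : ∀ q ∈ {q : (Fin 1 → G) × Γ.algVB.Tot | ∃ y, Γ.IsString (List.ofFn q.1) y q.2.1},
        Γ.src (q.1 0) = q.2.1 := by
      rintro q ⟨y, hy⟩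
      rw [List.ofFn_succ, List.ofFn_zero] at hy
      exact hy.2
    have hb : ContMDiffOn ((ModelWithCorners.pi (fun _ : Fin 1 => 𝓡 n)).prod Γ.algVB.J) (𝓡 n) ∞
        (fun q : (Fin 1 → G) × Γ.algVB.Tot => q.1 0)
        {q | ∃ y, Γ.IsString (List.ofFn q.1) y q.2.1} :=
      ((contMDiff_arrow 0).comp contMDiff_fst).contMDiffOn
    have h1 := contMDiffOn_ttgt (Γ := Γ) (contMDiffOn_incl (x := fun q : (Fin 1 → G) × Γ.algVB.Tot => q.2.1)
      (a := fun q : (Fin 1 → G) × Γ.algVB.Tot => q.2.2) (contMDiffOn_snd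
        (I := ModelWithCorners.pi (fun _ : Fin 1 => 𝓡 n)) (M := Fin 1 → G)
        (s := {q | ∃ y, Γ.IsString (List.ofFn q.1) y q.2.1})))
    have h2 : ContMDiffOn ((ModelWithCorners.pi (fun _ : Fin 1 => 𝓡 n)).prod Γ.algVB.J)
        (𝓡 n).tangent ∞ (fun q : (Fin 1 → G) × Γ.algVB.Tot =>
          (⟨q.1 0, Γ.ltr (q.1 0) q.2.1 q.2.2⟩ : TangentBundle (𝓡 n) G))
        {q | ∃ y, Γ.IsString (List.ofFn q.1) y q.2.1} :=
      contMDiffOn_ltr (Γ := Γ) hb contMDiffOn_snd hs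
    have h3 := contMDiffOn_split c hb h1 (fun q hq => by rw [Γ.tgt_unit]; exact hs q hq)
    refine contMDiffOn_of_rtr (Γ := Γ) (contMDiffOn_tangentSub h3 h2) hb ?_
    · intro q hq
      exact c.rtr_lamA rfl (hs q hq) _
  · revert h
    rw [List.ofFn_succ, List.ofFn_zero]
    rintro ⟨rfl, rfl⟩
    rfl

theorem smoothHom_Kbas : Γ.SmoothHom (tangentVB m M) Γ.algVB 2 (fun s => c.adOps s 1 0) := by
  -- The base point is written as the target of the product, not of the first arrow, to fit
  -- `contMDiffOn_of_rtr` for right translation by the product.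
  refine ⟨fun q => ⟨Γ.tgt (Γ.mul (q.1 0) (q.1 1)), c.Kbas (q.1 0) (q.1 1)
    (Γ.tgt (Γ.mul (q.1 0) (q.1 1))) (Γ.tgt (q.1 1)) q.2.1 q.2.2⟩, ?_, fun q y x h v => ?_⟩
  · have hs : ∀ q ∈ {q : (Fin 2 → G) × (tangentVB m M).Tot |
        ∃ y, Γ.IsString (List.ofFn q.1) y q.2.1},
        Γ.src (q.1 0) = Γ.tgt (q.1 1) ∧ Γ.src (q.1 1) = q.2.1 := by
      rintro q ⟨y, hy⟩
      rw [List.ofFn_succ, List.ofFn_succ, List.ofFn_zero] at hy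
      exact ⟨hy.2.1.symm, hy.2.2⟩
    have hb : ∀ i, ContMDiffOn ((ModelWithCorners.pi (fun _ : Fin 2 => 𝓡 n)).prod
        (tangentVB m M).J) (𝓡 n) ∞ (fun q : (Fin 2 → G) × (tangentVB m M).Tot => q.1 i)
        {q | ∃ y, Γ.IsString (List.ofFn q.1) y q.2.1} :=
      fun i => ((contMDiff_arrow i).comp contMDiff_fst).contMDiffOn
    have hm := Γ.contMDiffOn_mul.comp ((hb 0).prodMk (hb 1)) (fun q hq => (hs q hq).1)
    have hX : ContMDiffOn ((ModelWithCorners.pi (fun _ : Fin 2 => 𝓡 n)).prod (tangentVB m M).J)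
        (𝓡 m).tangent ∞ (fun q : (Fin 2 → G) × (tangentVB m M).Tot =>
          (⟨q.2.1, q.2.2⟩ : TangentBundle (𝓡 m) M))
        {q | ∃ y, Γ.IsString (List.ofFn q.1) y q.2.1} :=
      contMDiffOn_snd (N := (tangentVB m M).Tot) (J := (tangentVB m M).J)
    have h1 := contMDiffOn_split c (hb 1) hX (fun q hq => (hs q hq).2)
    have h2 := contMDiffOn_split c (hb 0) (contMDiffOn_ttgt (Γ := Γ) h1)
      (fun q hq => (hs q hq).1)
    have h3 := contMDiffOn_tmul (Γ := Γ) h2 h1 (fun q hq => (hs q hq).1)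
      (fun q hq => c.tsrc_split _ _)
    have h4 := contMDiffOn_split c hm hX
      (fun q hq => (Γ.src_mul _ _ (hs q hq).1).trans (hs q hq).2)
    refine contMDiffOn_of_rtr (Γ := Γ) (b := fun q : (Fin 2 → G) × (tangentVB m M).Tot => Γ.mul (q.1 0) (q.1 1))
      (contMDiffOn_tangentSub h3 h4) hm ?_
    intro q hq
    exact c.rtr_Kbas (Γ.tgt_mul _ _ (hs q hq).1).symm (hs q hq).1 rfl _
  · revert h
    rw [List.ofFn_succ, List.ofFn_succ, List.ofFn_zero]
    rintro ⟨hy, hgh, hx⟩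
    have e : Γ.tgt (Γ.mul (q 0) (q 1)) = y := (Γ.tgt_mul _ _ hgh.symm).trans hy
    change (⟨Γ.tgt (Γ.mul (q 0) (q 1)), c.Kbas (q 0) (q 1) (Γ.tgt (Γ.mul (q 0) (q 1)))
      (Γ.tgt (q 1)) x v⟩ : Γ.algVB.Tot) = _
    generalize Γ.tgt (Γ.mul (q 0) (q 1)) = z at e
    subst e
    rfl

theorem isOperatorSequence_adOps : IsOperatorSequence c.adOps where
  degree := c.adOps_degree
  smooth k l l' := by
    by_cases h : (k = 0 ∧ l = 0 ∧ l' = 1) ∨ (k = 1 ∧ l = 0 ∧ l' = 0) ∨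
      (k = 1 ∧ l = 1 ∧ l' = 1) ∨ (k = 2 ∧ l = 1 ∧ l' = 0)
    · obtain ⟨rfl, rfl, rfl⟩ | ⟨rfl, rfl, rfl⟩ | ⟨rfl, rfl, rfl⟩ | ⟨rfl, rfl, rfl⟩ := h
      · exact c.smoothHom_anchor
      · exact c.smoothHom_lamA
      · exact c.smoothHom_act
      · exact c.smoothHom_Kbas
    · exact smoothHom_of_eq_zero _ _ k _ fun s hs => c.adOps_eq_zero s l l' (by rwa [hs])

end Connection
end LieGroupoid

/-! ### Signs and double sums. -/

theorem neg_one_pow_congr {a b : ℕ} (h : Even a ↔ Even b) : (-1 : ℝ) ^ a = (-1) ^ b := by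
  by_cases ha : Even a
  · rw [ha.neg_one_pow, (h.1 ha).neg_one_pow]
  · have hb : ¬Even b := fun hb => ha (h.2 hb)
    rw [(Nat.not_even_iff_odd.1 ha).neg_one_pow, (Nat.not_even_iff_odd.1 hb).neg_one_pow]

/-- The square is cut along the diagonal: `q = j + 1` when `i < j`, and `q = j` when `i ≥ j`. For
face `i` of a string split after `j` arrows, these are the faces inside the initial block and inside
the final block. The extreme values of `q` contribute empty sums. -/
theorem sum_range_split {V : Type*} [AddCommMonoid V] (n : ℕ) (F : ℕ → ℕ → V) :
    ∑ i ∈ Finset.range n, ∑ j ∈ Finset.range n, F i j =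
      ∑ q ∈ Finset.range (n + 1), ∑ i ∈ Finset.range (q - 1), F i (q - 1) +
        ∑ q ∈ Finset.range (n + 1), ∑ i ∈ Finset.range (n - q), F (q + i) q := by
  have h1 : ∑ q ∈ Finset.range (n + 1), ∑ i ∈ Finset.range (q - 1), F i (q - 1) =
      ∑ i ∈ Finset.range n, ∑ j ∈ Finset.Ico (i + 1) n, F i j := by
    rw [Finset.sum_range_succ']
    simp only [Nat.add_sub_cancel, Nat.zero_sub, Finset.range_zero, Finset.sum_empty, add_zero]
    refine Finset.sum_comm' fun j i => ?_
    simp only [Finset.mem_range, Finset.mem_Ico]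
    omega
  have h2 : ∑ q ∈ Finset.range (n + 1), ∑ i ∈ Finset.range (n - q), F (q + i) q =
      ∑ i ∈ Finset.range n, ∑ j ∈ Finset.range (i + 1), F i j := by
    rw [Finset.sum_range_succ, Nat.sub_self, Finset.sum_range_zero, add_zero,
      ← Finset.sum_range_diag_flip n (fun q i => F (q + i) q)]
    refine Finset.sum_congr rfl fun i _ => Finset.sum_congr rfl fun j hj => ?_
    rw [Nat.add_sub_cancel' (Nat.lt_succ_iff.1 (Finset.mem_range.1 hj))]
  rw [h1, h2, ← Finset.sum_add_distrib]
  refine Finset.sum_congr rfl fun i hi => ?_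
  refine Eq.trans ?_ (add_comm _ _)
  exact (Finset.sum_range_add_sum_Ico _ (Finset.mem_range.1 hi)).symm

/-- The pair `(i, j)` with `i < j` cancels against `(j - 1, i)`, whose sign is opposite. -/
theorem sum_range_alternating_eq_zero {V : Type*} [AddCommGroup V] [Module ℝ V] (n : ℕ)
    (F : ℕ → ℕ → V) (h : ∀ i j, i < j → j < n → F i j = F (j - 1) i) :
    ∑ j ∈ Finset.range n, ∑ i ∈ Finset.range (n - 1), (-1 : ℝ) ^ (i + j) • F i j = 0 := by
  obtain _ | N := n
  · simp
  rw [Finset.sum_comm, Nat.add_sub_cancel]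
  have h1 : ∑ i ∈ Finset.range N, ∑ j ∈ Finset.Ico (i + 1) (N + 1), (-1 : ℝ) ^ (i + j) • F i j =
      -∑ i ∈ Finset.range N, ∑ j ∈ Finset.range (i + 1), (-1 : ℝ) ^ (i + j) • F i j := by
    rw [← Finset.sum_neg_distrib]
    simp only [← Finset.sum_neg_distrib, ← Finset.sum_Ico_add']
    rw [Finset.sum_comm' (t' := Finset.range N) (s' := fun j => Finset.range (j + 1))]
    · refine Finset.sum_congr rfl fun j hj => Finset.sum_congr rfl fun i hi => ?_
      have h1 := Finset.mem_range.1 hj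
      have h2 := Finset.mem_range.1 hi
      rw [h i (j + 1) h2 (by omega), Nat.add_sub_cancel, ← add_assoc, pow_succ, add_comm i j]
      module
    · intro i j
      simp only [Finset.mem_range, Finset.mem_Ico]
      omega
  rw [← add_eq_zero_iff_eq_neg.2 h1, ← Finset.sum_add_distrib]
  refine Finset.sum_congr rfl fun i hi => ?_
  refine Eq.trans ?_ (add_comm _ _)
  exact (Finset.sum_range_add_sum_Ico _ (by have := Finset.mem_range.1 hi; omega)).symm

/-! ### Faces, initial and final segments of strings. -/

namespace LieGroupoid
variable {Γ : LieGroupoid m n M G}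

section Lists

theorem take_contract_of_le (p : List G) {i j : ℕ} (h : j ≤ i) :
    (Γ.contract i p).take j = p.take j := by
  induction p generalizing i j with
  | nil => cases i <;> rfl
  | cons g p ih =>
    cases j with
    | zero => rfl
    | succ j =>
      cases i with
      | zero => omega
      | succ i => simp only [contract, List.take_succ_cons, ih (Nat.le_of_succ_le_succ h)]

theorem drop_contract_of_le (p : List G) {i j : ℕ} (h : j ≤ i) :
    (Γ.contract i p).drop j = Γ.contract (i - j) (p.drop j) := by
  induction p generalizing i j with
  | nil => cases i <;> cases j <;> simp [contract]
  | cons g p ih =>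
    cases j with
    | zero => rfl
    | succ j =>
      cases i with
      | zero => omega
      | succ i =>
        simp only [contract, List.drop_succ_cons, ih (Nat.le_of_succ_le_succ h),
          Nat.add_sub_add_right]

theorem take_contract_of_lt (p : List G) {i j : ℕ} (h : i < j) :
    (Γ.contract i p).take j = Γ.contract i (p.take (j + 1)) := by
  induction p generalizing i j with
  | nil => cases i <;> simp [contract]
  | cons g p ih =>
    obtain _ | j := j
    · omega
    cases i with
    | succ i => simp only [contract, List.take_succ_cons, ih (Nat.lt_of_succ_lt_succ h)]
    | zero => cases p <;> simp [contract]

theorem drop_contract_of_lt (p : List G) {i j : ℕ} (h : i < j) :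
    (Γ.contract i p).drop j = p.drop (j + 1) := by
  induction p generalizing i j with
  | nil => cases i <;> simp [contract]
  | cons g p ih =>
    obtain _ | j := j
    · omega
    cases i with
    | succ i => simp only [contract, List.drop_succ_cons, ih (Nat.lt_of_succ_lt_succ h)]
    | zero => cases p <;> simp [contract]

/-- Composability matters only when the contractions overlap, `j = i + 1`, where the claim is
associativity. -/
theorem contract_contract {p : List G} {y x : M} (hp : Γ.IsString p y x) {i j : ℕ} (h : i < j) :
    Γ.contract i (Γ.contract j p) = Γ.contract (j - 1) (Γ.contract i p) := by
  induction p generalizing i j y with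
  | nil => cases i <;> cases j <;> simp [contract]
  | cons g p ih =>
    obtain _ | j := j
    · omega
    cases i with
    | succ i =>
      obtain _ | j := j
      · omega
      simp only [contract, Nat.add_sub_cancel]
      rw [ih hp.2 (Nat.lt_of_succ_lt_succ h), Nat.add_sub_cancel]
    | zero =>
      obtain _ | ⟨k, p⟩ := p
      · cases j <;> simp [contract]
      cases j with
      | succ j => simp [contract]
      | zero =>
        obtain _ | ⟨k', p⟩ := p
        · simp [contract]
        · obtain ⟨-, h1, h2, -⟩ := hp
          simp only [contract, Nat.add_sub_cancel]
          rw [Γ.mul_assoc g k k' h1.symm h2.symm]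

theorem IsString.right_unique {p : List G} {y x x' : M} (h : Γ.IsString p y x)
    (h' : Γ.IsString p y x') : x = x' := by
  induction p generalizing y with
  | nil => exact h.symm.trans h'
  | cons g p ih => exact ih h.2 h'.2

end Lists

namespace Str

/-- Arrows alone do not locate an empty string, so one end vertex must be compared as well. Final
segments keep the right end definitionally, initial segments the left end; each gets its own
extensionality lemma. -/
theorem ext_right {s t : Γ.Str} (ha : s.arrows = t.arrows) (hr : s.right = t.right) : s = t := by
  obtain ⟨p, y, x, h⟩ := s
  obtain ⟨p', y', x', h'⟩ := t
  obtain rfl : p = p' := ha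
  obtain rfl : x = x' := hr
  obtain rfl : y = y' := h.eq_vertex.trans h'.eq_vertex.symm
  rfl

theorem ext_left {s t : Γ.Str} (ha : s.arrows = t.arrows) (hl : s.left = t.left) : s = t := by
  obtain ⟨p, y, x, h⟩ := s
  obtain ⟨p', y', x', h'⟩ := t
  obtain rfl : p = p' := ha
  obtain rfl : y = y' := hl
  obtain rfl : x = x' := h.right_unique h'
  rfl

variable (s : Γ.Str)

theorem len_take {j : ℕ} (h : j ≤ s.len) : (s.take j).len = j :=
  List.length_take.trans (min_eq_left h)

theorem len_drop (j : ℕ) : (s.drop j).len = s.len - j := List.length_drop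

theorem len_contract {i : ℕ} (h : i < s.len - 1) : (s.contract i).len = s.len - 1 :=
  length_contract _ _ h

theorem drop_drop (i j : ℕ) : (s.drop j).drop i = s.drop (j + i) :=
  ext_right List.drop_drop rfl

theorem take_take {i j : ℕ} (h : i ≤ j) : (s.take j).take i = s.take i :=
  ext_left (by simp [List.take_take, h]) rfl

theorem drop_take (i j : ℕ) : (s.take (j + i)).drop j = (s.drop j).take i := by
  refine ext_right ?_ ?_
  · simp [List.drop_take]
  · simp [List.drop_drop]

theorem take_contract_of_le {i j : ℕ} (h : j ≤ i) : (s.contract i).take j = s.take j :=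
  ext_left (LieGroupoid.take_contract_of_le _ h) rfl

theorem drop_contract_of_le (i j : ℕ) :
    (s.contract (j + i)).drop j = (s.drop j).contract i :=
  ext_right ((LieGroupoid.drop_contract_of_le _ (Nat.le_add_right j i)).trans (by simp)) rfl

theorem take_contract_of_lt {i j : ℕ} (h : i < j) :
    (s.contract i).take j = (s.take (j + 1)).contract i :=
  ext_left (LieGroupoid.take_contract_of_lt _ h) rfl

theorem drop_contract_of_lt {i j : ℕ} (h : i < j) : (s.contract i).drop j = s.drop (j + 1) :=
  ext_right (LieGroupoid.drop_contract_of_lt _ h) rfl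

theorem contract_contract {i j : ℕ} (h : i < j) :
    (s.contract j).contract i = (s.contract i).contract (j - 1) :=
  ext_right (LieGroupoid.contract_contract s.isString h) rfl

/-- The string without one of its inner vertices, or without its last one. -/
def face (i : ℕ) : Γ.Str := if i < s.len - 1 then s.contract i else s.take (s.len - 1)

theorem face_of_lt {i : ℕ} (h : i < s.len - 1) : s.face i = s.contract i := if_pos h

theorem face_last {i : ℕ} (h : s.len - 1 ≤ i) : s.face i = s.take (s.len - 1) :=
  if_neg (Nat.not_lt.2 h)

theorem len_face (i : ℕ) : (s.face i).len = s.len - 1 := by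
  by_cases h : i < s.len - 1
  · rw [s.face_of_lt h, s.len_contract h]
  · rw [s.face_last (Nat.not_lt.1 h), s.len_take (Nat.sub_le _ _)]

theorem take_face_of_lt {i j : ℕ} (h : i < j) (hj : j < s.len) :
    (s.face i).take j = (s.take (j + 1)).contract i := by
  rw [s.face_of_lt (by omega), s.take_contract_of_lt h]

theorem drop_face_of_lt {i j : ℕ} (h : i < j) (hj : j < s.len) :
    (s.face i).drop j = s.drop (j + 1) := by
  rw [s.face_of_lt (by omega), s.drop_contract_of_lt h]

theorem take_face_of_le {i j : ℕ} (h : j ≤ i) (hi : i < s.len) : (s.face i).take j = s.take j := by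
  by_cases h' : i < s.len - 1
  · rw [s.face_of_lt h', s.take_contract_of_le h]
  · rw [s.face_last (Nat.not_lt.1 h'), s.take_take (by omega)]

theorem drop_face_add {i j : ℕ} (h : j + i < s.len) : (s.face (j + i)).drop j = (s.drop j).face i := by
  have hl := s.len_drop j
  by_cases h' : j + i < s.len - 1
  · rw [s.face_of_lt h', s.drop_contract_of_le, face_of_lt _ (by omega)]
  · rw [s.face_last (Nat.not_lt.1 h'), face_last _ (by omega), hl,
      show s.len - 1 = j + (s.len - j - 1) by omega, s.drop_take]

/-- The simplicial identities for the faces that preserve the target of the string. The face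
deleting the first arrow changes the target and is not among them. -/
theorem face_face {i j : ℕ} (h : i < j) (hj : j < s.len) :
    (s.face j).face i = (s.face i).face (j - 1) := by
  have h1 := s.len_face i
  have h2 := s.len_face j
  have hi : i < s.len - 1 := by omega
  by_cases h' : j < s.len - 1
  · rw [face_of_lt _ (by omega), face_of_lt (s.face i) (by omega), s.face_of_lt h', s.face_of_lt hi,
      s.contract_contract h]
  rw [face_last (s.face i) (by omega), h1]
  by_cases h'' : i < s.len - 1 - 1
  · rw [s.take_face_of_lt h'' (by omega), face_of_lt _ (by omega), s.face_last (Nat.not_lt.1 h'),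
      Nat.sub_add_cancel (by omega)]
  · rw [s.take_face_of_le (by omega) (by omega), face_last _ (by omega), h2,
      s.take_face_of_le (by omega) hj]

end Str

end LieGroupoid

/-! ### The algebra of `D` for cochains in a single vector space. -/

namespace LieGroupoid
variable {Γ : LieGroupoid m n M G}

section Abstract
variable {W : Type*} [AddCommGroup W] [Module ℝ W] (ε : Module.End ℝ W)
  (R : Γ.Str → Module.End ℝ W) (N : Γ.Str → W) (f : Γ.Str → ℝ)

/-- The operator `∑ⱼ R_j ⋆`, for cochains with values in a fixed vector space. -/
def opL (s : Γ.Str) : W :=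
  ∑ j ∈ Finset.range (s.len + 1),
    (-1 : ℝ) ^ (j * (s.len + 1)) • (ε ^ j) (R (s.take j) (N (s.drop j)))

/-- The operator `D̂_0`, for cochains with values in a fixed vector space. -/
def opH (s : Γ.Str) : W :=
  (-1 : ℝ) ^ (s.len + 1) • ε (∑ i ∈ Finset.range s.len, (-1 : ℝ) ^ (i + 1) • N (s.face i))

/-- The right module structure, for cochains with values in a fixed vector space. -/
def opStar (s : Γ.Str) : W :=
  ∑ j ∈ Finset.range (s.len + 1), ((-1) ^ (j * (s.len - j)) * f (s.drop j)) • N (s.take j)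

variable {ε R}

/-- `ε` stands for the sign `(-1)^l` on `E^l`, so degree-dependent signs become powers of `ε`. The
hypothesis says that the operator on `k` arrows shifts degree by `1 - k`. -/
theorem end_pow_comm (hR : ∀ t w, R t (ε w) = (-1 : ℝ) ^ (t.len + 1) • ε (R t w)) (t : Γ.Str)
    (b : ℕ) (w : W) :
    R t ((ε ^ b) w) = (-1 : ℝ) ^ ((t.len + 1) * b) • (ε ^ b) (R t w) := by
  induction b with
  | zero => simp
  | succ b ih =>
    rw [pow_succ', Module.End.mul_apply, hR, ih, map_smul, smul_smul, ← pow_add,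
      Module.End.mul_apply]
    congr 1
    ring

/-- Terms are grouped by `q`, the number of arrows consumed by the two operators together. The
structure equation for the first `q` arrows rewrites each group as contractions; the last arrows are
spectators. -/
theorem opL_opL (hR : ∀ t w, R t (ε w) = (-1 : ℝ) ^ (t.len + 1) • ε (R t w))
    (hS : ∀ (s : Γ.Str) w, ∑ i ∈ Finset.range (s.len - 1), (-1 : ℝ) ^ (i + 1) •
      R (s.contract i) w = ∑ j ∈ Finset.range (s.len + 1), (-1 : ℝ) ^ j •
        R (s.take j) (R (s.drop j) w)) (s : Γ.Str) :
    opL ε R (opL ε R N) s = ∑ q ∈ Finset.range (s.len + 1), ∑ i ∈ Finset.range (q - 1),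
      (-1 : ℝ) ^ (q * s.len + i + 1) • (ε ^ q) (R ((s.take q).contract i) (N (s.drop q))) := by
  let T : ℕ → ℕ → W := fun a b => (-1 : ℝ) ^ ((a + b) * s.len + a) •
    (ε ^ (a + b)) (R (s.take a) (R ((s.drop a).take b) (N (s.drop (a + b)))))
  have h1 : opL ε R (opL ε R N) s =
      ∑ a ∈ Finset.range (s.len + 1), ∑ b ∈ Finset.range (s.len + 1 - a), T a b := by
    refine Finset.sum_congr rfl fun a ha => ?_
    obtain ⟨r, hr⟩ := Nat.exists_eq_add_of_le (Nat.lt_succ_iff.1 (Finset.mem_range.1 ha))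
    have hd : (s.drop a).len = r := by rw [s.len_drop]; omega
    rw [opL, hd, show s.len + 1 - a = r + 1 by omega, map_sum, map_sum, Finset.smul_sum]
    refine Finset.sum_congr rfl fun b _ => ?_
    simp only [T]
    rw [map_smul, end_pow_comm hR, s.len_take (by omega), s.drop_drop, map_smul, map_smul,
      smul_smul, smul_smul, ← Module.End.mul_apply, ← pow_add, ← pow_add, ← pow_add, hr]
    congr 1
    refine neg_one_pow_congr ?_
    simp only [Nat.even_add, Nat.even_mul, Nat.not_even_one]
    tauto
  rw [h1, ← Finset.sum_range_diag_flip]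
  refine Finset.sum_congr rfl fun q hq => ?_
  have hq' := Nat.lt_succ_iff.1 (Finset.mem_range.1 hq)
  have h2 := congrArg (fun w => (-1 : ℝ) ^ (q * s.len) • (ε ^ q) w) (hS (s.take q) (N (s.drop q)))
  simp only [s.len_take hq', map_sum, Finset.smul_sum, map_smul, smul_smul, ← pow_add] at h2
  refine Eq.trans ?_ h2.symm
  refine Finset.sum_congr rfl fun a ha => ?_
  have ha' := Nat.lt_succ_iff.1 (Finset.mem_range.1 ha)
  have h3 := s.drop_take (q - a) a
  rw [Nat.add_sub_cancel' ha'] at h3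
  simp only [T]
  rw [Nat.add_sub_cancel' ha', s.take_take ha', h3]

/-- Faces inside the arguments of the operator form the first sum, opposite to `opL_opL`. Faces
inside the arguments of the cochain form the second, opposite to `opL_opH`. -/
theorem opH_opL (s : Γ.Str) :
    opH ε (opL ε R N) s =
      (∑ q ∈ Finset.range (s.len + 1), ∑ i ∈ Finset.range (q - 1),
        (-1 : ℝ) ^ (q * s.len + i) • (ε ^ q) (R ((s.take q).contract i) (N (s.drop q)))) +
      ∑ q ∈ Finset.range (s.len + 1), ∑ i ∈ Finset.range (s.len - q),
        (-1 : ℝ) ^ (s.len + q + i + q * s.len) •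
          (ε ^ (q + 1)) (R (s.take q) (N ((s.drop q).face i))) := by
  have h1 : opH ε (opL ε R N) s = ∑ i ∈ Finset.range s.len, ∑ j ∈ Finset.range s.len,
      (-1 : ℝ) ^ (s.len + i + j * s.len) •
        (ε ^ (j + 1)) (R ((s.face i).take j) (N ((s.face i).drop j))) := by
    rw [opH, map_sum, Finset.smul_sum]
    refine Finset.sum_congr rfl fun i hi => ?_
    have hi' := Finset.mem_range.1 hi
    have hl : (s.face i).len + 1 = s.len := by rw [s.len_face]; omega
    rw [opL, hl, map_smul, map_sum, smul_smul, Finset.smul_sum]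
    refine Finset.sum_congr rfl fun j _ => ?_
    rw [map_smul, smul_smul, pow_succ' ε, Module.End.mul_apply, ← pow_add, ← pow_add]
    congr 1
    refine neg_one_pow_congr ?_
    simp only [Nat.even_add, Nat.even_mul, Nat.not_even_one]
    tauto
  rw [h1, sum_range_split]
  congr 1
  · refine Finset.sum_congr rfl fun q hq => Finset.sum_congr rfl fun i hi => ?_
    have hi' := Finset.mem_range.1 hi
    have hq' := Finset.mem_range.1 hq
    rw [s.take_face_of_lt hi' (by omega), s.drop_face_of_lt hi' (by omega),
      Nat.sub_add_cancel (by omega)]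
    congr 1
    refine neg_one_pow_congr ?_
    obtain ⟨p, rfl⟩ : ∃ p, q = p + 1 := ⟨q - 1, by omega⟩
    simp only [Nat.even_add, Nat.even_mul, Nat.not_even_one]
    tauto
  · refine Finset.sum_congr rfl fun q hq => Finset.sum_congr rfl fun i hi => ?_
    have hi' := Finset.mem_range.1 hi
    rw [s.take_face_of_le (by omega) (by omega), s.drop_face_add (by omega), ← add_assoc]

theorem opL_opH (hR : ∀ t w, R t (ε w) = (-1 : ℝ) ^ (t.len + 1) • ε (R t w)) (s : Γ.Str) :
    opL ε R (opH ε N) s =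
      ∑ q ∈ Finset.range (s.len + 1), ∑ i ∈ Finset.range (s.len - q),
        (-1 : ℝ) ^ (s.len + q + i + q * s.len + 1) •
          (ε ^ (q + 1)) (R (s.take q) (N ((s.drop q).face i))) := by
  refine Finset.sum_congr rfl fun q hq => ?_
  obtain ⟨r, hr⟩ := Nat.exists_eq_add_of_le (Nat.lt_succ_iff.1 (Finset.mem_range.1 hq))
  have hd : (s.drop q).len = r := by rw [s.len_drop]; omega
  rw [opH, hd, show s.len - q = r by omega, map_smul, hR, s.len_take (by omega), map_sum, map_sum,
    map_smul, map_smul, map_sum, Finset.smul_sum, Finset.smul_sum, Finset.smul_sum]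
  refine Finset.sum_congr rfl fun i _ => ?_
  rw [map_smul, map_smul, map_smul, ← Module.End.mul_apply, ← pow_succ]
  simp only [smul_smul, ← pow_add]
  rw [show s.len = q + r from hr]
  congr 1
  refine neg_one_pow_congr ?_
  simp only [Nat.even_add, Nat.even_mul, Nat.not_even_one]
  by_cases h1 : Even q <;> by_cases h2 : Even r <;> by_cases h3 : Even i <;> simp [h1, h2, h3]

/-- The two applications see lengths that differ by one, which makes the overall sign constant; the
simplicial identity `face_face` does the rest. -/
theorem opH_opH (s : Γ.Str) : opH ε (opH ε N) s = 0 := by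
  have h1 : opH ε (opH ε N) s = -(ε ^ 2) (∑ j ∈ Finset.range s.len, ∑ i ∈ Finset.range (s.len - 1),
      (-1 : ℝ) ^ (i + j) • N ((s.face j).face i)) := by
    rw [opH, map_sum, Finset.smul_sum, map_sum, ← Finset.sum_neg_distrib]
    refine Finset.sum_congr rfl fun j hj => ?_
    have hj' := Finset.mem_range.1 hj
    rw [opH, s.len_face, map_smul, map_smul, smul_smul, smul_smul, map_sum, map_sum, map_sum,
      Finset.smul_sum, ← Finset.sum_neg_distrib]
    refine Finset.sum_congr rfl fun i _ => ?_
    rw [map_smul, map_smul, smul_smul, map_smul, pow_two ε, Module.End.mul_apply, ← neg_smul,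
      ← pow_add, ← pow_add, ← pow_add, ← neg_one_mul ((-1 : ℝ) ^ (i + j)), ← pow_succ']
    congr 1
    refine neg_one_pow_congr ?_
    obtain ⟨p, hp⟩ : ∃ p, s.len = p + 1 := ⟨s.len - 1, by omega⟩
    rw [hp]
    simp only [Nat.even_add, Nat.not_even_one]
    tauto
  rw [h1, sum_range_alternating_eq_zero _ (fun i j => N ((s.face j).face i))
    (fun i j h hj => by rw [s.face_face h hj]), map_zero, neg_zero]

theorem opL_add_opH_square_zero
    (hR : ∀ t w, R t (ε w) = (-1 : ℝ) ^ (t.len + 1) • ε (R t w))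
    (hS : ∀ (s : Γ.Str) w, ∑ i ∈ Finset.range (s.len - 1), (-1 : ℝ) ^ (i + 1) •
      R (s.contract i) w = ∑ j ∈ Finset.range (s.len + 1), (-1 : ℝ) ^ j •
        R (s.take j) (R (s.drop j) w)) (s : Γ.Str) :
    opL ε R (opL ε R N) s + opH ε (opL ε R N) s +
      (opL ε R (opH ε N) s + opH ε (opH ε N) s) = 0 := by
  rw [opL_opL N hR hS, opH_opL, opL_opH N hR, opH_opH]
  simp only [pow_succ _ (_ * _ + _), pow_succ _ (_ + _ + _ * _), mul_neg, mul_one, neg_smul,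
    Finset.sum_neg_distrib]
  abel

/-- The operators act on the initial arrows and `f` on the final ones. Both sides are the same sum
over two cut points, and the signs match termwise. -/
theorem opL_opStar (s : Γ.Str) : opL ε R (opStar N f) s = opStar (opL ε R N) f s := by
  let T : ℕ → ℕ → W := fun a b =>
    ((-1 : ℝ) ^ (a * (s.len + 1) + b * (s.len - (a + b))) * f (s.drop (a + b))) •
      (ε ^ a) (R (s.take a) (N ((s.drop a).take b)))
  have h1 : opL ε R (opStar N f) s =
      ∑ a ∈ Finset.range (s.len + 1), ∑ b ∈ Finset.range (s.len + 1 - a), T a b := by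
    refine Finset.sum_congr rfl fun a ha => ?_
    have ha' := Finset.mem_range.1 ha
    rw [opStar, s.len_drop, show s.len + 1 - a = s.len - a + 1 by omega, map_sum, map_sum,
      Finset.smul_sum]
    refine Finset.sum_congr rfl fun b _ => ?_
    rw [map_smul, map_smul, smul_smul, s.drop_drop, ← _root_.mul_assoc, ← pow_add, Nat.sub_sub]
  rw [h1, ← Finset.sum_range_diag_flip]
  refine Finset.sum_congr rfl fun q hq => ?_
  obtain ⟨r, hr⟩ := Nat.exists_eq_add_of_le (Nat.lt_succ_iff.1 (Finset.mem_range.1 hq))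
  rw [opL, s.len_take (by omega), Finset.smul_sum]
  refine Finset.sum_congr rfl fun a ha => ?_
  have ha' := Nat.lt_succ_iff.1 (Finset.mem_range.1 ha)
  have h3 := s.drop_take (q - a) a
  rw [Nat.add_sub_cancel' ha'] at h3
  simp only [T]
  rw [Nat.add_sub_cancel' ha', s.take_take ha', h3, smul_smul, mul_right_comm, ← pow_add]
  congr 2
  refine neg_one_pow_congr ?_
  obtain ⟨b, rfl⟩ := Nat.exists_eq_add_of_le ha'
  rw [hr, Nat.add_sub_cancel_left, Nat.add_sub_cancel_left]
  simp only [Nat.even_add, Nat.even_mul, Nat.not_even_one]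
  tauto

/-- Only the face deleting the first arrow is kept apart; the others are indexed by `face`, as in
`opH`. -/
theorem scalarD_eq (s : Γ.Str) : scalarD f s =
    (if s.len = 0 then 0 else (-1) ^ (s.len - 1) * f (s.drop 1)) +
      ∑ i ∈ Finset.range s.len, (-1) ^ (s.len + i) * f (s.face i) := by
  by_cases h : s.arrows = []
  · have h0 : s.len = 0 := by simp [Str.len, h]
    rw [scalarD, if_pos h, if_pos h0, h0, Finset.sum_range_zero, add_zero]
  · obtain ⟨p, hp⟩ : ∃ p, s.len = p + 1 :=
      Nat.exists_eq_succ_of_ne_zero fun h0 => h (List.length_eq_zero_iff.1 h0)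
    rw [scalarD, if_neg h, if_neg (by omega), hp, Nat.add_sub_cancel, Finset.sum_range_succ,
      s.face_last (by omega), hp, Nat.add_sub_cancel, mul_add, mul_add, add_assoc, Finset.mul_sum]
    congr 2
    · refine Finset.sum_congr rfl fun i hi => ?_
      rw [s.face_of_lt (by have := Finset.mem_range.1 hi; omega)]
      ring
    · ring

/-- The hypothesis on `N` expresses homogeneity, with `δ` in the role of `(-1)^{|η|}`. -/
theorem opH_opStar {δ : ℝ} (hN : ∀ t, ε (N t) = (δ * (-1) ^ t.len) • N t) (s : Γ.Str) :
    opH ε (opStar N f) s = opStar (opH ε N) f s + δ • opStar N (scalarD f) s := by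
  -- `A` collects contractions inside the arguments of `N`, and `B` faces inside those of `f`. `C`
  -- deletes the arrow between the two blocks: it is the last face for `N` and, with opposite sign,
  -- the first face for `f`.
  let A : W := ∑ q ∈ Finset.range s.len, ∑ i ∈ Finset.range q,
    ((-1 : ℝ) ^ (s.len + i + q * (s.len - 1 - q)) * f (s.drop (q + 1))) •
      ε (N ((s.take (q + 1)).contract i))
  let B : W := ∑ q ∈ Finset.range (s.len + 1), ∑ i ∈ Finset.range (s.len - q),
    ((-1 : ℝ) ^ (s.len + i + q * (s.len - q)) * f ((s.drop q).face i)) • ε (N (s.take q))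
  let C : W := ∑ q ∈ Finset.range s.len,
    ((-1 : ℝ) ^ (s.len + q * (s.len - q)) * f (s.drop (q + 1))) • ε (N (s.take q))
  have h1 : opH ε (opStar N f) s = A + B := by
    have : opH ε (opStar N f) s = ∑ i ∈ Finset.range s.len, ∑ j ∈ Finset.range s.len,
        ((-1 : ℝ) ^ (s.len + i + j * (s.len - 1 - j)) * f ((s.face i).drop j)) •
          ε (N ((s.face i).take j)) := by
      rw [opH, map_sum, Finset.smul_sum]
      refine Finset.sum_congr rfl fun i hi => ?_
      have hi' := Finset.mem_range.1 hi
      rw [opStar, s.len_face, Nat.sub_add_cancel (by omega), map_smul, map_sum, smul_smul,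
        Finset.smul_sum]
      refine Finset.sum_congr rfl fun j _ => ?_
      rw [map_smul, smul_smul]
      congr 1
      ring
    rw [this, sum_range_split]
    congr 1
    · rw [Finset.sum_range_succ']
      simp only [Nat.zero_sub, Finset.sum_range_zero, add_zero, Nat.add_sub_cancel]
      refine Finset.sum_congr rfl fun q hq => Finset.sum_congr rfl fun i hi => ?_
      have hi' := Finset.mem_range.1 hi
      have hq' := Finset.mem_range.1 hq
      rw [s.take_face_of_lt hi' hq', s.drop_face_of_lt hi' hq']
    · refine Finset.sum_congr rfl fun q hq => Finset.sum_congr rfl fun i hi => ?_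
      have hi' := Finset.mem_range.1 hi
      rw [s.take_face_of_le (by omega) (by omega), s.drop_face_add (by omega)]
      congr 2
      refine neg_one_pow_congr ?_
      obtain ⟨r, hr⟩ : ∃ r, s.len = q + r + 1 := ⟨s.len - q - 1, by omega⟩
      rw [show s.len - 1 - q = r by omega, show s.len - q = r + 1 by omega, hr]
      simp only [Nat.even_add, Nat.even_mul, Nat.not_even_one]
      by_cases h1 : Even q <;> by_cases h2 : Even r <;> by_cases h3 : Even i <;> simp [h1, h2, h3]
  have h2 : opStar (opH ε N) f s = A + C := by
    rw [opStar, Finset.sum_range_succ', ← Finset.sum_add_distrib]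
    rw [opH, s.len_take (Nat.zero_le _), Finset.sum_range_zero, map_zero, smul_zero, smul_zero,
      add_zero]
    refine Finset.sum_congr rfl fun q hq => ?_
    have hq' := Finset.mem_range.1 hq
    obtain ⟨r, hr⟩ : ∃ r, s.len = q + r + 1 := ⟨s.len - q - 1, by omega⟩
    have hl : (s.take (q + 1)).len = q + 1 := s.len_take (by omega)
    rw [opH, hl, Finset.sum_range_succ, Str.face_last _ (by omega), hl, Nat.add_sub_cancel,
      s.take_take (Nat.le_succ q), map_add, map_sum, smul_add, smul_add]
    congr 1
    · rw [Finset.smul_sum, Finset.smul_sum]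
      refine Finset.sum_congr rfl fun i hi => ?_
      have hi' := Finset.mem_range.1 hi
      rw [Str.face_of_lt _ (by omega), map_smul, smul_smul, smul_smul,
        show ∀ a b c d : ℝ, a * b * c * d = a * c * d * b by intros; ring, ← pow_add, ← pow_add]
      congr 2
      refine neg_one_pow_congr ?_
      rw [show s.len - (q + 1) = r by omega, show s.len - 1 - q = r by omega, hr]
      simp only [Nat.even_add, Nat.even_mul, Nat.not_even_one]
      by_cases h1 : Even q <;> by_cases h2 : Even r <;> by_cases h3 : Even i <;> simp [h1, h2, h3]
    · rw [map_smul, smul_smul, smul_smul,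
        show ∀ a b c d : ℝ, a * b * c * d = a * c * d * b by intros; ring, ← pow_add, ← pow_add]
      congr 2
      refine neg_one_pow_congr ?_
      rw [show s.len - (q + 1) = r by omega, show s.len - q = r + 1 by omega, hr]
      simp only [Nat.even_add, Nat.even_mul, Nat.not_even_one]
      by_cases h1 : Even q <;> by_cases h2 : Even r <;> simp [h1, h2]
  have h3 : δ • opStar N (scalarD f) s = -C + B := by
    have : δ • opStar N (scalarD f) s = ∑ q ∈ Finset.range (s.len + 1),
        ((-1 : ℝ) ^ (q * (s.len - q) + q) * scalarD f (s.drop q)) • ε (N (s.take q)) := by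
      rw [opStar, Finset.smul_sum]
      refine Finset.sum_congr rfl fun q hq => ?_
      rw [hN, s.len_take (Nat.lt_succ_iff.1 (Finset.mem_range.1 hq)), smul_smul, smul_smul]
      congr 1
      have h1 : (-1 : ℝ) ^ q * (-1) ^ q = 1 := by rw [← mul_pow]; simp
      rw [pow_add]
      linear_combination -(δ * (-1) ^ (q * (s.len - q)) * scalarD f (s.drop q)) * h1
    simp only [this, scalarD_eq, mul_add, add_smul, Finset.sum_add_distrib]
    congr 1
    · rw [Finset.sum_range_succ, if_pos (by rw [s.len_drop]; omega), mul_zero, zero_smul, add_zero,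
        ← Finset.sum_neg_distrib]
      refine Finset.sum_congr rfl fun q hq => ?_
      have hq' := Finset.mem_range.1 hq
      obtain ⟨r, hr⟩ : ∃ r, s.len = q + r + 1 := ⟨s.len - q - 1, by omega⟩
      have hl := s.len_drop q
      rw [if_neg (by omega), hl, s.drop_drop, ← _root_.mul_assoc, ← pow_add, ← neg_smul, ← neg_mul,
        ← neg_one_mul ((-1 : ℝ) ^ (s.len + _)), ← pow_succ']
      congr 2
      refine neg_one_pow_congr ?_
      rw [show s.len - q = r + 1 by omega, hr, Nat.add_sub_cancel]
      simp only [Nat.even_add, Nat.even_mul, Nat.not_even_one]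
      by_cases h1 : Even q <;> by_cases h2 : Even r <;> simp [h1, h2]
    · refine Finset.sum_congr rfl fun q hq => ?_
      obtain ⟨r, hr⟩ := Nat.exists_eq_add_of_le (Nat.lt_succ_iff.1 (Finset.mem_range.1 hq))
      have hr' : s.len = q + r := hr
      have hl := s.len_drop q
      rw [hl, Finset.mul_sum, Finset.sum_smul]
      refine Finset.sum_congr rfl fun i _ => ?_
      rw [← _root_.mul_assoc, ← pow_add]
      congr 2
      refine neg_one_pow_congr ?_
      rw [show s.len - q = r by omega, hr']
      simp only [Nat.even_add, Nat.even_mul]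
      by_cases h1 : Even q <;> by_cases h2 : Even r <;> by_cases h3 : Even i <;> simp [h1, h2, h3]
  rw [h1, h2, h3]
  abel

end Abstract

end LieGroupoid

/-! ### Transfer of the algebra to cochains with values in `E`. -/

theorem neg_one_zpow_congr {a b : ℤ} (h : Even a ↔ Even b) : (-1 : ℝ) ^ a = (-1) ^ b := by
  by_cases ha : Even a
  · rw [ha.neg_one_zpow, (h.1 ha).neg_one_zpow]
  · have hb : ¬Even b := fun hb => ha (h.2 hb)
    rw [(Int.not_even_iff_odd.1 ha).neg_one_zpow, (Int.not_even_iff_odd.1 hb).neg_one_zpow]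

namespace LieGroupoid
variable {Γ : LieGroupoid m n M G}

theorem Str.left_face (s : Γ.Str) (i : ℕ) : (s.face i).left = s.left := by
  by_cases h : i < s.len - 1
  · rw [s.face_of_lt h]
  · rw [s.face_last (Nat.not_lt.1 h)]

section Total
open Classical
variable (E : GradedVB m M)

/-- All families of vectors of `E`, over all points and in all degrees. -/
abbrev TotalFib := ∀ (x : M) (l : ℤ), (E.deg l).Fib x

/-- Multiplication by `(-1)^l` in degree `l`. -/
def parity : Module.End ℝ (TotalFib E) where
  toFun w x l := (-1 : ℝ) ^ l • w x l
  map_add' v w := funext fun x => funext fun l => smul_add _ (v x l) (w x l)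
  map_smul' a w := funext fun x => funext fun l => smul_comm _ a (w x l)

variable {E}

theorem parity_apply (w : TotalFib E) (x : M) (l : ℤ) : parity E w x l = (-1 : ℝ) ^ l • w x l := rfl

theorem parity_pow_apply (j : ℕ) (w : TotalFib E) (x : M) (l : ℤ) :
    (parity E ^ j) w x l = (-1 : ℝ) ^ ((j : ℤ) * l) • w x l := by
  induction j with
  | zero => simp
  | succ j ih =>
    rw [pow_succ', Module.End.mul_apply, parity_apply, ih, smul_smul,
      ← zpow_add₀ (by norm_num : (-1 : ℝ) ≠ 0)]
    congr 2
    push_cast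
    ring

/-- The value of a cochain, extended by zero to the other points. -/
def extend (η : Γ.RawCochain E) (s : Γ.Str) : TotalFib E := Pi.single s.left (η s)

theorem extend_apply (η : Γ.RawCochain E) (s : Γ.Str) : extend η s s.left = η s :=
  Pi.single_eq_same _ _

theorem extend_of_ne (η : Γ.RawCochain E) {s : Γ.Str} {x : M} (h : x ≠ s.left) :
    extend η s x = 0 := Pi.single_eq_of_ne h _

/-- The components of degree `1 - k`, extended by zero to the other points. -/
def extendOp (R : Γ.Operators E) (s : Γ.Str) : Module.End ℝ (TotalFib E) :=
  LinearMap.single ℝ _ s.left ∘ₗ LinearMap.pi fun l =>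
    R s (l + s.len - 1) l ∘ₗ LinearMap.proj (l + s.len - 1) ∘ₗ LinearMap.proj s.right

variable (R : Γ.Operators E)

theorem extendOp_apply (s : Γ.Str) (w : TotalFib E) {l l' : ℤ} (h : l' = l + s.len - 1) :
    extendOp R s w s.left l = R s l' l (w s.right l') := by
  subst h
  exact congrFun (Pi.single_eq_same (M := fun x => ∀ l, (E.deg l).Fib x) s.left
    (fun l => R s (l + s.len - 1) l (w s.right (l + s.len - 1)))) l

theorem extendOp_of_ne {s : Γ.Str} (w : TotalFib E) {x : M} (h : x ≠ s.left) :
    extendOp R s w x = 0 := Pi.single_eq_of_ne h _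

theorem extendOp_parity (s : Γ.Str) (w : TotalFib E) :
    extendOp R s (parity E w) = (-1 : ℝ) ^ (s.len + 1) • parity E (extendOp R s w) := by
  funext x l
  rw [Pi.smul_apply, Pi.smul_apply, parity_apply]
  by_cases hx : x = s.left
  · subst hx
    rw [extendOp_apply R s _ rfl, extendOp_apply R s _ rfl, parity_apply, map_smul, smul_smul,
      ← zpow_natCast, ← zpow_add₀ (by norm_num : (-1 : ℝ) ≠ 0)]
    congr 1
    refine neg_one_zpow_congr ?_
    push_cast
    simp only [Int.even_add, Int.even_sub, Int.not_even_one]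
    tauto
  · rw [extendOp_of_ne R _ hx, extendOp_of_ne R _ hx, Pi.zero_apply, smul_zero, smul_zero]

/-- Extension by zero turns maps between different fibres into endomorphisms of one space. On a
string of `k` arrows the sign exponent is `j(k + 1) + jl` modulo `2`, and the part `jl` is the
`j`-th power of `parity`. -/
theorem extend_leftMul (η : Γ.RawCochain E) (s : Γ.Str) :
    extend (leftMul R η) s = opL (parity E) (extendOp R) (extend η) s := by
  funext x l
  rw [opL, Finset.sum_apply, Finset.sum_apply]
  by_cases hx : x = s.left
  · subst hx
    rw [extend_apply, leftMul]
    refine Finset.sum_congr rfl fun j hj => ?_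
    have hj' := Nat.lt_succ_iff.1 (Finset.mem_range.1 hj)
    rw [Pi.smul_apply, Pi.smul_apply, parity_pow_apply, smul_smul, ← zpow_natCast,
      ← zpow_add₀ (by norm_num : (-1 : ℝ) ≠ 0)]
    refine congrArg₂ _ (neg_one_zpow_congr ?_) ?_
    · push_cast
      simp only [Int.even_add, Int.even_mul, Int.even_sub, Int.not_even_one]
      tauto
    · refine Eq.trans ?_ (extendOp_apply R (s.take j) _ (l' := l + j - 1) ?_).symm
      · exact congrArg _ (congrFun (extend_apply η (s.drop j)).symm _)
      · rw [s.len_take hj']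
  · rw [extend_of_ne _ hx, Pi.zero_apply]
    refine (Finset.sum_eq_zero fun j _ => ?_).symm
    rw [Pi.smul_apply, Pi.smul_apply, parity_pow_apply, extendOp_of_ne R (s := s.take j) _ hx, Pi.zero_apply,
      smul_zero, smul_zero]

theorem extend_hatD (η : Γ.RawCochain E) (s : Γ.Str) :
    extend (hatD η) s = opH (parity E) (extend η) s := by
  funext x l
  rw [opH, Pi.smul_apply, Pi.smul_apply, parity_apply, Finset.sum_apply, Finset.sum_apply]
  by_cases hx : x = s.left
  · subst hx
    rw [extend_apply, hatD]
    by_cases h : s.arrows = []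
    · have h0 : s.len = 0 := by simp [Str.len, h]
      rw [if_pos h, h0, Finset.sum_range_zero, smul_zero, smul_zero]
    · obtain ⟨p, hp⟩ : ∃ p, s.len = p + 1 :=
        Nat.exists_eq_succ_of_ne_zero fun h0 => h (List.length_eq_zero_iff.1 h0)
      rw [if_neg h, hp, Nat.add_sub_cancel, Finset.sum_range_succ, smul_smul]
      refine congrArg₂ _ ?_ (congrArg₂ _ (Finset.sum_congr rfl fun i hi => ?_) ?_)
      · rw [← zpow_natCast, ← zpow_add₀ (by norm_num : (-1 : ℝ) ≠ 0)]
        refine neg_one_zpow_congr ?_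
        push_cast
        simp only [Int.even_add, Int.even_sub, Int.not_even_one]
      · rw [s.face_of_lt (by have := Finset.mem_range.1 hi; omega)]
        exact congrArg _ (congrFun (extend_apply η (s.contract i)).symm l)
      · rw [s.face_last (by omega), hp, Nat.add_sub_cancel]
        exact congrArg _ (congrFun (extend_apply η (s.take p)).symm l)
  · rw [extend_of_ne _ hx, Pi.zero_apply, Finset.sum_eq_zero, smul_zero, smul_zero]
    intro i _
    rw [Pi.smul_apply, extend_of_ne η (by rwa [s.left_face]), smul_zero, Pi.zero_apply]

theorem extend_star (η : Γ.RawCochain E) (f : Γ.Str → ℝ) (s : Γ.Str) :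
    extend (star η f) s = opStar (extend η) f s := by
  funext x l
  rw [opStar, Finset.sum_apply, Finset.sum_apply]
  by_cases hx : x = s.left
  · subst hx
    rw [extend_apply, star]
    refine Finset.sum_congr rfl fun j _ => ?_
    exact congrArg _ (congrFun (extend_apply η (s.take j)).symm l)
  · rw [extend_of_ne _ hx, Pi.zero_apply]
    refine (Finset.sum_eq_zero fun j _ => ?_).symm
    rw [Pi.smul_apply, extend_of_ne η (s := s.take j) hx, smul_zero, Pi.zero_apply]

theorem extend_injective {η ζ : Γ.RawCochain E} (h : ∀ s, extend η s = extend ζ s) : η = ζ := by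
  funext s
  rw [← extend_apply η, h, extend_apply]

theorem extend_add (η ζ : Γ.RawCochain E) (s : Γ.Str) :
    extend (η + ζ) s = extend η s + extend ζ s := Pi.single_add _ _ _

theorem extend_smul (a : ℝ) (η : Γ.RawCochain E) (s : Γ.Str) :
    extend (a • η) s = a • extend η s :=
  Pi.single_smul (f := fun x => ∀ l, (E.deg l).Fib x) s.left a (η s)

theorem extend_of_hasDegree {η : Γ.RawCochain E} {d : ℤ} (h : HasDegree d η) (s : Γ.Str) :
    parity E (extend η s) = ((-1 : ℝ) ^ d * (-1) ^ s.len) • extend η s := by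
  funext x l
  rw [parity_apply, Pi.smul_apply, Pi.smul_apply]
  by_cases hx : x = s.left
  · subst hx
    rw [extend_apply]
    by_cases hl : (s.len : ℤ) + l = d
    · rw [← zpow_natCast, ← zpow_add₀ (by norm_num : (-1 : ℝ) ≠ 0), ← hl]
      congr 1
      refine neg_one_zpow_congr ?_
      simp only [Int.even_add]
      tauto
    · rw [h s l hl, smul_zero, smul_zero]
  · rw [extend_of_ne _ hx, Pi.zero_apply, smul_zero, smul_zero]

variable {R}

/-- The target degree is freed to any integer equal to the prescribed one, so that the equation can
be read at a given target degree without casts. -/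
theorem StructureEquations.apply (h : StructureEquations R) (s : Γ.Str) {l l' : ℤ}
    (hl : l' = l + 2 - s.len) (v : (E.deg l).Fib s.right) :
    ∑ i ∈ Finset.range (s.len - 1), (-1 : ℝ) ^ (i + 1) •
        (R (s.contract i) l l' v : (E.deg l').Fib s.left) =
      ∑ j ∈ Finset.range (s.len + 1), (-1 : ℝ) ^ j •
        show (E.deg l').Fib s.left from
          R (s.take j) (l + 1 - (s.len - j)) l' (R (s.drop j) l (l + 1 - (s.len - j)) v) := by
  subst hl
  refine Eq.trans ?_ ((LinearMap.congr_fun (h s l) v).trans ?_)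
  · exact (LinearMap.sum_apply (R := ℝ) (R₂ := ℝ) (σ₁₂ := RingHom.id ℝ)
      (M := (E.deg l).Fib s.right) (M₂ := (E.deg (l + 2 - s.len)).Fib s.left) (Finset.range _)
      (fun i => (-1 : ℝ) ^ (i + 1) •
        show (E.deg l).Fib s.right →ₗ[ℝ] (E.deg (l + 2 - s.len)).Fib s.left from
          R (s.contract i) l (l + 2 - s.len)) v).symm
  · exact LinearMap.sum_apply (R := ℝ) (R₂ := ℝ) (σ₁₂ := RingHom.id ℝ)
      (M := (E.deg l).Fib s.right)
      (M₂ := (E.deg (l + 2 - s.len)).Fib s.left) _ _ _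

theorem StructureEquations.extendOp (h : StructureEquations R) (s : Γ.Str) (w : TotalFib E) :
    ∑ i ∈ Finset.range (s.len - 1), (-1 : ℝ) ^ (i + 1) • extendOp R (s.contract i) w =
      ∑ j ∈ Finset.range (s.len + 1), (-1 : ℝ) ^ j •
        LieGroupoid.extendOp R (s.take j) (LieGroupoid.extendOp R (s.drop j) w) := by
  funext x l
  rw [Finset.sum_apply, Finset.sum_apply, Finset.sum_apply, Finset.sum_apply]
  by_cases hx : x = s.left
  · subst hx
    refine Eq.trans (Finset.sum_congr rfl fun i hi => ?_)
      ((h.apply s (l := l + s.len - 2) (by ring) (w s.right _)).trans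
        (Finset.sum_congr rfl fun j hj => ?_))
    · have hi' := Finset.mem_range.1 hi
      refine congrArg _ (extendOp_apply R (s.contract i) w ?_)
      rw [s.len_contract hi']
      omega
    · have hj' := Nat.lt_succ_iff.1 (Finset.mem_range.1 hj)
      refine congrArg _ (Eq.symm ?_)
      refine (extendOp_apply R (s.take j) _ (l' := l + s.len - 2 + 1 - (s.len - j)) ?_).trans ?_
      · rw [s.len_take hj']
        ring
      · refine congrArg _ (extendOp_apply R (s.drop j) w ?_)
        rw [s.len_drop, Nat.cast_sub hj']
        ring
  · rw [Finset.sum_eq_zero, Finset.sum_eq_zero]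
    · intro j _
      rw [Pi.smul_apply, extendOp_of_ne R (s := s.take j) _ hx, smul_zero, Pi.zero_apply]
    · intro i _
      rw [Pi.smul_apply, extendOp_of_ne R (s := s.contract i) _ hx, smul_zero, Pi.zero_apply]

variable (R)

theorem leftMul_add (η ζ : Γ.RawCochain E) : leftMul R (η + ζ) = leftMul R η + leftMul R ζ := by
  funext s l
  simp only [leftMul, Pi.add_apply, map_add, smul_add, Finset.sum_add_distrib]

theorem leftMul_smul (a : ℝ) (η : Γ.RawCochain E) : leftMul R (a • η) = a • leftMul R η := by
  funext s l
  simp only [leftMul, Pi.smul_apply, map_smul, Finset.smul_sum, smul_comm a]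

theorem hatD_add (η ζ : Γ.RawCochain E) : hatD (η + ζ) = hatD η + hatD ζ := by
  funext s l
  by_cases h : s.arrows = []
  · simp [hatD, h]
  · simp only [hatD, Pi.add_apply, if_neg h, smul_add, Finset.sum_add_distrib]
    abel

theorem hatD_smul (a : ℝ) (η : Γ.RawCochain E) : hatD (a • η) = a • hatD η := by
  funext s l
  by_cases h : s.arrows = []
  · simp [hatD, h]
  · simp only [hatD, Pi.smul_apply, if_neg h, smul_add, Finset.smul_sum, smul_comm a]

variable {R}

theorem leftMul_add_hatD_square_zero (h : StructureEquations R) (η : Γ.RawCochain E) :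
    leftMul R (leftMul R η + hatD η) + hatD (leftMul R η + hatD η) = 0 := by
  refine extend_injective fun s => ?_
  have h0 := opL_add_opH_square_zero (ε := parity E) (R := extendOp R) (extend η)
    (extendOp_parity R) h.extendOp s
  have h1 : opL (parity E) (extendOp R) (extend η) = extend (leftMul R η) :=
    funext fun s => (extend_leftMul R η s).symm
  have h2 : opH (parity E) (extend η) = extend (hatD η) :=
    funext fun s => (extend_hatD η s).symm
  rw [h1, h2, ← extend_leftMul, ← extend_leftMul, ← extend_hatD, ← extend_hatD] at h0
  rw [leftMul_add, hatD_add, extend_add, extend_add, extend_add]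
  refine Eq.trans ?_ (h0.trans (Pi.single_zero _).symm)
  abel

variable (R)

theorem leftMul_add_hatD_star {d : ℤ} {η : Γ.RawCochain E} (h : HasDegree d η) (f : Γ.Str → ℝ) :
    leftMul R (star η f) + hatD (star η f) =
      star (leftMul R η + hatD η) f + (-1 : ℝ) ^ d • star η (scalarD f) := by
  refine extend_injective fun s => ?_
  have hs : ∀ (ζ : Γ.RawCochain E) f, extend (star ζ f) = opStar (extend ζ) f :=
    fun ζ f => funext (extend_star ζ f)
  have h1 : extend (leftMul R η + hatD η) =
      opL (parity E) (extendOp R) (extend η) + opH (parity E) (extend η) :=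
    funext fun s => by rw [extend_add, extend_leftMul, extend_hatD]; rfl
  rw [extend_add, extend_add, extend_smul, extend_leftMul, extend_hatD, hs, hs, hs, h1,
    opL_opStar, opH_opStar _ _ (extend_of_hasDegree h), ← add_assoc]
  congr 1
  simp only [opStar, Pi.add_apply, smul_add, Finset.sum_add_distrib]

end Total

end LieGroupoid

/-! ### Smoothness and finiteness of the resulting cochains. -/

section
variable {E' H' N : Type*} [NormedAddCommGroup E'] [NormedSpace ℝ E'] [TopologicalSpace H']
  {I' : ModelWithCorners ℝ E' H'} [TopologicalSpace N] [ChartedSpace H' N] {S : Set N}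

theorem contMDiffOn_arrows {k : ℕ} {f : N → Fin k → G}
    (h : ∀ a, ContMDiffOn I' (𝓡 n) ∞ (fun q => f q a) S) :
    ContMDiffOn I' (ModelWithCorners.pi (fun _ : Fin k => 𝓡 n)) ∞ f S := by
  intro x hx
  rw [contMDiffWithinAt_iff]
  refine ⟨continuousWithinAt_pi.2 fun a => (h a x hx).continuousWithinAt, ?_⟩
  exact contDiffWithinAt_pi.2 fun a => (contMDiffWithinAt_iff.1 (h a x hx)).2

theorem contMDiffOn_smul_section (V : SmoothVB m M) {φ : N → ℝ} {Φ : N → V.Tot}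
    (hφ : ContMDiffOn I' 𝓘(ℝ, ℝ) ∞ φ S) (h : ContMDiffOn I' V.J ∞ Φ S) :
    ContMDiffOn I' V.J ∞ (fun q => (⟨(Φ q).1, φ q • (Φ q).2⟩ : V.Tot)) S := by
  intro q₀ hq₀
  have k₁ := contMDiffWithinAt_totalSpace.1 (h q₀ hq₀)
  rw [contMDiffWithinAt_totalSpace]
  refine ⟨k₁.1, ((hφ q₀ hq₀).smul k₁.2).congr_of_eventuallyEq_of_mem ?_ hq₀⟩
  have hU := k₁.1.continuousWithinAt.preimage_mem_nhdsWithin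
    ((trivializationAt V.F V.Fib (Φ q₀).1).open_baseSet.mem_nhds
      (mem_baseSet_trivializationAt V.F V.Fib (Φ q₀).1))
  filter_upwards [hU] with q hq
  exact ((trivializationAt V.F V.Fib (Φ q₀).1).linear ℝ hq).map_smul _ _

end

namespace LieGroupoid
variable {Γ : LieGroupoid m n M G}

theorem SmoothSection.congr {V : SmoothVB m M} {k : ℕ} {v w : ∀ s : Γ.Str, V.Fib s.left}
    (hv : Γ.SmoothSection V k v) (h : ∀ s : Γ.Str, s.len = k → w s = v s) :
    Γ.SmoothSection V k w := by
  obtain ⟨Φ, hΦ, e⟩ := hv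
  exact ⟨Φ, hΦ, fun q y hq => by rw [e q y hq, h ⟨_, y, _, hq⟩ List.length_ofFn]⟩

theorem SmoothSection.sum_smul {V : SmoothVB m M} {k : ℕ} {ι : Type*} (t : Finset ι) (a : ι → ℝ)
    {v : ι → ∀ s : Γ.Str, V.Fib s.left} (h : ∀ i ∈ t, Γ.SmoothSection V k (v i)) :
    Γ.SmoothSection V k (fun s => ∑ i ∈ t, a i • v i s) := by
  classical
  induction t using Finset.induction_on with
  | empty => simpa using Γ.smoothSection_zero V k
  | insert i t hi ih =>
    refine ((ih fun j hj => h j (Finset.mem_insert_of_mem hj)).add_smul (a i)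
      (h i (Finset.mem_insert_self i t))).congr fun s _ => ?_
    rw [Finset.sum_insert hi, add_comm]

theorem SmoothSection.smul {V : SmoothVB m M} {k : ℕ} {v : ∀ s : Γ.Str, V.Fib s.left}
    (hv : Γ.SmoothSection V k v) (a : ℝ) : Γ.SmoothSection V k (fun s => a • v s) :=
  (SmoothSection.sum_smul (Finset.univ : Finset Unit) (fun _ => a) (v := fun _ => v)
    fun _ _ => hv).congr
    fun s _ => by simp

/-- `(g_1, …, g_k) ↦ (g_{j+1}, …, g_k)`. -/
def dropMap (k j : ℕ) (q : (Fin k → G) × M) : (Fin (k - j) → G) × M :=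
  (fun a => q.1 ⟨j + a, by omega⟩, q.2)

theorem ofFn_dropMap (k j : ℕ) (q : (Fin k → G) × M) :
    List.ofFn (dropMap k j q).1 = (List.ofFn q.1).drop j := by
  refine List.ext_getElem (by simp) fun a _ _ => ?_
  simp [dropMap]

theorem contMDiff_dropMap (k j : ℕ) :
    ContMDiff (stringModel m n k) (stringModel m n (k - j)) ∞ (dropMap (M := M) (G := G) k j) := by
  rw [← contMDiffOn_univ]
  refine ContMDiffOn.prodMk (contMDiffOn_arrows fun a => ContMDiff.contMDiffOn ?_)
    contMDiff_snd.contMDiffOn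
  exact (contMDiff_arrow _).comp contMDiff_fst

variable (Γ) in
/-- `(g_1, …, g_k) ↦ (g_1, …, g_j)`. -/
def takeMap (k j : ℕ) (hj : j ≤ k) (q : (Fin k → G) × M) : (Fin j → G) × M :=
  (fun a => q.1 ⟨a, by omega⟩, Γ.vertex ((List.ofFn q.1).drop j) q.2)

theorem ofFn_takeMap (k j : ℕ) (hj : j ≤ k) (q : (Fin k → G) × M) :
    List.ofFn (Γ.takeMap k j hj q).1 = (List.ofFn q.1).take j := by
  refine List.ext_getElem (by simp [hj]) fun a _ _ => ?_
  simp [takeMap]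

theorem contMDiff_takeMap (k j : ℕ) (hj : j ≤ k) :
    ContMDiff (stringModel m n k) (stringModel m n j) ∞ (Γ.takeMap k j hj) := by
  rw [← contMDiffOn_univ]
  refine ContMDiffOn.prodMk (contMDiffOn_arrows fun a => ContMDiff.contMDiffOn ?_)
    (ContMDiff.contMDiffOn ?_)
  · exact (contMDiff_arrow _).comp contMDiff_fst
  · refine ((contMDiff_vertex (Γ := Γ) (k - j)).comp (contMDiff_dropMap k j)).congr fun q => ?_
    rw [Function.comp_apply, ofFn_dropMap]
    rfl

variable (Γ) in
/-- `(g_1, …, g_k) ↦ (g_1, …, g_{i+1}g_{i+2}, …, g_k)`. -/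
def contractMap (k i : ℕ) (hi : i < k - 1) (q : (Fin k → G) × M) : (Fin (k - 1) → G) × M :=
  (fun a => if (a : ℕ) < i then q.1 ⟨a, by omega⟩ else if (a : ℕ) = i then
    Γ.mul (q.1 ⟨i, by omega⟩) (q.1 ⟨i + 1, by omega⟩) else q.1 ⟨a + 1, by omega⟩, q.2)

theorem getElem_contract (p : List G) {i a : ℕ} (hi : i < p.length - 1)
    (ha : a < (Γ.contract i p).length) (ha' : a < p.length - 1) : (Γ.contract i p)[a] =
      if a < i then p[a] else if a = i then Γ.mul p[i] p[i + 1] else p[a + 1] := by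
  induction p generalizing i a with
  | nil => simp at hi
  | cons g p ih =>
    cases i with
    | zero =>
      cases p with
      | nil => simp at hi
      | cons k p => cases a <;> simp [contract]
    | succ i =>
      simp only [List.length_cons, Nat.add_sub_cancel] at hi ha'
      cases a with
      | zero => simp [contract]
      | succ a =>
        have := ih (i := i) (a := a) (by omega) (by simpa [contract] using ha) (by omega)
        simp [contract, this]

theorem ofFn_contractMap (k i : ℕ) (hi : i < k - 1) (q : (Fin k → G) × M) :
    List.ofFn (Γ.contractMap k i hi q).1 = Γ.contract i (List.ofFn q.1) := by
  have hl : i < (List.ofFn q.1).length - 1 := by simpa using hi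
  refine List.ext_getElem ?_ fun a h1 h2 => ?_
  · rw [length_contract _ _ hl, List.length_ofFn, List.length_ofFn]
  · rw [getElem_contract _ hl h2 (by simpa using h1)]
    simp [contractMap]

theorem IsString.composable {p : List G} {y x : M} (h : Γ.IsString p y x) {i : ℕ}
    (hi : i + 1 < p.length) : Γ.src p[i] = Γ.tgt p[i + 1] := by
  induction p generalizing i y with
  | nil => simp at hi
  | cons g p ih =>
    cases i with
    | zero =>
      cases p with
      | nil => simp at hi
      | cons k p => exact h.2.1.symm
    | succ i => exact ih h.2 (by simpa using hi)

theorem contMDiffOn_contractMap (k i : ℕ) (hi : i < k - 1) :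
    ContMDiffOn (stringModel m n k) (stringModel m n (k - 1)) ∞ (Γ.contractMap k i hi)
      (Γ.nerve k) := by
  refine ContMDiffOn.prodMk (contMDiffOn_arrows fun a => ?_) contMDiff_snd.contMDiffOn
  have ha : ∀ b : Fin k, ContMDiffOn (stringModel m n k) (𝓡 n) ∞
      (fun q : (Fin k → G) × M => q.1 b) (Γ.nerve k) := fun b =>
    ((contMDiff_arrow b).comp contMDiff_fst).contMDiffOn
  split_ifs
  · exact ha _
  · refine Γ.contMDiffOn_mul.comp ((ha _).prodMk (ha _)) ?_
    rintro q ⟨y, hq⟩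
    have := hq.composable (i := i) (by simp; omega)
    simpa using this
  · exact ha _

/-- The conclusion is not a `SmoothSection`, because the string `θ s` may have another left end than
`s`, as it does for final segments. -/
theorem SmoothSection.comp {V : SmoothVB m M} {k k' : ℕ} {v : ∀ s : Γ.Str, V.Fib s.left}
    (hv : Γ.SmoothSection V k' v) (θ : Γ.Str → Γ.Str) {ψ : (Fin k → G) × M → (Fin k' → G) × M}
    (hψ : ContMDiffOn (stringModel m n k) (stringModel m n k') ∞ ψ (Γ.nerve k))
    (hθ : ∀ q y (h : Γ.IsString (List.ofFn q.1) y q.2),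
      List.ofFn (ψ q).1 = (θ ⟨_, y, _, h⟩).arrows ∧ (ψ q).2 = (θ ⟨_, y, _, h⟩).right) :
    ∃ Φ : (Fin k → G) × M → V.Tot, ContMDiffOn (stringModel m n k) V.J ∞ Φ (Γ.nerve k) ∧
      ∀ q y (h : Γ.IsString (List.ofFn q.1) y q.2),
        Φ q = ⟨(θ ⟨_, y, _, h⟩).left, v (θ ⟨_, y, _, h⟩)⟩ := by
  obtain ⟨Φ, hΦ, e⟩ := hv
  refine ⟨Φ ∘ ψ, hΦ.comp hψ ?_, fun q y h => ?_⟩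
  · rintro q ⟨y, h⟩
    obtain ⟨h1, h2⟩ := hθ q y h
    refine ⟨(θ ⟨_, y, _, h⟩).left, ?_⟩
    rw [h1, h2]
    exact (θ ⟨_, y, _, h⟩).isString
  · obtain ⟨h1, h2⟩ := hθ q y h
    rw [Function.comp_apply]
    generalize θ ⟨_, y, _, h⟩ = t at *
    generalize ψ q = r at *
    obtain ⟨p, y', x', h'⟩ := t
    obtain ⟨a, b⟩ := r
    obtain rfl : b = x' := h2
    obtain rfl : List.ofFn a = p := h1
    exact e (a, b) y' h'

theorem SmoothFunction.comp {k k' : ℕ} {f : Γ.Str → ℝ}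
    (hf : Γ.SmoothFunction k' f) (θ : Γ.Str → Γ.Str) {ψ : (Fin k → G) × M → (Fin k' → G) × M}
    (hψ : ContMDiffOn (stringModel m n k) (stringModel m n k') ∞ ψ (Γ.nerve k))
    (hθ : ∀ q y (h : Γ.IsString (List.ofFn q.1) y q.2),
      List.ofFn (ψ q).1 = (θ ⟨_, y, _, h⟩).arrows ∧ (ψ q).2 = (θ ⟨_, y, _, h⟩).right) :
    Γ.SmoothFunction k (fun s => f (θ s)) := by
  obtain ⟨Φ, hΦ, e⟩ := hf
  refine ⟨Φ ∘ ψ, hΦ.comp hψ ?_, fun q y h => ?_⟩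
  · rintro q ⟨y, h⟩
    obtain ⟨h1, h2⟩ := hθ q y h
    refine ⟨(θ ⟨_, y, _, h⟩).left, ?_⟩
    rw [h1, h2]
    exact (θ ⟨_, y, _, h⟩).isString
  · obtain ⟨h1, h2⟩ := hθ q y h
    change _ = f (θ _)
    rw [Function.comp_apply]
    generalize θ ⟨_, y, _, h⟩ = t at *
    generalize ψ q = r at *
    obtain ⟨p, y', x', h'⟩ := t
    obtain ⟨a, b⟩ := r
    obtain rfl : b = x' := h2
    obtain rfl : List.ofFn a = p := h1
    exact e (a, b) y' h'

theorem SmoothSection.take {V : SmoothVB m M} {k j : ℕ} (hj : j ≤ k)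
    {v : ∀ s : Γ.Str, V.Fib s.left} (hv : Γ.SmoothSection V j v) :
    Γ.SmoothSection V k (fun s => v (s.take j)) :=
  hv.comp (fun s => s.take j) (contMDiff_takeMap k j hj).contMDiffOn
    fun q _ _ => ⟨ofFn_takeMap k j hj q, rfl⟩

theorem SmoothSection.contract {V : SmoothVB m M} {k i : ℕ} (hi : i < k - 1)
    {v : ∀ s : Γ.Str, V.Fib s.left} (hv : Γ.SmoothSection V (k - 1) v) :
    Γ.SmoothSection V k (fun s => v (s.contract i)) :=
  hv.comp (fun s => s.contract i) (contMDiffOn_contractMap k i hi)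
    fun q _ _ => ⟨ofFn_contractMap k i hi q, rfl⟩

theorem SmoothSection.smul_function {V : SmoothVB m M} {k : ℕ} {v : ∀ s : Γ.Str, V.Fib s.left}
    {f : Γ.Str → ℝ} (hv : Γ.SmoothSection V k v) (hf : Γ.SmoothFunction k f) :
    Γ.SmoothSection V k (fun s => f s • v s) := by
  obtain ⟨Φ, hΦ, e⟩ := hv
  obtain ⟨φ, hφ, e'⟩ := hf
  exact ⟨_, contMDiffOn_smul_section V hφ hΦ, fun q y h => by rw [e q y h, e' q y h]⟩

/-- The right end of the initial segment is by definition the left end of the final one, so the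
smooth bundle map can be composed with the smooth section over the cut vertex. -/
theorem SmoothHom.apply_drop {V W : SmoothVB m M} {k j : ℕ} (hj : j ≤ k)
    {T : ∀ s : Γ.Str, V.Fib s.right →ₗ[ℝ] W.Fib s.left} (hT : Γ.SmoothHom V W j T)
    {v : ∀ s : Γ.Str, V.Fib s.left} (hv : Γ.SmoothSection V (k - j) v) :
    Γ.SmoothSection W k (fun s => T (s.take j) (v (s.drop j))) := by
  obtain ⟨Φ, hΦ, e⟩ := hv.comp (k := k) (fun s => s.drop j) (contMDiff_dropMap k j).contMDiffOn
    fun q _ _ => ⟨ofFn_dropMap k j q, rfl⟩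
  obtain ⟨Ψ, hΨ, e'⟩ := hT
  have ht : ∀ q y, Γ.IsString (List.ofFn q.1) y q.2 →
      Γ.IsString (List.ofFn (Γ.takeMap k j hj q).1) y (Γ.vertex ((List.ofFn q.1).drop j) q.2) := by
    intro q y h
    rw [ofFn_takeMap]
    exact h.take j
  refine ⟨fun q => Ψ ((Γ.takeMap k j hj q).1, Φ q), hΨ.comp
    (ContMDiffOn.prodMk (contMDiff_fst.comp (contMDiff_takeMap k j hj)).contMDiffOn hΦ) ?_,
    fun q y h => ?_⟩
  · rintro q ⟨y, h⟩
    refine ⟨y, ?_⟩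
    simp only [e q y h]
    exact ht q y h
  · simp only [e q y h]
    refine (e' _ y _ (ht q y h) _).trans ?_
    have key : ∀ (p p' : List G) (hp : p = p') (x : M) (h1 : Γ.IsString p y x)
        (h2 : Γ.IsString p' y x) (w : V.Fib x),
        T ⟨p, y, x, h1⟩ w = T ⟨p', y, x, h2⟩ w := by
      rintro p _ rfl x _ _ w
      rfl
    exact congrArg (TotalSpace.mk y) (key _ _ (ofFn_takeMap k j hj q) _ _ _ _)

variable {E : GradedVB m M} {R : Γ.Operators E}

theorem smoothSection_leftMul (hR : IsOperatorSequence R) {η : Γ.RawCochain E}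
    (hη : ∀ k l, Γ.SmoothSection (E.deg l) k (fun s => η s l)) (k : ℕ) (l : ℤ) :
    Γ.SmoothSection (E.deg l) k (fun s => leftMul R η s l) := by
  refine (SmoothSection.sum_smul (Finset.range (k + 1))
    (fun j => (-1 : ℝ) ^ ((j : ℤ) * ((k - j : ℤ) + (l + j - 1))))
    (v := fun j s => R (s.take j) (l + j - 1) l (η (s.drop j) (l + j - 1)))
    fun j hj => ?_).congr fun s hs => ?_
  · exact (hR.smooth j (l + j - 1) l).apply_drop (Nat.lt_succ_iff.1 (Finset.mem_range.1 hj))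
      (hη (k - j) (l + j - 1))
  · subst hs
    rfl

theorem smoothSection_hatD {η : Γ.RawCochain E}
    (hη : ∀ k l, Γ.SmoothSection (E.deg l) k (fun s => η s l)) (k : ℕ) (l : ℤ) :
    Γ.SmoothSection (E.deg l) k (fun s => hatD η s l) := by
  obtain _ | k := k
  · refine (Γ.smoothSection_zero (E.deg l) 0).congr fun s hs => ?_
    rw [hatD, if_pos (List.length_eq_zero_iff.1 hs)]
  · refine (((SmoothSection.sum_smul (Finset.range k) (fun i => (-1 : ℝ) ^ (i + 1))
      (v := fun i s => η (s.contract i) l) fun i hi => ?_).add_smul ((-1 : ℝ) ^ (k + 1))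
      ((hη k l).take (Nat.le_succ k))).smul ((-1 : ℝ) ^ ((k : ℤ) + l))).congr fun s hs => ?_
    · exact SmoothSection.contract (k := k + 1) (by simpa using hi) (hη k l)
    · have h0 : s.arrows ≠ [] := by
        intro h
        simp [Str.len, h] at hs
      rw [hatD, if_neg h0, hs, Nat.succ_eq_add_one, Nat.add_sub_cancel, Nat.cast_succ,
        add_sub_cancel_right]

theorem smoothSection_star {η : Γ.RawCochain E} {f : Γ.Str → ℝ}
    (hη : ∀ k l, Γ.SmoothSection (E.deg l) k (fun s => η s l)) (hf : ∀ k, Γ.SmoothFunction k f)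
    (k : ℕ) (l : ℤ) : Γ.SmoothSection (E.deg l) k (fun s => star η f s l) := by
  refine (SmoothSection.sum_smul (Finset.range (k + 1)) (fun j => (-1 : ℝ) ^ (j * (k - j)))
    (v := fun j s => f (s.drop j) • η (s.take j) l) fun j hj => ?_).congr fun s hs => ?_
  · exact ((hη j l).take (Nat.lt_succ_iff.1 (Finset.mem_range.1 hj))).smul_function
      ((hf (k - j)).comp (fun s => s.drop j) (contMDiff_dropMap k j).contMDiffOn
        fun q _ _ => ⟨ofFn_dropMap k j q, rfl⟩)
  · subst hs
    exact Finset.sum_congr rfl fun j _ => mul_smul _ _ _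

theorem leftMul_add_hatD_mem (hR : IsOperatorSequence R) {η : Γ.RawCochain E}
    (hη : η ∈ Γ.Cochain E) : leftMul R η + hatD η ∈ Γ.Cochain E := by
  obtain ⟨hs, N, hN⟩ := hη
  obtain ⟨B, hB⟩ := E.bounded
  -- If both `E^l` and `E^{l+j-1}` are nonzero then `j ≤ 2B + 1`. On a string with more than `N + 2B
  -- + 2` arrows, the part left for `η` is still longer than `N`.
  refine ⟨fun k l => ?_, N + 2 * B + 2, fun s l h => ?_⟩
  · simpa using (smoothSection_leftMul hR hs k l).add_smul 1 (smoothSection_hatD hs k l)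
  by_cases hl : (B : ℤ) < |l|
  · exact @Subsingleton.elim _ (hB l hl _) _ _
  have hlen : N + 2 * B + 2 < s.len := by
    rcases h with h | h
    · exact h
    · push_cast at h
      omega
  have h1 : leftMul R η s l = 0 := by
    refine Finset.sum_eq_zero fun j hj => ?_
    have h0 : η (s.drop j) (l + j - 1) = 0 := by
      by_cases hl' : (B : ℤ) < |l + j - 1|
      · exact @Subsingleton.elim _ (hB _ hl' _) _ _
      · refine hN _ _ (Or.inl ?_)
        rw [s.len_drop]
        rw [not_lt, abs_le] at hl hl'
        omega
    rw [h0]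
    exact (congrArg _ (map_zero _)).trans (smul_zero _)
  have h2 : hatD η s l = 0 := by
    rw [hatD]
    split_ifs with h0
    · rfl
    · rw [hN (s.take (s.len - 1)) l (Or.inl (by rw [s.len_take (by omega)]; omega)), smul_zero,
        add_zero, Finset.sum_eq_zero, smul_zero]
      intro i hi
      rw [hN (s.contract i) l (Or.inl (by
        rw [s.len_contract (Finset.mem_range.1 hi)]; omega)), smul_zero]
  change leftMul R η s l + hatD η s l = 0
  rw [h1, h2, add_zero]

theorem star_mem {η : Γ.RawCochain E} (hη : η ∈ Γ.Cochain E) {r : ℕ} {f : Γ.Str → ℝ}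
    (hf : IsScalarCochain r f) : star η f ∈ Γ.Cochain E := by
  obtain ⟨hs, N, hN⟩ := hη
  -- Only the cut leaving exactly `r` arrows for `f` contributes, so beyond `N + r` arrows the part
  -- for `η` is longer than `N`.
  refine ⟨fun k l => smoothSection_star hs hf.1 k l, N + r, fun s l h => ?_⟩
  refine Finset.sum_eq_zero fun j hj => ?_
  have hj' := Nat.lt_succ_iff.1 (Finset.mem_range.1 hj)
  by_cases hr : (s.drop j).len = r
  · rw [s.len_drop] at hr
    rw [hN (s.take j) l (by rw [s.len_take hj']; omega), smul_zero]
  · rw [hf.2 _ hr, mul_zero, zero_smul]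

theorem HasDegree.leftMul_add_hatD {η : Γ.RawCochain E} {d : ℤ} (h : HasDegree d η) :
    HasDegree (d + 1) (leftMul R η + hatD η) := by
  intro s l hd
  have h1 : leftMul R η s l = 0 := by
    refine Finset.sum_eq_zero fun j hj => ?_
    have hj' := Nat.lt_succ_iff.1 (Finset.mem_range.1 hj)
    rw [h (s.drop j) _ (by rw [s.len_drop, Nat.cast_sub hj']; omega)]
    exact (congrArg _ (map_zero _)).trans (smul_zero _)
  have h2 : hatD η s l = 0 := by
    rw [hatD]
    split_ifs with h0
    · rfl
    · have hlen : s.len ≠ 0 := fun h => h0 (List.length_eq_zero_iff.1 h)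
      rw [h (s.take (s.len - 1)) l (by rw [s.len_take (by omega)]; omega), smul_zero,
        add_zero, Finset.sum_eq_zero, smul_zero]
      intro i hi
      rw [h (s.contract i) l (by rw [s.len_contract (Finset.mem_range.1 hi)]; omega), smul_zero]
  change leftMul R η s l + hatD η s l = 0
  rw [h1, h2, add_zero]

/-- The structure equations make `D(η) = ∑ₖ R_k ⋆ η + D̂_0(η)` a representation up to homotopy. -/
def RepUpToHomotopy.ofOperators (hR : IsOperatorSequence R) (h : StructureEquations R) :
    Γ.RepUpToHomotopy E where
  D :=
    { toFun := fun η => ⟨leftMul R η.1 + hatD η.1, leftMul_add_hatD_mem hR η.2⟩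
      map_add' := fun η ζ => Subtype.ext <| by
        change leftMul R (η.1 + ζ.1) + hatD (η.1 + ζ.1) =
          leftMul R η.1 + hatD η.1 + (leftMul R ζ.1 + hatD ζ.1)
        rw [leftMul_add, hatD_add]
        abel
      map_smul' := fun a η => Subtype.ext <| by
        change leftMul R (a • η.1) + hatD (a • η.1) = a • (leftMul R η.1 + hatD η.1)
        rw [leftMul_smul, hatD_smul, smul_add] }
  degree_one _ _ hd := hd.leftMul_add_hatD
  square_zero η := Subtype.ext (leftMul_add_hatD_square_zero h η.1)
  leibniz _ _ η f hd hf := ⟨star_mem η.2 hf, leftMul_add_hatD_star R hd f⟩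

theorem RepUpToHomotopy.hasComponents_ofOperators (hR : IsOperatorSequence R)
    (h : StructureEquations R) : (ofOperators hR h).HasComponents R := fun _ => rfl

end LieGroupoid

end LieGpd

end

theorem mainTheorem5 {m n : ℕ} {M G : Type*}
    [TopologicalSpace M] [ChartedSpace (EuclideanSpace ℝ (Fin m)) M] [IsManifold (𝓡 m) ∞ M]
    [TopologicalSpace G] [ChartedSpace (EuclideanSpace ℝ (Fin n)) G] [IsManifold (𝓡 n) ∞ G]
    (Γ : LieGpd.LieGroupoid m n M G) (c : Γ.Connection) :
    -- `ω ∘ r = Id` and `r ∘ ω + σ ∘ ds = Id`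
    (∀ (g : G) (y x : M), Γ.tgt g = y → Γ.src g = x →
      (∀ α : Γ.Alg y, c.omega g y (Γ.rightTr g y α) = α) ∧
      ∀ X : TangentSpace (𝓡 n) g,
        Γ.rightTr g y (c.omega g y X) + c.sig g x (Γ.dsrc g X) = X) ∧
    -- `r_{gh} (K(g, h) X) = dm(σ_g (λ_h X), σ_h X) - σ_{gh} X`
    (∀ (g h : G) (z y x : M), Γ.tgt g = z → Γ.src g = y → Γ.tgt h = y → Γ.src h = x →
      ∀ X : TangentSpace (𝓡 m) x,
        Γ.rightTr (Γ.mul g h) z (c.Kbas g h z y x X) =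
          Γ.dmul g h (c.sig g y (c.lamT h y x X), c.sig h x X) - c.sig (Γ.mul g h) x X) ∧
    -- equivariance of the anchor
    (∀ (g : G) (y x : M), Γ.tgt g = y → Γ.src g = x → ∀ α : Γ.Alg x,
      Γ.anchor y (c.lamA g y x α) = c.lamT g y x (Γ.anchor x α)) ∧
    -- the curvature identities
    (∀ (g h : G) (z y x : M), Γ.tgt g = z → Γ.src g = y → Γ.tgt h = y → Γ.src h = x →
      (∀ X : TangentSpace (𝓡 m) x,
        c.lamT g z y (c.lamT h y x X) - c.lamT (Γ.mul g h) z x X =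
          Γ.anchor z (c.Kbas g h z y x X)) ∧
      ∀ α : Γ.Alg x,
        c.lamA g z y (c.lamA h y x α) - c.lamA (Γ.mul g h) z x α =
          c.Kbas g h z y x (Γ.anchor x α)) ∧
    -- the cocycle equation
    (∀ (g h k : G) (z y x w : M), Γ.tgt g = z → Γ.src g = y → Γ.tgt h = y → Γ.src h = x →
      Γ.tgt k = x → Γ.src k = w → ∀ X : TangentSpace (𝓡 m) w,
        c.lamA g z y (c.Kbas h k y x w X) - c.Kbas (Γ.mul g h) k z x w X +
          c.Kbas g (Γ.mul h k) z y w X - c.Kbas g h z y x (c.lamT k x w X) = 0) ∧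
    -- `R_0 = ρ`, `R_1 = λ`, `R_2 = K` make the adjoint complex a unital representation up to homotopy
    LieGpd.LieGroupoid.IsOperatorSequence c.adOps ∧
    LieGpd.LieGroupoid.StructureEquations c.adOps ∧
    LieGpd.LieGroupoid.IsUnital c.adOps ∧
    ∃ 𝓓 : Γ.RepUpToHomotopy Γ.adj, 𝓓.HasComponents c.adOps := by
  refine ⟨fun g y x hg hx => ⟨fun α => c.omega_rtr hg α, fun X => ?_⟩,
    fun g h z y x hz hy hy' hx X => ?_, fun g y x hg hx α => c.anc_lamA hg hx α,
    fun g h z y x hz hy hy' hx => ⟨fun X => ?_, fun α => c.lamA_lamA hz hy hy' hx α⟩,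
    fun g h k z y x w hz hy hy' hx hx' hw X => ?_, c.isOperatorSequence_adOps,
    c.structureEquations_adOps, c.isUnital_adOps,
    _, LieGpd.LieGroupoid.RepUpToHomotopy.hasComponents_ofOperators c.isOperatorSequence_adOps
      c.structureEquations_adOps⟩
  · obtain rfl := hx
    exact (congrArg (· + c.split g (Γ.tsrc g X)) (c.rtr_omega hg X)).trans (sub_add_cancel _ _)
  · exact c.rtr_Kbas hz hy hy' X
  · exact c.act_act hz hy hy' X
  · exact c.Kbas_cocycle hz hy hy' hx hx' X
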